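/- **Setting.** Let $\mathcal X$ be the covariate space (for instance a subset of $\mathbb R^p$), $\mathcal T,\mathcal Y\subset\mathbb R$ measurable, $(X,T,Y)$ random with values in $\mathcal X\times\mathcal T\times\mathcal Y$, and $\tau$ an interior point of $\mathcal T$, say $(\tau-d,\tau+d)\subset\mathcal T$ with $d>0$. Let $\Gamma\ge 1$ and $\gamma=\Gamma/(1+\Gamma)$. Let $f(t|x)$ be the conditional density of $T$ given $X=x$ and $f(y|x,t)$ that of $Y$ given $X=x,T=t$. Put $\eta(t,x)=E[Y|X=x,T=t]$ and let $q_\upsilon^{x,t}=\inf\{q: P(Y\le q|X=x,T=t)>\upsilon\}$ be the conditional quantile. Let $\mathcal W$ be the set of functions $w:\mathcal Y\times\mathcal X\times\mathcal T\to[\Gamma^{-1},\Gamma]$ (measurable in $y$) with $E[w(Y,x,t)|X=x,T=t]=1$ for all $(x,t)$. The bounds for the average potential outcome are $\theta^\pm(\tau)=E[\theta^\pm(\tau,X)]$, where $\theta^+(\tau,x)$ (resp. $\theta^-(\tau,x)$) is $\eta(\tau,x)$ plus the supremum (resp. infimum) over $w\in\mathcal W$ of $E[(Y-\eta(\tau,x))\,w(Y,x,\tau)\,|\,X=x,T=\tau]$.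 Given i.i.d. copies $(X_i,T_i,Y_i)$ of $(X,T,Y)$, a kernel $K$, a bandwidth $h>0$ and $K_h(s)=K(s/h)/h$, put $q_+^{x,t}=q_\gamma^{x,t}$, $q_-^{x,t}=q_{1-\gamma}^{x,t}$, $R_i=\frac{K_h(T_i-\tau)}{f(T_i|X_i)}(Y_i-\eta(T_i,X_i))$, $I_+=\{i\le n:Y_i>q_+^{X_i,T_i}\}$, $I_-=\{i\le n:Y_i\le q_-^{X_i,T_i}\}$ and $n_\pm=|I_\pm|$. The estimator $\tilde\theta_h^\pm(\tau)$ is either of $$\frac1n\sum_{i=1}^n\eta(\tau,X_i)+\frac{2\gamma-1}{\gamma n_\pm}\sum_{i\in I_\pm}R_i,\qquad \frac1n\sum_{i=1}^n\eta(\tau,X_i)+\frac1n\sum_{i=1}^nR_i\,\Gamma^{\pm\mathrm{sign}(Y_i-q_\pm^{X_i,T_i})}$$ (the second term of the first form is $0$ if $n_\pm=0$). Its mean squared error is $\mathrm{MSE}_n^\pm(h)=E[(\tilde\theta_h^\pm(\tau)-\theta^\pm(\tau))^2]$. **Assumptions.** 1. $f(t|x)\ge m_f>0$ and $f(y|x,t)>0$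 for all $x\in\mathcal X$, $t\in\mathcal T$, $y\in\mathcal Y$. 2. $K\ge0$ is symmetric and integrable with $\int_{\mathbb R}K=1$, $\int K^2\le M_{K^2}<\infty$ and $\int u^2K(u)\,du\le M_{u^2K}<\infty$. 3. $|y|\le M_Y$ for all $y\in\mathcal Y$. 4. For all $x,y$, $t\mapsto f(y|x,t)$ is $C^2$ on $\mathcal T$ with second derivative bounded by $M_{\partial^2f}$, and $f(y|x,\tau)\le\|f\|_\infty<\infty$. 5. For all $x$ and $\upsilon\in[0,1)$, $t\mapsto q_\upsilon^{x,t}$ is $C^2$ on $\mathcal T$ with second derivative bounded by $M_{\partial^2Q}$. **Theorem 2.** There are constants $C_1,C_2,C>0$, depending only on $\Gamma,m_f,M_Y,M_{K^2},M_{u^2K},\|f\|_\infty,M_{\partial^2f},M_{\partial^2Q}$ and $d$, such that under these assumptions, for both signs and both forms of the estimator, the following hold. - For all $n\ge1$ and $h>0$, $\tilde\theta_h^\pm(\tau)\in L^2$ and $$\mathrm{MSE}_n^\pm(h)\le \frac{C_1}{nh}+\frac{C_2}{n}+C\,h^4 .$$ - For each $n\ge1$ this upper bound has a unique minimizer $h_n^\star$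 over $h>0$; it satisfies $h_n^\star=O(n^{-1/5})$, and $\mathrm{MSE}_n^\pm(h_n^\star)=O(n^{-4/5})$ as $n\to\infty$. - If $h_n>0$, $h_n\to0$ and $nh_n\to\infty$, then $\tilde\theta^\pm_{h_n}(\tau)\to\theta^\pm(\tau)$ in $L^2$. -/

import Mathlib

open MeasureTheory ProbabilityTheory Set Filter Topology Asymptotics

namespace APOBounds

/-! ### Conditional laws, conditional means, conditional quantiles

`fT x t` is the density of the treatment `T` at `t` given `X = x` (on the treatment set `𝒯`), and
`fY x t y` the density of the outcome `Y` at `y` given `X = x`, `T = t` (on the outcome set `𝒴`). -/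

/-- The law of `Y` conditionally on `X = x` and `T = t`. -/
noncomputable def condLaw {𝒳 : Type*} (𝒴 : Set ℝ) (fY : 𝒳 → ℝ → ℝ → ℝ) (x : 𝒳) (t : ℝ) :
    Measure ℝ :=
  (volume.restrict 𝒴).withDensity fun y => ENNReal.ofReal (fY x t y)

/-- The joint law of `(X, T, Y)` when `X` has law `PX`, `T` has conditional density `fT x` on `𝒯`
given `X = x`, and `Y` has conditional density `fY x t` on `𝒴` given `X = x`, `T = t`. -/
noncomputable def jointLaw {𝒳 : Type*} [MeasurableSpace 𝒳] (PX : Measure 𝒳) (𝒯 𝒴 : Set ℝ)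
    (fT : 𝒳 → ℝ → ℝ) (fY : 𝒳 → ℝ → ℝ → ℝ) : Measure (𝒳 × ℝ × ℝ) :=
  (PX.prod ((volume.restrict 𝒯).prod (volume.restrict 𝒴))).withDensity
    fun p => ENNReal.ofReal (fT p.1 p.2.1 * fY p.1 p.2.1 p.2.2)

/-- `η(t, x) = E[Y | X = x, T = t]`. -/
noncomputable def condMean {𝒳 : Type*} (𝒴 : Set ℝ) (fY : 𝒳 → ℝ → ℝ → ℝ) (t : ℝ) (x : 𝒳) : ℝ :=
  ∫ y, y ∂(condLaw 𝒴 fY x t)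

/-- The generalized conditional quantile `inf {q : P(Y ≤ q | X = x, T = t) > υ}`. -/
noncomputable def condQuantile {𝒳 : Type*} (𝒴 : Set ℝ) (fY : 𝒳 → ℝ → ℝ → ℝ) (υ : ℝ) (x : 𝒳)
    (t : ℝ) : ℝ :=
  sInf {q : ℝ | υ < (condLaw 𝒴 fY x t).real (Iic q)}

/-! ### Bounds for the (conditional) average potential outcome -/

/-- The lower and the upper bound. -/
inductive Side
  | lower
  | upper

/-- Weight functions `w(y, x, t)` with values in `[Γ⁻¹, Γ]` and
`E[w(Y, x, t) | X = x, T = t] = 1` for all `x` and all `t ∈ 𝒯`. -/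
def weights {𝒳 : Type*} (Γ : ℝ) (𝒯 𝒴 : Set ℝ) (fY : 𝒳 → ℝ → ℝ → ℝ) : Set (ℝ → 𝒳 → ℝ → ℝ) :=
  {w | (∀ x t, Measurable fun y => w y x t) ∧ (∀ y x t, w y x t ∈ Icc Γ⁻¹ Γ) ∧
    ∀ x, ∀ t ∈ 𝒯, ∫ y, w y x t ∂(condLaw 𝒴 fY x t) = 1}

/-- `E[(Y - η(τ, x)) w(Y, x, τ) | X = x, T = τ]`. -/
noncomputable def weightedMean {𝒳 : Type*} (𝒴 : Set ℝ) (fY : 𝒳 → ℝ → ℝ → ℝ) (τ : ℝ) (x : 𝒳)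
    (w : ℝ → 𝒳 → ℝ → ℝ) : ℝ :=
  ∫ y, (y - condMean 𝒴 fY τ x) * w y x τ ∂(condLaw 𝒴 fY x τ)

/-- The bounds `θ^±(τ, x)`: the smallest and largest conditional average potential outcome when
the weight function varies. -/
noncomputable def capoBound {𝒳 : Type*} (s : Side) (Γ : ℝ) (𝒯 𝒴 : Set ℝ) (fY : 𝒳 → ℝ → ℝ → ℝ)
    (τ : ℝ) (x : 𝒳) : ℝ :=
  match s with
  | .lower => sInf (weightedMean 𝒴 fY τ x '' weights Γ 𝒯 𝒴 fY) + condMean 𝒴 fY τ x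
  | .upper => sSup (weightedMean 𝒴 fY τ x '' weights Γ 𝒯 𝒴 fY) + condMean 𝒴 fY τ x

/-- The bounds `θ^±(τ) = E[θ^±(τ, X)]`. -/
noncomputable def apoBound {𝒳 : Type*} [MeasurableSpace 𝒳] (s : Side) (Γ : ℝ) (PX : Measure 𝒳)
    (𝒯 𝒴 : Set ℝ) (fY : 𝒳 → ℝ → ℝ → ℝ) (τ : ℝ) : ℝ :=
  ∫ x, capoBound s Γ 𝒯 𝒴 fY τ x ∂PX

/-! ### The kernel estimators -/

/-- `γ = Γ / (1 + Γ)`. -/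
noncomputable def gam (Γ : ℝ) : ℝ := Γ / (1 + Γ)

/-- The quantile used by the estimators: order `γ` for the upper bound, `1 - γ` for the lower. -/
noncomputable def sideQuantile {𝒳 : Type*} (s : Side) (Γ : ℝ) (𝒴 : Set ℝ)
    (fY : 𝒳 → ℝ → ℝ → ℝ) (x : 𝒳) (t : ℝ) : ℝ :=
  match s with
  | .lower => condQuantile 𝒴 fY (1 - gam Γ) x t
  | .upper => condQuantile 𝒴 fY (gam Γ) x t

/-- The set of `(x, t, y)` with `y > q_γ^{x,t}` (upper) or `y ≤ q_{1-γ}^{x,t}` (lower). -/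
def tailSet {𝒳 : Type*} (s : Side) (Γ : ℝ) (𝒴 : Set ℝ) (fY : 𝒳 → ℝ → ℝ → ℝ) :
    Set (𝒳 × ℝ × ℝ) :=
  match s with
  | .lower => {p | p.2.2 ≤ sideQuantile .lower Γ 𝒴 fY p.1 p.2.1}
  | .upper => {p | sideQuantile .upper Γ 𝒴 fY p.1 p.2.1 < p.2.2}

/-- `Γ^{sign(y - q_γ^{x,t})}` (upper) or `Γ^{-sign(y - q_{1-γ}^{x,t})}` (lower). -/
noncomputable def signWeight {𝒳 : Type*} (s : Side) (Γ : ℝ) (𝒴 : Set ℝ)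
    (fY : 𝒳 → ℝ → ℝ → ℝ) (p : 𝒳 × ℝ × ℝ) : ℝ :=
  match s with
  | .lower => Γ ^ (-Real.sign (p.2.2 - sideQuantile .lower Γ 𝒴 fY p.1 p.2.1))
  | .upper => Γ ^ Real.sign (p.2.2 - sideQuantile .upper Γ 𝒴 fY p.1 p.2.1)

/-- `K_h(s) = K(s / h) / h`. -/
noncomputable def scaledKernel (K : ℝ → ℝ) (h s : ℝ) : ℝ := K (s / h) / h

/-- `K_h(t - τ) / f(t | x) * (y - η(t, x))`, at an observation `(x, t, y)`. -/
noncomputable def kernelResidual {𝒳 : Type*} (𝒴 : Set ℝ) (fT : 𝒳 → ℝ → ℝ)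
    (fY : 𝒳 → ℝ → ℝ → ℝ) (K : ℝ → ℝ) (τ h : ℝ) (p : 𝒳 × ℝ × ℝ) : ℝ :=
  scaledKernel K h (p.2.1 - τ) / fT p.1 p.2.1 * (p.2.2 - condMean 𝒴 fY p.2.1 p.1)

/-- `(1/n) ∑ η(τ, X_i)`. -/
noncomputable def etaTilde {𝒳 : Type*} (𝒴 : Set ℝ) (fY : 𝒳 → ℝ → ℝ → ℝ) (τ : ℝ) (n : ℕ)
    (D : ℕ → 𝒳 × ℝ × ℝ) : ℝ :=
  (∑ i ∈ Finset.range n, condMean 𝒴 fY τ (D i).1) / n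

/-- The two formulations of the kernel estimators. -/
inductive Form
  | tail
  | sign

open Classical in
/-- The estimator of `θ^±(τ)` with bandwidth `h`, from the first `n` points of the data `D`.

In the form `tail`, the residuals are averaged over the observations in the tail set (an average
over no observation is `0`); in the form `sign`, all residuals are averaged with sign weights. -/
noncomputable def estimator {𝒳 : Type*} (form : Form) (s : Side) (Γ : ℝ) (𝒴 : Set ℝ)
    (fT : 𝒳 → ℝ → ℝ) (fY : 𝒳 → ℝ → ℝ → ℝ) (K : ℝ → ℝ) (τ : ℝ) (n : ℕ) (h : ℝ)
    (D : ℕ → 𝒳 × ℝ × ℝ) : ℝ :=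
  match form with
  | .tail =>
    (2 * gam Γ - 1) /
        (gam Γ * ((Finset.range n).filter fun i => D i ∈ tailSet s Γ 𝒴 fY).card) *
        (∑ i ∈ (Finset.range n).filter fun i => D i ∈ tailSet s Γ 𝒴 fY,
          kernelResidual 𝒴 fT fY K τ h (D i)) +
      etaTilde 𝒴 fY τ n D
  | .sign =>
    etaTilde 𝒴 fY τ n D +
      (∑ i ∈ Finset.range n,
        kernelResidual 𝒴 fT fY K τ h (D i) * signWeight s Γ 𝒴 fY (D i)) / n

/-- The mean squared error `E[(Z - θ)²]`. -/
noncomputable def mse {Ω : Type*} [MeasurableSpace Ω] (μ : Measure Ω) (Z : Ω → ℝ) (θ : ℝ) : ℝ :=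
  ∫ ω, (Z ω - θ) ^ 2 ∂μ

/-- The upper bound `C₁/(nh) + C₂/n + C h⁴` on the mean squared error. -/
noncomputable def mseBound (C₁ C₂ C : ℝ) (n : ℕ) (h : ℝ) : ℝ :=
  C₁ / (n * h) + C₂ / n + C * h ^ 4

/-- `h` is an optimal bandwidth: it minimizes the upper bound over all positive bandwidths. -/
def IsOptimalBandwidth (C₁ C₂ C : ℝ) (n : ℕ) (h : ℝ) : Prop :=
  0 < h ∧ IsMinOn (mseBound C₁ C₂ C n) (Ioi 0) h

/-! ### Assumptions -/

/-- Nonnegative, symmetric, integrable kernels of total mass one, square-integrable, with finite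
second moment. -/
structure IsKernel (K : ℝ → ℝ) (MK2 Mu2K : ℝ) : Prop where
  nonneg : ∀ u, 0 ≤ K u
  symm : ∀ u, K (-u) = K u
  integrable : Integrable K
  integral_eq_one : ∫ u, K u = 1
  integrable_sq : Integrable fun u => K u ^ 2
  integral_sq_le : ∫ u, K u ^ 2 ≤ MK2
  integrable_sq_mul : Integrable fun u => u ^ 2 * K u
  integral_sq_mul_le : ∫ u, u ^ 2 * K u ≤ Mu2K

/-- Conditional densities of `T` given `X` and of `Y` given `X, T`, with their positivity. -/
structure ArePositiveDensities {𝒳 : Type*} [MeasurableSpace 𝒳] (𝒯 𝒴 : Set ℝ)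
    (fT : 𝒳 → ℝ → ℝ) (fY : 𝒳 → ℝ → ℝ → ℝ) (mf : ℝ) : Prop where
  measurableSet_treatment : MeasurableSet 𝒯
  measurableSet_outcome : MeasurableSet 𝒴
  measurable_treatment : Measurable fun p : 𝒳 × ℝ => fT p.1 p.2
  measurable_outcome : Measurable fun p : 𝒳 × ℝ × ℝ => fY p.1 p.2.1 p.2.2
  treatment_mass : ∀ x, ∫⁻ t in 𝒯, ENNReal.ofReal (fT x t) = 1
  outcome_mass : ∀ x, ∀ t ∈ 𝒯, ∫⁻ y in 𝒴, ENNReal.ofReal (fY x t y) = 1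
  le_treatment : ∀ x, ∀ t ∈ 𝒯, mf ≤ fT x t
  outcome_pos : ∀ x, ∀ t ∈ 𝒯, ∀ y ∈ 𝒴, 0 < fY x t y

/-- `C²` regularity in `t` of the conditional density of the outcome, with a bound at `τ` and a
uniform bound on the second derivative. -/
structure IsRegularDensity {𝒳 : Type*} (𝒯 𝒴 : Set ℝ) (fY : 𝒳 → ℝ → ℝ → ℝ)
    (τ Mf Mf2 : ℝ) : Prop where
  contDiffOn : ∀ x, ∀ y ∈ 𝒴, ContDiffOn ℝ 2 (fun t => fY x t y) 𝒯
  abs_le : ∀ x, ∀ y ∈ 𝒴, |fY x τ y| ≤ Mf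
  abs_deriv_le : ∀ x, ∀ y ∈ 𝒴, ∀ t ∈ 𝒯,
    |iteratedDerivWithin 2 (fun t' => fY x t' y) 𝒯 t| ≤ Mf2

/-- `C²` regularity in `t` of the conditional quantiles. The order `1`, whose quantile is an
infimum over the empty set, is left out. -/
structure IsRegularQuantile {𝒳 : Type*} (𝒯 𝒴 : Set ℝ) (fY : 𝒳 → ℝ → ℝ → ℝ)
    (MQ2 : ℝ) : Prop where
  contDiffOn : ∀ x, ∀ υ ∈ Ico (0 : ℝ) 1, ContDiffOn ℝ 2 (fun t => condQuantile 𝒴 fY υ x t) 𝒯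
  abs_deriv_le : ∀ x, ∀ υ ∈ Ico (0 : ℝ) 1, ∀ t ∈ 𝒯,
    |iteratedDerivWithin 2 (fun t' => condQuantile 𝒴 fY υ x t') 𝒯 t| ≤ MQ2

/-- `D 0, D 1, …` are independent observations of `(X, T, Y)` with common law `P`. -/
structure IsIIDSample {Ω 𝒳 : Type*} [MeasurableSpace Ω] [MeasurableSpace 𝒳] (μ : Measure Ω)
    (D : ℕ → Ω → 𝒳 × ℝ × ℝ) (P : Measure (𝒳 × ℝ × ℝ)) : Prop where
  measurable : ∀ i, Measurable (D i)
  indep : iIndepFun D μ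
  law : ∀ i, μ.map (D i) = P

end APOBounds

/-! The error is split into a sampling part with variance of order `1/(nh)` and a deterministic bias
of order `h²`.

Closed form. The extremal weight is `Γ` on the tail and `Γ⁻¹` off it. It has mean one because the
tail has conditional probability `1 - γ`. It beats any other weight because, after recentring `Y` at
the quantile `q`, the product of `y - q` and the difference of the two weights has constant sign. So
the bound at `x` is `η + (Γ - Γ⁻¹) a`, where `a` is `tailMean` at `τ` (`capoBound_eq`).

Bias. Both forms target `E[η(τ,X)] + (Γ - Γ⁻¹) E[R; tail]`. Division by the treatment density turns
`E[R; tail]` into the kernel average of `a(X, ·)` around `τ`, and by symmetry of the kernel only the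
second difference of `a` at `τ` matters (`IsKernel.abs_integral_sub_le`). The crux is
`abs_second_difference_tail_le`: a tail expectation is a minimum over levels `c` of `c (1 - υ) + ∫
(y - c)₊ f`, so testing well-chosen levels bounds its second difference on both sides. This needs
only second differences of the density in `t` and Lipschitz control of density and quantile, both
supplied by `second_difference_and_lipschitz`.

Variance. `E[R²]` is `O(1/h)`, since one of the two inverse densities cancels
(`memLp_kernelResidual`). Almost surely the sign form is an i.i.d. mean. The tail form is a ratio
with a random denominator `N`; a leave-one-out identity removes the cross terms and leaves the
inverse moment of `N`, which is `O(1/n)` (`integral_centered_ratio_sq_le`, `integral_inv_count_le`).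

The statements on the bandwidth then follow from an explicit factorization of the bound around its
critical point. -/

namespace APOBounds

/-! ### The optimal bandwidth -/

/-- The condition on `k` says that it is a critical point of the bound. Hence `h` times the
increment is a quintic in `h` with a double root at `k`, and the remaining cubic has positive
coefficients when `k > 0`. Existence and uniqueness of the minimizer follow without calculus. -/
lemma mseBound_eq_add {C₁ C₂ C h k : ℝ} {n : ℕ} (hh : 0 < h) (hn : 1 ≤ n)
    (hkC : 4 * C * k ^ 5 * n = C₁) :
    mseBound C₁ C₂ C n h = mseBound C₁ C₂ C n k +
      C * (h - k) ^ 2 * (h ^ 3 + 2 * h ^ 2 * k + 3 * h * k ^ 2 + 4 * k ^ 3) / h := by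
  have hn' : (0 : ℝ) < n := by exact_mod_cast hn
  unfold mseBound
  subst hkC
  field_simp
  ring

/-- The minimizer of the upper bound on the mean squared error. -/
noncomputable def optBandwidth (C₁ C : ℝ) (n : ℕ) : ℝ := (C₁ / (4 * C * n)) ^ (1 / 5 : ℝ)

lemma optBandwidth_pos {C₁ C : ℝ} (h₁ : 0 < C₁) (hC : 0 < C) {n : ℕ} (hn : 1 ≤ n) :
    0 < optBandwidth C₁ C n := by
  have hn' : (0 : ℝ) < n := by exact_mod_cast hn
  unfold optBandwidth
  positivity

lemma optBandwidth_pow {C₁ C : ℝ} (h₁ : 0 < C₁) (hC : 0 < C) {n : ℕ} (hn : 1 ≤ n) :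
    4 * C * optBandwidth C₁ C n ^ 5 * n = C₁ := by
  have hn' : (0 : ℝ) < n := by exact_mod_cast hn
  have : optBandwidth C₁ C n ^ 5 = C₁ / (4 * C * n) := by
    unfold optBandwidth
    rw [← Real.rpow_natCast, ← Real.rpow_mul (by positivity)]
    norm_num
  rw [this]
  field_simp

lemma isOptimalBandwidth_iff {C₁ C₂ C : ℝ} (h₁ : 0 < C₁) (hC : 0 < C) {n : ℕ} (hn : 1 ≤ n)
    (h : ℝ) : IsOptimalBandwidth C₁ C₂ C n h ↔ h = optBandwidth C₁ C n := by
  have hk := optBandwidth_pos h₁ hC hn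
  have hkC := optBandwidth_pow h₁ hC hn
  constructor
  · rintro ⟨hh, hmin⟩
    have hle := isMinOn_iff.1 hmin _ hk
    have heq := mseBound_eq_add (C₂ := C₂) hh hn hkC
    by_contra hne
    have : 0 < (h - optBandwidth C₁ C n) ^ 2 := by
      have := sub_ne_zero.2 hne
      positivity
    have : 0 < C * (h - optBandwidth C₁ C n) ^ 2 * (h ^ 3 + 2 * h ^ 2 * optBandwidth C₁ C n +
        3 * h * optBandwidth C₁ C n ^ 2 + 4 * optBandwidth C₁ C n ^ 3) / h := by positivity
    linarith
  · rintro rfl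
    refine ⟨hk, isMinOn_iff.2 fun h hh => ?_⟩
    have hh : 0 < h := hh
    rw [mseBound_eq_add (C₂ := C₂) hh hn hkC]
    have : 0 ≤ C * (h - optBandwidth C₁ C n) ^ 2 * (h ^ 3 + 2 * h ^ 2 * optBandwidth C₁ C n +
        3 * h * optBandwidth C₁ C n ^ 2 + 4 * optBandwidth C₁ C n ^ 3) / h := by positivity
    linarith

lemma optBandwidth_eq {C₁ C : ℝ} (h₁ : 0 < C₁) (hC : 0 < C) (n : ℕ) :
    optBandwidth C₁ C n = (C₁ / (4 * C)) ^ (1 / 5 : ℝ) * (n : ℝ) ^ (-(1 / 5) : ℝ) := by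
  unfold optBandwidth
  rw [← div_div, Real.div_rpow (by positivity) (by positivity), Real.rpow_neg (by positivity),
    div_eq_mul_inv]

/-- At the critical bandwidth `k` the variance term equals `4 C k⁴`, so the first and last terms add
up to `5 C k⁴`, of exact order `n ^ (-4/5)`; the term `C₂ / n` is of smaller order. -/
lemma mseBound_optBandwidth_le {C₁ C₂ C : ℝ} (h₁ : 0 < C₁) (h₂ : 0 < C₂) (hC : 0 < C) {n : ℕ}
    (hn : 1 ≤ n) :
    mseBound C₁ C₂ C n (optBandwidth C₁ C n) ≤
      (5 * C * (C₁ / (4 * C)) ^ (4 / 5 : ℝ) + C₂) * (n : ℝ) ^ (-(4 / 5) : ℝ) := by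
  have hn' : (1 : ℝ) ≤ n := by exact_mod_cast hn
  have hn0 : (0 : ℝ) < n := by linarith
  have hk := optBandwidth_pos h₁ hC hn
  have hkC := optBandwidth_pow h₁ hC hn
  have hfour : optBandwidth C₁ C n ^ 4 =
      (C₁ / (4 * C)) ^ (4 / 5 : ℝ) * (n : ℝ) ^ (-(4 / 5) : ℝ) := by
    rw [optBandwidth_eq h₁ hC, mul_pow, ← Real.rpow_natCast, ← Real.rpow_natCast,
      ← Real.rpow_mul (by positivity), ← Real.rpow_mul (by positivity)]
    norm_num
  have hinv : C₂ / n ≤ C₂ * (n : ℝ) ^ (-(4 / 5) : ℝ) := by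
    rw [div_eq_mul_inv, ← Real.rpow_neg_one]
    gcongr
    norm_num
  have : C₁ / (n * optBandwidth C₁ C n) = 4 * C * optBandwidth C₁ C n ^ 4 := by
    nth_rw 1 [← hkC]
    field_simp
  unfold mseBound
  rw [this, hfour]
  rw [add_mul]
  linarith

lemma existsUnique_isOptimalBandwidth {C₁ C₂ C : ℝ} (h₁ : 0 < C₁) (hC : 0 < C) {n : ℕ}
    (hn : 1 ≤ n) : ∃! h : ℝ, IsOptimalBandwidth C₁ C₂ C n h :=
  ⟨optBandwidth C₁ C n, (isOptimalBandwidth_iff h₁ hC hn _).2 rfl,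
    fun h hh => (isOptimalBandwidth_iff h₁ hC hn h).1 hh⟩

lemma isBigO_optimalBandwidth {C₁ C₂ C : ℝ} (h₁ : 0 < C₁) (hC : 0 < C) {hstar : ℕ → ℝ}
    (hopt : ∀ n : ℕ, 1 ≤ n → IsOptimalBandwidth C₁ C₂ C n (hstar n)) :
    hstar =O[atTop] fun n : ℕ => (n : ℝ) ^ (-(1 / 5) : ℝ) := by
  refine IsBigO.of_bound ((C₁ / (4 * C)) ^ (1 / 5 : ℝ)) ?_
  filter_upwards [eventually_ge_atTop 1] with n hn
  rw [(isOptimalBandwidth_iff h₁ hC hn _).1 (hopt n hn), optBandwidth_eq h₁ hC, norm_mul,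
    Real.norm_of_nonneg (show 0 ≤ (C₁ / (4 * C)) ^ (1 / 5 : ℝ) by positivity)]

lemma mse_nonneg {Ω : Type*} [MeasurableSpace Ω] (μ : Measure Ω) (Z : Ω → ℝ) (θ : ℝ) :
    0 ≤ mse μ Z θ := integral_nonneg fun _ => sq_nonneg _

lemma isBigO_of_le_mseBound {C₁ C₂ C : ℝ} (h₁ : 0 < C₁) (h₂ : 0 < C₂) (hC : 0 < C)
    {hstar m : ℕ → ℝ} (hopt : ∀ n : ℕ, 1 ≤ n → IsOptimalBandwidth C₁ C₂ C n (hstar n))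
    (h₀ : ∀ n, 0 ≤ m n) (hm : ∀ n, 1 ≤ n → m n ≤ mseBound C₁ C₂ C n (hstar n)) :
    m =O[atTop] fun n : ℕ => (n : ℝ) ^ (-(4 / 5) : ℝ) := by
  refine IsBigO.of_bound (5 * C * (C₁ / (4 * C)) ^ (4 / 5 : ℝ) + C₂) ?_
  filter_upwards [eventually_ge_atTop 1] with n hn
  rw [Real.norm_of_nonneg (h₀ n), Real.norm_of_nonneg (by positivity)]
  refine (hm n hn).trans ?_
  rw [(isOptimalBandwidth_iff h₁ hC hn _).1 (hopt n hn)]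
  exact mseBound_optBandwidth_le h₁ h₂ hC hn

/-! ### Consistency in `L²`. -/

lemma tendsto_mseBound {C₁ C₂ C : ℝ} {h : ℕ → ℝ} (h0 : Tendsto h atTop (𝓝 0))
    (hn : Tendsto (fun n : ℕ => (n : ℝ) * h n) atTop atTop) :
    Tendsto (fun n => mseBound C₁ C₂ C n (h n)) atTop (𝓝 0) := by
  have e₁ : Tendsto (fun n : ℕ => C₁ / (n * h n)) atTop (𝓝 0) := hn.const_div_atTop C₁
  have e₂ : Tendsto (fun n : ℕ => C₂ / (n : ℝ)) atTop (𝓝 0) :=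
    tendsto_natCast_atTop_atTop.const_div_atTop C₂
  have e₃ : Tendsto (fun n : ℕ => C * h n ^ 4) atTop (𝓝 0) := by
    simpa using (h0.pow 4).const_mul C
  simpa [mseBound] using (e₁.add e₂).add e₃

lemma eLpNorm_two_eq_sqrt_mse {Ω : Type*} [MeasurableSpace Ω] {μ : Measure Ω}
    [IsFiniteMeasure μ] {Z : Ω → ℝ} (hZ : MemLp Z 2 μ) (θ : ℝ) :
    eLpNorm (fun ω => Z ω - θ) 2 μ = ENNReal.ofReal (√(mse μ Z θ)) := by
  have h : MemLp (fun ω => Z ω - θ) 2 μ := hZ.sub (memLp_const θ)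
  rw [h.eLpNorm_eq_integral_rpow_norm (by norm_num) (by norm_num), mse, Real.sqrt_eq_rpow]
  simp

lemma tendsto_eLpNorm_of_le_mseBound {Ω : Type*} [MeasurableSpace Ω] {μ : Measure Ω}
    [IsFiniteMeasure μ] {C₁ C₂ C θ : ℝ} {h : ℕ → ℝ} {Z : ℕ → Ω → ℝ}
    (hZ : ∀ n, 1 ≤ n → MemLp (Z n) 2 μ)
    (hm : ∀ n, 1 ≤ n → mse μ (Z n) θ ≤ mseBound C₁ C₂ C n (h n))
    (h0 : Tendsto h atTop (𝓝 0)) (hn : Tendsto (fun n : ℕ => (n : ℝ) * h n) atTop atTop) :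
    Tendsto (fun n => eLpNorm (fun ω => Z n ω - θ) 2 μ) atTop (𝓝 0) := by
  have hmse : Tendsto (fun n => mse μ (Z n) θ) atTop (𝓝 0) := by
    refine tendsto_of_tendsto_of_tendsto_of_le_of_le' tendsto_const_nhds
      (tendsto_mseBound (C₁ := C₁) (C₂ := C₂) (C := C) h0 hn)
      (Eventually.of_forall fun n => mse_nonneg _ _ _) ?_
    filter_upwards [eventually_ge_atTop 1] with n hn using hm n hn
  have := ENNReal.tendsto_ofReal ((Real.continuous_sqrt.tendsto 0).comp hmse)
  simp only [Real.sqrt_zero, ENNReal.ofReal_zero] at this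
  refine this.congr' ?_
  filter_upwards [eventually_ge_atTop 1] with n hn
  rw [eLpNorm_two_eq_sqrt_mse (hZ n hn)]
  rfl

/-! ### Means and ratios of means of independent observations -/

section Sample

variable {Ω S : Type*} [MeasurableSpace Ω] [MeasurableSpace S] {μ : Measure Ω} {P : Measure S}
  {D : ℕ → Ω → S}

lemma memLp_comp_sample (hm : ∀ i, Measurable (D i)) (hl : ∀ i, μ.map (D i) = P) {Z : S → ℝ}
    {p : ENNReal} (hZ : MemLp Z p P) (i : ℕ) : MemLp (fun ω => Z (D i ω)) p μ := by
  rw [← hl i] at hZ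
  exact hZ.comp_of_map (hm i).aemeasurable

lemma integral_comp_sample (hm : ∀ i, Measurable (D i)) (hl : ∀ i, μ.map (D i) = P) {Z : S → ℝ}
    (hZ : AEStronglyMeasurable Z P) (i : ℕ) : ∫ ω, Z (D i ω) ∂μ = ∫ s, Z s ∂P := by
  rw [← hl i] at hZ ⊢
  exact (integral_map (hm i).aemeasurable hZ).symm

lemma ae_sample (hm : ∀ i, Measurable (D i)) (hl : ∀ i, μ.map (D i) = P) {p : S → Prop}
    (h : ∀ᵐ s ∂P, p s) : ∀ᵐ ω ∂μ, ∀ i, p (D i ω) := by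
  rw [ae_all_iff]
  intro i
  rw [← hl i] at h
  exact ae_of_ae_map (hm i).aemeasurable h

/-- Allows expectations to factor when a function of one observation multiplies a weight built from
the others. -/
lemma indepFun_rest (hm : ∀ i, Measurable (D i)) (hi : iIndepFun D μ) (i : ℕ) (A : Finset ℕ)
    (hA : i ∉ A) : IndepFun (D i) (fun ω (k : A) => D k ω) μ := by
  have h := hi.indepFun_finset {i} A (by simpa using hA) hm
  have h2 := h.comp (φ := fun z : (({i} : Finset ℕ) → S) => z ⟨i, by simp⟩)
    (ψ := id) (measurable_pi_apply (X := fun _ : ({i} : Finset ℕ) => S) _) measurable_id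
  exact h2

/-- The variance of a sum of independent copies is at most the sum of the second moments. -/
lemma integral_sum_sub_sq_le [IsProbabilityMeasure μ] (hm : ∀ i, Measurable (D i))
    (hi : iIndepFun D μ)
    (hl : ∀ i, μ.map (D i) = P) {Z : S → ℝ} (hZ : MemLp Z 2 P) (n : ℕ) :
    ∫ ω, (∑ i ∈ Finset.range n, Z (D i ω) - n * ∫ s, Z s ∂P) ^ 2 ∂μ ≤ n * ∫ s, Z s ^ 2 ∂P := by
  have hL : ∀ i, MemLp (fun ω => Z (D i ω)) 2 μ := memLp_comp_sample hm hl hZ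
  have hE : ∀ i, ∫ ω, Z (D i ω) ∂μ = ∫ s, Z s ∂P :=
    integral_comp_sample hm hl hZ.aestronglyMeasurable
  have hE2 : ∀ i, ∫ ω, Z (D i ω) ^ 2 ∂μ = ∫ s, Z s ^ 2 ∂P :=
    integral_comp_sample (Z := fun s => Z s ^ 2) hm hl (hZ.aestronglyMeasurable.pow 2)
  have hind : Set.Pairwise (↑(Finset.range n) : Set ℕ)
      fun i j => IndepFun (fun ω => Z (D i ω)) (fun ω => Z (D j ω)) μ := by
    intro i _ j _ hij
    refine (hi.indepFun hij).comp₀ (φ := Z) (ψ := Z) (hm i).aemeasurable (hm j).aemeasurable ?_ ?_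
    · rw [hl]; exact hZ.aestronglyMeasurable.aemeasurable
    · rw [hl]; exact hZ.aestronglyMeasurable.aemeasurable
  have hvar := IndepFun.variance_sum (μ := μ) (s := Finset.range n)
    (X := fun i ω => Z (D i ω)) (fun i _ => hL i) hind
  have hsum : MemLp (∑ i ∈ Finset.range n, fun ω => Z (D i ω)) 2 μ :=
    memLp_finsetSum' _ fun i _ => hL i
  have hmean : ∫ ω, (∑ i ∈ Finset.range n, fun ω => Z (D i ω)) ω ∂μ = n * ∫ s, Z s ∂P := by
    simp only [Finset.sum_apply]
    rw [integral_finsetSum _ fun i _ => (hL i).integrable (by norm_num)]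
    simp [hE]
  rw [variance_eq_integral hsum.aestronglyMeasurable.aemeasurable, hmean] at hvar
  simp only [Finset.sum_apply] at hvar
  rw [hvar]
  calc ∑ i ∈ Finset.range n, variance (fun ω => Z (D i ω)) μ
      ≤ ∑ i ∈ Finset.range n, ∫ s, Z s ^ 2 ∂P := by
        refine Finset.sum_le_sum fun i _ => ?_
        rw [← hE2 i]
        exact variance_le_expectation_sq (hL i).aestronglyMeasurable
    _ = n * ∫ s, Z s ^ 2 ∂P := by simp

lemma integral_mean_sub_sq_le [IsProbabilityMeasure μ] (hm : ∀ i, Measurable (D i))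
    (hi : iIndepFun D μ)
    (hl : ∀ i, μ.map (D i) = P) {Z : S → ℝ} (hZ : MemLp Z 2 P) {n : ℕ} (hn : 1 ≤ n) :
    ∫ ω, ((∑ i ∈ Finset.range n, Z (D i ω)) / n - ∫ s, Z s ∂P) ^ 2 ∂μ ≤
      (∫ s, Z s ^ 2 ∂P) / n := by
  have hn' : (0 : ℝ) < n := by exact_mod_cast hn
  have h := integral_sum_sub_sq_le hm hi hl hZ n
  have : ∀ ω, ((∑ i ∈ Finset.range n, Z (D i ω)) / n - ∫ s, Z s ∂P) ^ 2 =
      (∑ i ∈ Finset.range n, Z (D i ω) - n * ∫ s, Z s ∂P) ^ 2 / n ^ 2 := fun ω => by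
    field_simp
  simp_rw [this]
  rw [integral_div, div_le_div_iff₀ (by positivity) hn']
  calc _ ≤ (n * ∫ s, Z s ^ 2 ∂P) * n := by gcongr
    _ = _ := by ring

/-- The first inverse moment of a nonnegative integer count is controlled by its variance. -/
lemma inv_le_add_sq {a N : ℝ} (ha : 0 < a) (hN : N = 0 ∨ 1 ≤ N) :
    N⁻¹ ≤ 2 / a + 4 / a ^ 2 * (N - a) ^ 2 := by
  -- The case `N = 0` relies on `0⁻¹ = 0`. If `1 ≤ N < a / 2`, then `(N - a)² > a² / 4`, so the
  -- quadratic term alone exceeds `1 ≥ N⁻¹`.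
  rcases hN with rfl | hN
  · rw [inv_zero]; positivity
  · by_cases h : a / 2 ≤ N
    · have : N⁻¹ ≤ (a / 2)⁻¹ := inv_anti₀ (by positivity) h
      have h2 : (a / 2)⁻¹ = 2 / a := by field_simp
      have : 0 ≤ 4 / a ^ 2 * (N - a) ^ 2 := by positivity
      linarith
    · push Not at h
      have h1 : N⁻¹ ≤ 1 := inv_le_one_of_one_le₀ hN
      have h2 : 1 ≤ 4 / a ^ 2 * (N - a) ^ 2 := by
        rw [div_mul_eq_mul_div, le_div_iff₀ (by positivity)]
        nlinarith
      have : 0 ≤ 2 / a := by positivity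
      linarith

omit [MeasurableSpace S] in
lemma zero_or_one_le_sum {χ : S → ℝ} (hχ : ∀ s, χ s = 0 ∨ χ s = 1) (A : Finset ℕ) (d : ℕ → S) :
    ∑ k ∈ A, χ (d k) = 0 ∨ 1 ≤ ∑ k ∈ A, χ (d k) := by
  by_cases h : ∀ k ∈ A, χ (d k) = 0
  · exact Or.inl (Finset.sum_eq_zero h)
  · push Not at h
    obtain ⟨k, hk, hk0⟩ := h
    right
    have := (hχ (d k)).resolve_left hk0
    rw [← this]
    refine Finset.single_le_sum (f := fun k => χ (d k)) (fun j _ => ?_) hk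
    rcases hχ (d j) with h | h <;> simp [h]

variable [IsProbabilityMeasure μ] [IsProbabilityMeasure P]

/-- An indicator equals its square, so its second moment is its mean. -/
lemma integral_count_sub_sq_le (hm : ∀ i, Measurable (D i)) (hi : iIndepFun D μ)
    (hl : ∀ i, μ.map (D i) = P) {χ : S → ℝ} (hχm : Measurable χ)
    (hχ : ∀ s, χ s = 0 ∨ χ s = 1) (n : ℕ) :
    ∫ ω, (∑ i ∈ Finset.range n, χ (D i ω) - n * ∫ s, χ s ∂P) ^ 2 ∂μ ≤ n * ∫ s, χ s ∂P := by
  have hb : MemLp χ 2 P := MemLp.of_bound hχm.aestronglyMeasurable 1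
    (Eventually.of_forall fun s => by rcases hχ s with h | h <;> simp [h])
  have hsq : ∀ s, χ s ^ 2 = χ s := fun s => by rcases hχ s with h | h <;> simp [h]
  have := integral_sum_sub_sq_le hm hi hl hb n
  simpa only [hsq] using this

lemma integrable_count_sub_sq (hm : ∀ i, Measurable (D i))
    {χ : S → ℝ} (hχm : Measurable χ)
    (hχ : ∀ s, χ s = 0 ∨ χ s = 1) (n : ℕ) (a : ℝ) :
    Integrable (fun ω => (∑ i ∈ Finset.range n, χ (D i ω) - a) ^ 2) μ := by
  have h1 : ∀ i, MemLp (fun ω => χ (D i ω)) 2 μ := fun i =>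
    MemLp.of_bound (hχm.comp (hm i)).aestronglyMeasurable 1
    (Eventually.of_forall fun s => by rcases hχ (D i s) with h | h <;> simp [h])
  exact ((memLp_finsetSum _ fun i _ => h1 i).sub (memLp_const a)).integrable_sq

/-- Integrate `inv_le_add_sq` at `a = n p`: the variance of the count is at most `n p`, whence `6 =
2 + 4`. An empty count contributes `0`. -/
lemma integral_inv_count_le (hm : ∀ i, Measurable (D i)) (hi : iIndepFun D μ)
    (hl : ∀ i, μ.map (D i) = P) {χ : S → ℝ} (hχm : Measurable χ)
    (hχ : ∀ s, χ s = 0 ∨ χ s = 1) (hp : 0 < ∫ s, χ s ∂P) {n : ℕ} (hn : 1 ≤ n) :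
    ∫ ω, (∑ i ∈ Finset.range n, χ (D i ω))⁻¹ ∂μ ≤ 6 / (n * ∫ s, χ s ∂P) := by
  have hn' : (0 : ℝ) < n := by exact_mod_cast hn
  set p := ∫ s, χ s ∂P
  have hsq := integral_count_sub_sq_le hm hi hl hχm hχ n
  have hint := integrable_count_sub_sq (μ := μ) hm hχm hχ n (n * p)
  have ha : 0 < n * p := by positivity
  calc ∫ ω, (∑ i ∈ Finset.range n, χ (D i ω))⁻¹ ∂μ
      ≤ ∫ ω, (2 / (n * p) + 4 / (n * p) ^ 2 *
          (∑ i ∈ Finset.range n, χ (D i ω) - n * p) ^ 2) ∂μ := by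
        refine integral_mono_of_nonneg (Eventually.of_forall fun ω => ?_)
          ((integrable_const _).add (hint.const_mul _))
          (Eventually.of_forall fun ω => inv_le_add_sq ha (zero_or_one_le_sum hχ _ fun i => D i ω))
        refine inv_nonneg.2 (Finset.sum_nonneg fun i _ => ?_)
        rcases hχ (D i ω) with h | h <;> simp [h]
    _ = 2 / (n * p) + 4 / (n * p) ^ 2 *
          ∫ ω, (∑ i ∈ Finset.range n, χ (D i ω) - n * p) ^ 2 ∂μ := by
        rw [integral_add (integrable_const _) (hint.const_mul _), integral_const_mul]
        simp
    _ ≤ 2 / (n * p) + 4 / (n * p) ^ 2 * (n * p) := by gcongr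
    _ = 6 / (n * p) := by field_simp; norm_num

omit [IsProbabilityMeasure P] in
/-- A centered sum over the selected observations, divided by their number. -/
lemma integral_centered_ratio_sq_le (hm : ∀ i, Measurable (D i)) (hi : iIndepFun D μ)
    (hl : ∀ i, μ.map (D i) = P) {χ ξ : S → ℝ} (hχm : Measurable χ)
    (hχ : ∀ s, χ s = 0 ∨ χ s = 1) (hp : 0 < ∫ s, χ s ∂P) (hξm : Measurable ξ)
    (hξ : MemLp ξ 2 P) (hξχ : ∀ s, χ s = 0 → ξ s = 0) (hξ0 : ∫ s, ξ s ∂P = 0) (n : ℕ) :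
    ∫ ω, ((∑ i ∈ Finset.range n, ξ (D i ω)) / ∑ i ∈ Finset.range n, χ (D i ω)) ^ 2 ∂μ ≤
      (∫ s, ξ s ^ 2 ∂P) / (∫ s, χ s ∂P) *
        ∫ ω, (∑ i ∈ Finset.range n, χ (D i ω))⁻¹ ∂μ := by
  classical
  set p := ∫ s, χ s ∂P with hpdef
  have hχ0 : ∀ s, 0 ≤ χ s := fun s => by rcases hχ s with h | h <;> simp [h]
  -- the weight coming from all observations but the `i`-th
  let A : ℕ → Finset ℕ := fun i => (Finset.range n).erase i
  let Q : ℕ → Ω → ℝ := fun i ω => ((1 + ∑ k ∈ A i, χ (D k ω)) ^ 2)⁻¹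
  let N : Ω → ℝ := fun ω => ∑ i ∈ Finset.range n, χ (D i ω)
  have hNm : Measurable N := Finset.measurable_sum _ fun i _ => hχm.comp (hm i)
  have hQm : ∀ i, Measurable (Q i) := fun i =>
    (((Finset.measurable_sum _ fun k _ => hχm.comp (hm k)).const_add 1).pow_const 2).inv
  have hT0 : ∀ i ω, 0 ≤ ∑ k ∈ A i, χ (D k ω) := fun i ω => Finset.sum_nonneg fun k _ => hχ0 _
  have hQ0 : ∀ i ω, 0 ≤ Q i ω := fun i ω => inv_nonneg.2 (sq_nonneg _)
  have hQ1 : ∀ i ω, Q i ω ≤ 1 := fun i ω => inv_le_one_of_one_le₀ (by nlinarith [hT0 i ω])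
  have hN : ∀ i ∈ Finset.range n, ∀ ω, N ω = χ (D i ω) + ∑ k ∈ A i, χ (D k ω) :=
    fun i hi ω => (Finset.add_sum_erase _ _ hi).symm
  -- Leave-one-out: if the `i`-th observation is selected, `N` is exactly one plus the count of the
  -- others; if not, both sides vanish. The random denominator becomes a weight independent of that
  -- observation.
  have hχQ : ∀ i ∈ Finset.range n, ∀ ω, χ (D i ω) / N ω ^ 2 = χ (D i ω) * Q i ω := by
    intro i hi ω
    rcases hχ (D i ω) with h | h
    · simp [h]
    · rw [hN i hi ω, h, div_eq_mul_inv]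
  have hξQ : ∀ i ∈ Finset.range n, ∀ ω, ξ (D i ω) / N ω ^ 2 = ξ (D i ω) * Q i ω := by
    intro i hi ω
    rcases hχ (D i ω) with h | h
    · simp [hξχ _ h]
    · rw [hN i hi ω, h, div_eq_mul_inv]
  have hξL : ∀ i, MemLp (fun ω => ξ (D i ω)) 2 μ := memLp_comp_sample hm hl hξ
  have hξξ : ∀ i j, Integrable (fun ω => ξ (D i ω) * (ξ (D j ω) * Q i ω)) μ := by
    intro i j
    have h := (hξL i).integrable_mul (hξL j)
    have h2 := h.mul_bdd (c := 1) (hQm i).aestronglyMeasurable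
      (Eventually.of_forall fun ω => by
        rw [Real.norm_of_nonneg (hQ0 i ω)]; exact hQ1 i ω)
    refine h2.congr (Eventually.of_forall fun ω => ?_)
    simp only [Pi.mul_apply]
    ring
  have hχI : ∀ i, Integrable (fun ω => χ (D i ω) * Q i ω) μ := fun i =>
    Integrable.of_bound ((hχm.comp (hm i)).mul (hQm i)).aestronglyMeasurable 1
      (Eventually.of_forall fun ω => by
        have := hQ0 i ω
        have := hQ1 i ω
        rcases hχ (D i ω) with h | h <;> simp [abs_of_nonneg, *])
  -- factorization of expectations
  have hfac : ∀ i, ∀ f : S → ℝ, Measurable f →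
      ∫ ω, f (D i ω) * Q i ω ∂μ = (∫ s, f s ∂P) * ∫ ω, Q i ω ∂μ := by
    intro i f hf
    have hind := indepFun_rest hm hi i (A i) (by simp [A])
    have hgm : Measurable fun z : A i → S => ((1 + ∑ k : A i, χ (z k)) ^ 2)⁻¹ :=
      (((Finset.measurable_sum _ fun k _ =>
        hχm.comp (measurable_pi_apply k)).const_add 1).pow_const 2).inv
    have h := hind.integral_fun_comp_mul_comp (f := f)
      (g := fun z : A i → S => ((1 + ∑ k : A i, χ (z k)) ^ 2)⁻¹) (hm i).aemeasurable
      (measurable_pi_lambda (fun ω (k : A i) => D k ω) fun k => hm k).aemeasurable hf.aestronglyMeasurable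
      hgm.aestronglyMeasurable
    have hs : ∀ ω, ∑ k : A i, χ (D k ω) = ∑ k ∈ A i, χ (D k ω) := fun ω =>
      Finset.sum_coe_sort (A i) fun k => χ (D k ω)
    simp only [hs] at h
    rw [h, integral_comp_sample hm hl hf.aestronglyMeasurable]
  -- Off the diagonal, `ξ (D j) * Q i` involves only observations other than the `i`-th, so the
  -- expectation factors and the centering of `ξ` makes it vanish.
  have hcross : ∀ i ∈ Finset.range n, ∀ j ∈ Finset.range n, j ≠ i →
      ∫ ω, ξ (D i ω) * (ξ (D j ω) * Q i ω) ∂μ = 0 := by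
    intro i _ j hj hji
    have hind := indepFun_rest hm hi i (A i) (by simp [A])
    let j' : A i := ⟨j, Finset.mem_erase.2 ⟨hji, hj⟩⟩
    have hgm : Measurable fun z : A i → S => ξ (z j') * ((1 + ∑ k : A i, χ (z k)) ^ 2)⁻¹ :=
      (hξm.comp (measurable_pi_apply j')).mul
      (((Finset.measurable_sum _ fun k _ =>
        hχm.comp (measurable_pi_apply k)).const_add 1).pow_const 2).inv
    have h := hind.integral_fun_comp_mul_comp (f := ξ)
      (g := fun z : A i → S => ξ (z j') * ((1 + ∑ k : A i, χ (z k)) ^ 2)⁻¹) (hm i).aemeasurable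
      (measurable_pi_lambda (fun ω (k : A i) => D k ω) fun k => hm k).aemeasurable hξm.aestronglyMeasurable
      hgm.aestronglyMeasurable
    have hs : ∀ ω, ∑ k : A i, χ (D k ω) = ∑ k ∈ A i, χ (D k ω) := fun ω =>
      Finset.sum_coe_sort (A i) fun k => χ (D k ω)
    simp only [hs] at h
    rw [integral_comp_sample hm hl hξm.aestronglyMeasurable, hξ0, zero_mul] at h
    exact h
  have hexp : ∀ ω, ((∑ i ∈ Finset.range n, ξ (D i ω)) / N ω) ^ 2 =
      ∑ i ∈ Finset.range n, ∑ j ∈ Finset.range n, ξ (D i ω) * (ξ (D j ω) * Q i ω) := by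
    intro ω
    rw [div_pow, sq (∑ i ∈ Finset.range n, ξ (D i ω)), Finset.sum_mul_sum, Finset.sum_div]
    refine Finset.sum_congr rfl fun i hi => ?_
    rw [Finset.sum_div]
    refine Finset.sum_congr rfl fun j _ => ?_
    have := hξQ i hi ω
    rw [mul_comm (ξ (D i ω)), mul_div_assoc, this]
    ring
  -- Writing `N⁻¹` as `N / N ^ 2`, valid also for `N = 0`, expands it with the same weights `Q i`.
  have hinv : ∀ ω, (N ω)⁻¹ = ∑ i ∈ Finset.range n, χ (D i ω) * Q i ω := by
    intro ω
    rw [← Finset.sum_congr rfl fun i hi => hχQ i hi ω, ← Finset.sum_div]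
    change _ = N ω / N ω ^ 2
    by_cases h : N ω = 0
    · simp [h]
    · field_simp
  change ∫ ω, ((∑ i ∈ Finset.range n, ξ (D i ω)) / N ω) ^ 2 ∂μ ≤ _ * ∫ ω, (N ω)⁻¹ ∂μ
  simp_rw [hexp, hinv]
  rw [integral_finsetSum _ fun i _ => integrable_finsetSum _ fun j _ => hξξ i j,
    integral_finsetSum _ fun i _ => hχI i, Finset.mul_sum]
  -- The two sides agree term by term: the diagonal gives `E[ξ²] E[Q i]`, and on the right `p E[Q
  -- i]` is divided by `p`.
  refine le_of_eq (Finset.sum_congr rfl fun i hi' => ?_)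
  rw [integral_finsetSum _ fun j _ => hξξ i j,
    Finset.sum_eq_single_of_mem i hi' fun j hj hji => hcross i hi' j hj hji]
  have : ∀ ω, ξ (D i ω) * (ξ (D i ω) * Q i ω) = ξ (D i ω) ^ 2 * Q i ω := fun ω => by ring
  simp_rw [this]
  rw [hfac i (fun s => ξ s ^ 2) (hξm.pow_const 2), hfac i χ hχm, ← hpdef]
  field_simp

omit [IsProbabilityMeasure μ] [IsProbabilityMeasure P] in
-- The denominator is `0`, where the quotient is `0`, or at least `1`; hence the ratio is dominated
-- by its numerator.
lemma memLp_ratio (hm : ∀ i, Measurable (D i)) {χ ξ : S → ℝ}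
    (hl : ∀ i, μ.map (D i) = P) (hχm : Measurable χ)
    (hχ : ∀ s, χ s = 0 ∨ χ s = 1) (hξ : MemLp ξ 2 P) (n : ℕ) :
    MemLp (fun ω => (∑ i ∈ Finset.range n, ξ (D i ω)) / ∑ i ∈ Finset.range n, χ (D i ω)) 2 μ := by
  have h : MemLp (fun ω => ∑ i ∈ Finset.range n, ξ (D i ω)) 2 μ :=
    memLp_finsetSum _ fun i _ => memLp_comp_sample hm hl hξ i
  have hN : Measurable fun ω => ∑ i ∈ Finset.range n, χ (D i ω) :=
    Finset.measurable_sum _ fun i _ => hχm.comp (hm i)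
  refine h.of_le (h.aestronglyMeasurable.aemeasurable.div hN.aemeasurable).aestronglyMeasurable
    (Eventually.of_forall fun ω => ?_)
  rw [norm_div]
  rcases zero_or_one_le_sum hχ (Finset.range n) fun i => D i ω with h | h
  · simp [h]
  · exact div_le_self (norm_nonneg _) (by rwa [Real.norm_of_nonneg (by linarith)])

/-- The mean of `r` over the observations selected by `χ` estimates `E[r χ] / E[χ]`. -/
lemma integral_ratio_sub_sq_le_of_measurable (hm : ∀ i, Measurable (D i)) (hi : iIndepFun D μ)
    (hl : ∀ i, μ.map (D i) = P) {χ r : S → ℝ} (hχm : Measurable χ)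
    (hχ : ∀ s, χ s = 0 ∨ χ s = 1) (hp : 0 < ∫ s, χ s ∂P) (hrm : Measurable r)
    (hr : MemLp r 2 P) {n : ℕ} (hn : 1 ≤ n) :
    ∫ ω, ((∑ i ∈ Finset.range n, r (D i ω) * χ (D i ω)) / (∑ i ∈ Finset.range n, χ (D i ω)) -
        (∫ s, r s * χ s ∂P) / ∫ s, χ s ∂P) ^ 2 ∂μ ≤
      7 * (∫ s, r s ^ 2 ∂P) / ((∫ s, χ s ∂P) ^ 2 * n) := by
  have hn' : (0 : ℝ) < n := by exact_mod_cast hn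
  set p := ∫ s, χ s ∂P with hpdef
  set m := ∫ s, r s * χ s ∂P with hmdef
  set v := ∫ s, r s ^ 2 ∂P with hvdef
  have hχ0 : ∀ s, 0 ≤ χ s := fun s => by rcases hχ s with h | h <;> simp [h]
  have hχ1 : ∀ s, χ s ≤ 1 := fun s => by rcases hχ s with h | h <;> simp [h]
  have hχL : MemLp χ 2 P := MemLp.of_bound hχm.aestronglyMeasurable 1
    (Eventually.of_forall fun s => by rw [Real.norm_of_nonneg (hχ0 s)]; exact hχ1 s)
  have hrχ : MemLp (fun s => r s * χ s) 2 P :=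
    hr.of_le (hrm.mul hχm).aestronglyMeasurable (Eventually.of_forall fun s => by
      rw [norm_mul, Real.norm_of_nonneg (hχ0 s)]
      exact mul_le_of_le_one_right (norm_nonneg _) (hχ1 s))
  -- With this centering the error of the ratio is exactly `∑ ξ / ∑ χ` as soon as one observation is
  -- selected.
  let ξ : S → ℝ := fun s => r s * χ s - m / p * χ s
  have hξm : Measurable ξ := (hrm.mul hχm).sub (hχm.const_mul _)
  have hξ : MemLp ξ 2 P := hrχ.sub (hχL.const_mul _)
  have hrχI := hrχ.integrable (by norm_num : (1 : ENNReal) ≤ 2)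
  have hχI := hχL.integrable (by norm_num : (1 : ENNReal) ≤ 2)
  have hξ0 : ∫ s, ξ s ∂P = 0 := by
    change ∫ s, (r s * χ s - m / p * χ s) ∂P = 0
    rw [integral_sub hrχI (hχI.const_mul _), integral_const_mul, ← hmdef, ← hpdef]
    field_simp
    ring
  have hξsq : ∫ s, ξ s ^ 2 ∂P ≤ v - m ^ 2 / p := by
    have h1 : ∀ s, ξ s ^ 2 ≤ r s ^ 2 - 2 * (m / p) * (r s * χ s) + (m / p) ^ 2 * χ s := by
      intro s
      rcases hχ s with h | h
      · simp [ξ, h]; positivity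
      · simp only [ξ, h]; apply le_of_eq; ring
    calc ∫ s, ξ s ^ 2 ∂P
        ≤ ∫ s, (r s ^ 2 - 2 * (m / p) * (r s * χ s) + (m / p) ^ 2 * χ s) ∂P :=
          integral_mono hξ.integrable_sq
            ((hr.integrable_sq.sub (hrχI.const_mul _)).add (hχI.const_mul _)) h1
      _ = v - 2 * (m / p) * m + (m / p) ^ 2 * p := by
          have hi1 : Integrable (fun s => r s ^ 2 - 2 * (m / p) * (r s * χ s)) P :=
            hr.integrable_sq.sub (hrχI.const_mul _)
          rw [integral_add hi1 (hχI.const_mul _),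
            integral_sub hr.integrable_sq (hrχI.const_mul _), integral_const_mul,
            integral_const_mul]
      _ = v - m ^ 2 / p := by field_simp; ring
  have hξv : ∫ s, ξ s ^ 2 ∂P ≤ v := hξsq.trans (sub_le_self _ (by positivity))
  -- Comes from `0 ≤ E[ξ²] ≤ v - m² / p`. It controls the error made when no observation is
  -- selected.
  have hmv : (m / p) ^ 2 ≤ v / p := by
    have h0 : 0 ≤ ∫ s, ξ s ^ 2 ∂P := integral_nonneg fun s => sq_nonneg _
    rw [div_pow, sq p, ← div_div]
    gcongr
    linarith
  have hL := (memLp_ratio hm hl hχm hχ hξ n).integrable_sq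
  have hC := integrable_count_sub_sq (μ := μ) hm hχm hχ n (n * p)
  have ha : 0 < n * p := by positivity
  have hv : 0 ≤ v := integral_nonneg fun s => sq_nonneg _
  have hpt : ∀ ω, ((∑ i ∈ Finset.range n, r (D i ω) * χ (D i ω)) /
      (∑ i ∈ Finset.range n, χ (D i ω)) - m / p) ^ 2 ≤
      ((∑ i ∈ Finset.range n, ξ (D i ω)) / ∑ i ∈ Finset.range n, χ (D i ω)) ^ 2 +
      (v / p) / (n * p) ^ 2 * (∑ i ∈ Finset.range n, χ (D i ω) - n * p) ^ 2 := by
    intro ω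
    -- With an empty selection the error is `(m / p)²`; the count then deviates from its mean by `n
    -- p`, so the second term equals `v / p` and covers it.
    rcases zero_or_one_le_sum hχ (Finset.range n) fun i => D i ω with h | h
    · rw [h]
      have : (v / p) / (n * p) ^ 2 * (0 - n * p) ^ 2 = v / p := by field_simp; ring
      rw [this]
      simpa using hmv
    · have h0 : ∑ i ∈ Finset.range n, χ (D i ω) ≠ 0 := by linarith
      have : ∑ i ∈ Finset.range n, ξ (D i ω) = ∑ i ∈ Finset.range n, r (D i ω) * χ (D i ω) -
          m / p * ∑ i ∈ Finset.range n, χ (D i ω) := by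
        simp only [ξ, Finset.sum_sub_distrib, Finset.mul_sum]
      rw [this, sub_div, mul_div_assoc, div_self h0, mul_one]
      exact le_add_of_nonneg_right (by positivity)
  calc _ ≤ ∫ ω, (((∑ i ∈ Finset.range n, ξ (D i ω)) /
          ∑ i ∈ Finset.range n, χ (D i ω)) ^ 2 +
        (v / p) / (n * p) ^ 2 * (∑ i ∈ Finset.range n, χ (D i ω) - n * p) ^ 2) ∂μ :=
        integral_mono_of_nonneg (Eventually.of_forall fun ω => sq_nonneg _)
          (hL.add (hC.const_mul _)) (Eventually.of_forall hpt)
    _ = (∫ ω, ((∑ i ∈ Finset.range n, ξ (D i ω)) /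
          ∑ i ∈ Finset.range n, χ (D i ω)) ^ 2 ∂μ) +
        (v / p) / (n * p) ^ 2 *
          ∫ ω, (∑ i ∈ Finset.range n, χ (D i ω) - n * p) ^ 2 ∂μ := by
        rw [integral_add hL (hC.const_mul _), integral_const_mul]
    -- The final `7` is `6` from the inverse moment plus `1` from the empty selection.
    _ ≤ v / p * (6 / (n * p)) + (v / p) / (n * p) ^ 2 * (n * p) := by
        gcongr
        · refine (integral_centered_ratio_sq_le hm hi hl hχm hχ hp hξm hξ
            (fun s h => by simp [ξ, h]) hξ0 n).trans ?_
          have h6 := integral_inv_count_le hm hi hl hχm hχ hp hn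
          have h0 : 0 ≤ ∫ ω, (∑ i ∈ Finset.range n, χ (D i ω))⁻¹ ∂μ :=
            integral_nonneg fun ω => inv_nonneg.2 (Finset.sum_nonneg fun i _ => hχ0 _)
          gcongr
        · exact integral_count_sub_sq_le hm hi hl hχm hχ n
    _ = 7 * v / (p ^ 2 * n) := by field_simp; norm_num

/-- Version up to null sets, because the tail set is only null measurable (quantiles are
uncontrolled outside `𝒯`) and the kernel is only almost everywhere measurable. Almost surely no
observation falls in the exceptional null set. -/
lemma integral_ratio_sub_sq_le (hm : ∀ i, Measurable (D i)) (hi : iIndepFun D μ)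
    (hl : ∀ i, μ.map (D i) = P) {B : Set S} {r : S → ℝ} (hB : NullMeasurableSet B P)
    (hp : 0 < P.real B) (hr : MemLp r 2 P) {n : ℕ} (hn : 1 ≤ n) :
    MemLp (fun ω => (∑ i ∈ Finset.range n, B.indicator r (D i ω)) /
        ∑ i ∈ Finset.range n, B.indicator 1 (D i ω)) 2 μ ∧
    ∫ ω, ((∑ i ∈ Finset.range n, B.indicator r (D i ω)) /
        (∑ i ∈ Finset.range n, B.indicator 1 (D i ω)) -
        (∫ s in B, r s ∂P) / P.real B) ^ 2 ∂μ ≤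
      7 * (∫ s, r s ^ 2 ∂P) / (P.real B ^ 2 * n) := by
  classical
  obtain ⟨A, -, hA, hAB⟩ := hB.exists_measurable_superset_ae_eq
  have hrm := hr.aestronglyMeasurable
  set r' := hrm.mk r
  have hrr : r =ᵐ[P] r' := hrm.ae_eq_mk
  have hr'm : Measurable r' := hrm.stronglyMeasurable_mk.measurable
  have hr' : MemLp r' 2 P := hr.ae_eq hrr
  let χ : S → ℝ := A.indicator 1
  have hχm : Measurable χ := measurable_one.indicator hA
  have hχ : ∀ s, χ s = 0 ∨ χ s = 1 := fun s => by
    by_cases h : s ∈ A <;> simp [χ, h]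
  have hχr : ∀ s, r' s * χ s = A.indicator r' s := fun s => by
    by_cases h : s ∈ A <;> simp [χ, h]
  have hPA : ∫ s, χ s ∂P = P.real B := by
    rw [integral_indicator_one hA, measureReal_congr hAB]
  have hint : ∫ s, r' s * χ s ∂P = ∫ s in B, r s ∂P := by
    simp_rw [hχr]
    rw [integral_indicator hA, setIntegral_congr_set hAB]
    exact integral_congr_ae (ae_restrict_of_ae hrr.symm)
  have hsq : ∫ s, r' s ^ 2 ∂P = ∫ s, r s ^ 2 ∂P :=
    integral_congr_ae (hrr.mono fun s hs => by simp only [hs])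
  have hae : ∀ᵐ ω ∂μ, ∀ i, B.indicator r (D i ω) = r' (D i ω) * χ (D i ω) ∧
      B.indicator 1 (D i ω) = χ (D i ω) := by
    refine ae_sample (p := fun s => B.indicator r s = r' s * χ s ∧ B.indicator 1 s = χ s) hm hl ?_
    filter_upwards [hrr, hAB.mem_iff] with s h1 h2
    by_cases h : s ∈ A
    · simp [χ, h, h2.1 h, h1]
    · simp [χ, h, mt h2.2 h]
  have hae' : (fun ω => (∑ i ∈ Finset.range n, B.indicator r (D i ω)) /
        ∑ i ∈ Finset.range n, B.indicator 1 (D i ω)) =ᵐ[μ]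
      fun ω => (∑ i ∈ Finset.range n, r' (D i ω) * χ (D i ω)) /
        ∑ i ∈ Finset.range n, χ (D i ω) := by
    filter_upwards [hae] with ω hω
    simp_rw [fun i => (hω i).1, fun i => (hω i).2]
  constructor
  · refine MemLp.ae_eq hae'.symm (memLp_ratio hm hl hχm hχ (ξ := fun s => r' s * χ s) ?_ n)
    simp_rw [hχr]
    exact hr'.indicator hA
  · have := integral_ratio_sub_sq_le_of_measurable hm hi hl hχm hχ (by rwa [hPA]) hr'm hr' hn
    rw [hPA, hint, hsq] at this
    refine le_of_eq_of_le (integral_congr_ae ?_) this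
    filter_upwards [hae'] with ω hω
    simp only [hω]

end Sample

/-! ### Second-order expansions -/

/-- The mean value inequality is applied twice: to `u'`, then to `u` minus its linear part. Bounding
`u' - u' τ` by its maximum on the interval costs the factor `1/2` of Taylor's formula. -/
lemma exists_abs_sub_linear_le {u : ℝ → ℝ} {𝒯 : Set ℝ} {τ d M : ℝ}
    (h𝒯 : Ioo (τ - d) (τ + d) ⊆ 𝒯) (hu : ContDiffOn ℝ 2 u 𝒯)
    (hM : ∀ t ∈ 𝒯, |iteratedDerivWithin 2 u 𝒯 t| ≤ M) :
    ∃ a : ℝ, ∀ s, |s| < d → |u (τ + s) - u τ - a * s| ≤ M * s ^ 2 := by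
  set I := Ioo (τ - d) (τ + d) with hI
  have hIo : IsOpen I := isOpen_Ioo
  have huI : ContDiffOn ℝ 2 u I := hu.mono h𝒯
  have hd1 : DifferentiableOn ℝ u I := huI.differentiableOn (by norm_num)
  have hd2 : DifferentiableOn ℝ (deriv u) I :=
    (huI.deriv_of_isOpen (m := 1) hIo (by norm_num)).differentiableOn (by norm_num)
  have hdd : ∀ t ∈ I, |deriv (deriv u) t| ≤ M := by
    intro t ht
    -- Iterated derivatives within a set depend only on its germ at the point, and `𝒯` is a
    -- neighbourhood of every point of `I`.
    have h1 : iteratedDerivWithin 2 u 𝒯 t = iteratedDerivWithin 2 u I t :=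
      congrArg (fun L : ContinuousMultilinearMap ℝ (fun _ : Fin 2 => ℝ) ℝ => L fun _ => 1)
        (iteratedFDerivWithin_congr_set
          ((eventuallyEq_univ.2 (mem_of_superset (hIo.mem_nhds ht) h𝒯)).trans
          (eventuallyEq_univ.2 (hIo.mem_nhds ht)).symm) 2)
    have h2 := iteratedDerivWithin_of_isOpen (n := 2) (f := u) hIo ht
    have h3 := hM t (h𝒯 ht)
    rw [h1, h2, iteratedDeriv_succ, iteratedDeriv_one] at h3
    exact h3
  refine ⟨deriv u τ, fun s hs => ?_⟩
  have hs' := abs_lt.1 hs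
  have hd0 : 0 < d := (abs_nonneg s).trans_lt hs
  -- work on the symmetric interval of radius `|s|`
  have hJ : Icc (τ - |s|) (τ + |s|) ⊆ I := by
    intro t ht
    exact ⟨by linarith [ht.1], by linarith [ht.2]⟩
  have hτJ : τ ∈ Icc (τ - |s|) (τ + |s|) := ⟨by linarith [abs_nonneg s], by linarith [abs_nonneg s]⟩
  have hτsJ : τ + s ∈ Icc (τ - |s|) (τ + |s|) :=
    ⟨by linarith [neg_abs_le s], by linarith [le_abs_self s]⟩
  have hM0 : 0 ≤ M := (abs_nonneg _).trans (hdd τ (hJ hτJ))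
  have hder : ∀ t ∈ Icc (τ - |s|) (τ + |s|), |deriv u t - deriv u τ| ≤ M * |s| := by
    intro t ht
    have := (convex_Icc (τ - |s|) (τ + |s|)).norm_image_sub_le_of_norm_deriv_le (f := deriv u)
      (C := M) (fun x hx => (hd2.differentiableAt (hIo.mem_nhds (hJ hx))))
      (fun x hx => hdd x (hJ hx)) hτJ ht
    refine this.trans (mul_le_mul_of_nonneg_left ?_ hM0)
    rw [Real.norm_eq_abs, abs_le]
    exact ⟨by linarith [ht.1], by linarith [ht.2]⟩
  have hdiff : ∀ x ∈ Icc (τ - |s|) (τ + |s|),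
      HasDerivAt (fun t => u t - deriv u τ * t) (deriv u x - deriv u τ) x := by
    intro x hx
    have h1 := (hd1.differentiableAt (hIo.mem_nhds (hJ hx))).hasDerivAt
    simpa using h1.fun_sub ((hasDerivAt_id' x).const_mul (deriv u τ))
  have := (convex_Icc (τ - |s|) (τ + |s|)).norm_image_sub_le_of_norm_hasDerivWithin_le
    (f := fun t => u t - deriv u τ * t) (f' := fun x => deriv u x - deriv u τ)
    (C := M * |s|) (fun x hx => (hdiff x hx).hasDerivWithinAt)
    (fun x hx => hder x hx) hτJ hτsJ
  rw [Real.norm_eq_abs, Real.norm_eq_abs] at this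
  calc |u (τ + s) - u τ - deriv u τ * s|
      = |u (τ + s) - deriv u τ * (τ + s) - (u τ - deriv u τ * τ)| := by ring_nf
    _ ≤ M * |s| * |τ + s - τ| := this
    _ = M * s ^ 2 := by rw [add_sub_cancel_left, mul_assoc, ← sq, sq_abs]

/-- A function which has a second-order expansion on `(τ - d, τ + d)` and is bounded below there is
Lipschitz at `τ`. -/
lemma second_difference_and_lipschitz {u : ℝ → ℝ} {𝒯 : Set ℝ} {τ d M B : ℝ} (hd : 0 < d)
    (h𝒯 : Ioo (τ - d) (τ + d) ⊆ 𝒯) (hu : ContDiffOn ℝ 2 u 𝒯)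
    (hM : ∀ t ∈ 𝒯, |iteratedDerivWithin 2 u 𝒯 t| ≤ M) (hB : u τ ≤ B)
    (hB' : ∀ t ∈ 𝒯, -B ≤ u t) (s : ℝ) (hs : |s| < d) :
    |u (τ + s) + u (τ - s) - 2 * u τ| ≤ 2 * M * s ^ 2 ∧
      |u (τ + s) - u τ| ≤ (4 * B / d + 2 * M * d) * |s| := by
  obtain ⟨a, ha⟩ := exists_abs_sub_linear_le h𝒯 hu hM
  have hM0 : 0 ≤ M := (abs_nonneg _).trans (hM τ (h𝒯 ⟨by linarith, by linarith⟩))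
  have h1 := abs_le.1 (ha s hs)
  have h2 := abs_le.1 (ha (-s) (by rwa [abs_neg]))
  have hd2 : |d / 2| < d := by rw [abs_of_pos (by positivity)]; linarith
  have h3 := abs_le.1 (ha (d / 2) hd2)
  have h4 := abs_le.1 (ha (-(d / 2)) (by rwa [abs_neg]))
  have h5 := hB' (τ + d / 2) (h𝒯 ⟨by linarith, by linarith⟩)
  have h6 := hB' (τ + -(d / 2)) (h𝒯 ⟨by linarith, by linarith⟩)
  have hs2 : s ^ 2 ≤ d * |s| := by
    rw [← sq_abs]; nlinarith [abs_nonneg s]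
  rw [← sub_eq_add_neg τ s] at h2
  refine ⟨abs_le.2 ⟨by linarith, by linarith⟩, ?_⟩
  -- A steep slope would push `u` below `-B` at `τ + d / 2` or at `τ - d / 2`; an upper bound at `τ`
  -- alone is therefore enough.
  have habs : |a| ≤ 4 * B / d + M * d := by
    rw [abs_le]
    constructor
    · rw [neg_le_iff_add_nonneg, show a + (4 * B / d + M * d) = (a * d + 4 * B + M * d ^ 2) / d by
        field_simp; ring]
      apply div_nonneg _ hd.le
      nlinarith [sq_nonneg d]
    · rw [← sub_nonneg, show 4 * B / d + M * d - a = (4 * B + M * d ^ 2 - a * d) / d by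
        field_simp]
      apply div_nonneg _ hd.le
      nlinarith [sq_nonneg d]
  calc |u (τ + s) - u τ| = |(u (τ + s) - u τ - a * s) + a * s| := by ring_nf
    _ ≤ |u (τ + s) - u τ - a * s| + |a * s| := abs_add_le _ _
    _ ≤ M * s ^ 2 + |a| * |s| := by rw [abs_mul]; gcongr; exact ha s hs
    _ ≤ M * (d * |s|) + (4 * B / d + M * d) * |s| := by gcongr
    _ = _ := by ring

/-! ### The bias of a symmetric kernel -/

lemma scaledKernel_integral_sub {K : ℝ → ℝ} {h τ : ℝ} (hh : 0 < h) (g : ℝ → ℝ) :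
    ∫ t, scaledKernel K h (t - τ) * g t = ∫ u, K u * g (τ + h * u) := by
  have h1 := integral_sub_right_eq_self (μ := volume)
    (fun t => scaledKernel K h t * g (t + τ)) τ
  simp only [sub_add_cancel] at h1
  rw [h1]
  have h2 := Measure.integral_comp_mul_left (fun t => scaledKernel K h t * g (t + τ)) h
  rw [abs_of_pos (inv_pos.2 hh)] at h2
  have h3 : ∫ t, scaledKernel K h t * g (t + τ) =
      h * ∫ u, scaledKernel K h (h * u) * g (h * u + τ) := by
    rw [h2]; simp [hh.ne']
  rw [h3, ← integral_const_mul]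
  congr 1
  ext u
  simp only [scaledKernel]
  rw [mul_div_cancel_left₀ _ hh.ne', add_comm τ]
  field_simp

/-- Averaging over `u` and `-u` replaces `g` by its second difference, which removes the linear
term. Where `|h u| ≥ d`, the crude bound `4 B` is at most `4 B / d² * (h u)²`, so the second moment
of `K` handles both regions. -/
lemma IsKernel.abs_integral_sub_le {K : ℝ → ℝ} {MK2 Mu2K h τ d L B : ℝ}
    (hK : IsKernel K MK2 Mu2K) (hh : 0 < h) (hd : 0 < d) {g : ℝ → ℝ} (hg : AEStronglyMeasurable g)
    (hgB : ∀ t, |g t| ≤ B)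
    (hL : ∀ s, |s| < d → |g (τ + s) + g (τ - s) - 2 * g τ| ≤ L * s ^ 2) :
    |(∫ t, scaledKernel K h (t - τ) * g t) - g τ| ≤ (L + 4 * B / d ^ 2) * Mu2K * h ^ 2 := by
  have hB0 : 0 ≤ B := (abs_nonneg _).trans (hgB τ)
  have hL0 : 0 ≤ L := by
    have h1 := hL (d / 2) (by rw [abs_of_pos (by positivity)]; linarith)
    have h2 := (abs_nonneg _).trans h1
    by_contra hneg
    push Not at hneg
    have : L * (d / 2) ^ 2 < 0 := mul_neg_of_neg_of_pos hneg (by positivity)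
    linarith
  rw [scaledKernel_integral_sub hh]
  have hqmp : Measure.QuasiMeasurePreserving (fun u : ℝ => τ + h * u) volume volume := by
    refine (measurePreserving_add_left volume τ).quasiMeasurePreserving.comp ?_
    refine ⟨measurable_const_mul h, ?_⟩
    rw [Real.map_volume_mul_left hh.ne']
    exact Measure.smul_absolutelyContinuous
  have hgm : AEStronglyMeasurable (fun u => g (τ + h * u)) volume :=
    hg.comp_quasiMeasurePreserving hqmp
  have hI : Integrable fun u => K u * g (τ + h * u) :=
    hK.integrable.mul_bdd (c := B) hgm (Eventually.of_forall fun u => hgB _)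
  have hsymm : ∫ u, K u * g (τ + h * u) = ∫ u, K u * g (τ - h * u) := by
    rw [← integral_neg_eq_self]
    congr 1
    ext u
    rw [hK.symm, mul_neg, sub_eq_add_neg]
  have hI' : Integrable fun u => K u * g (τ - h * u) := by
    have := hI.comp_neg
    refine this.congr (Eventually.of_forall fun u => ?_)
    simp only [hK.symm, mul_neg, sub_eq_add_neg]
  have hkey : 2 * ((∫ u, K u * g (τ + h * u)) - g τ) =
      ∫ u, K u * (g (τ + h * u) + g (τ - h * u) - 2 * g τ) := by
    have hr : ∀ u, K u * (g (τ + h * u) + g (τ - h * u) - 2 * g τ) =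
        K u * g (τ + h * u) + K u * g (τ - h * u) - K u * (2 * g τ) := fun u => by ring
    simp_rw [hr]
    have hi1 : Integrable fun u => K u * g (τ + h * u) + K u * g (τ - h * u) := hI.add hI'
    rw [integral_sub hi1 (hK.integrable.mul_const _), integral_add hI hI',
      integral_mul_const, hK.integral_eq_one, ← hsymm]
    ring
  have hbd : |∫ u, K u * (g (τ + h * u) + g (τ - h * u) - 2 * g τ)| ≤
      ∫ u, (L + 4 * B / d ^ 2) * h ^ 2 * (u ^ 2 * K u) := by
    rw [← Real.norm_eq_abs]
    refine norm_integral_le_of_norm_le (hK.integrable_sq_mul.const_mul _)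
      (Eventually.of_forall fun u => ?_)
    rw [norm_mul, Real.norm_of_nonneg (hK.nonneg u), Real.norm_eq_abs]
    have : |g (τ + h * u) + g (τ - h * u) - 2 * g τ| ≤ (L + 4 * B / d ^ 2) * (h * u) ^ 2 := by
      by_cases hu : |h * u| < d
      · refine (hL _ hu).trans ?_
        gcongr
        exact le_add_of_nonneg_right (by positivity)
      · push Not at hu
        have h1 : d ^ 2 ≤ (h * u) ^ 2 := by rw [← sq_abs (h * u)]; gcongr
        have h2 : 4 * B ≤ 4 * B / d ^ 2 * (h * u) ^ 2 := by
          rw [div_mul_eq_mul_div, le_div_iff₀ (by positivity)]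
          gcongr
        have h3 : |g (τ + h * u) + g (τ - h * u) - 2 * g τ| ≤ 4 * B := by
          have e1 := abs_le.1 (hgB (τ + h * u))
          have e2 := abs_le.1 (hgB (τ - h * u))
          have e3 := abs_le.1 (hgB τ)
          exact abs_le.2 ⟨by linarith, by linarith⟩
        have h4 : 0 ≤ L * (h * u) ^ 2 := by positivity
        rw [add_mul]
        linarith
    calc _ ≤ K u * ((L + 4 * B / d ^ 2) * (h * u) ^ 2) :=
          mul_le_mul_of_nonneg_left this (hK.nonneg u)
      _ = _ := by ring
  rw [integral_const_mul, ← hkey, abs_mul, abs_of_pos (by norm_num : (0 : ℝ) < 2)] at hbd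
  have hfin : (L + 4 * B / d ^ 2) * h ^ 2 * ∫ u, u ^ 2 * K u ≤
      (L + 4 * B / d ^ 2) * h ^ 2 * Mu2K := by
    gcongr
    exact hK.integral_sq_mul_le
  have := abs_nonneg ((∫ u, K u * g (τ + h * u)) - g τ)
  linarith

lemma IsKernel.lintegral_scaledKernel_sq_le {K : ℝ → ℝ} {MK2 Mu2K h τ : ℝ}
    (hK : IsKernel K MK2 Mu2K) (hh : 0 < h) :
    ∫⁻ t, ENNReal.ofReal (scaledKernel K h (t - τ) ^ 2) ≤ ENNReal.ofReal (MK2 / h) := by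
  have hI : Integrable fun t => scaledKernel K h (t - τ) ^ 2 := by
    have h1 := (hK.integrable_sq.comp_div hh.ne').comp_sub_right τ
    refine (h1.div_const (h ^ 2)).congr (Eventually.of_forall fun t => ?_)
    simp only [scaledKernel, div_pow]
  rw [← ofReal_integral_eq_lintegral_ofReal hI (Eventually.of_forall fun t => sq_nonneg _)]
  apply ENNReal.ofReal_le_ofReal
  have h1 := scaledKernel_integral_sub (K := K) (τ := τ) hh fun t => scaledKernel K h (t - τ)
  simp_rw [← sq] at h1
  rw [h1]
  have h2 : ∀ u, K u * scaledKernel K h (τ + h * u - τ) = K u ^ 2 / h := fun u => by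
    rw [add_sub_cancel_left, scaledKernel, mul_div_cancel_left₀ _ hh.ne']
    ring
  simp_rw [h2]
  rw [integral_div]
  gcongr
  exact hK.integral_sq_le

/-! ### The second difference of tail expectations -/

section TailExpectation

variable {𝒴 : Set ℝ} {M : ℝ}

lemma volume_ne_top_of_abs_le (hM : ∀ y ∈ 𝒴, |y| ≤ M) : volume 𝒴 ≠ ⊤ := by
  refine ne_top_of_le_ne_top ?_ (measure_mono (show 𝒴 ⊆ Icc (-M) M from fun y hy =>
    abs_le.1 (hM y hy)))
  simp

lemma volume_real_le (hM0 : 0 ≤ M) (hM : ∀ y ∈ 𝒴, |y| ≤ M) : volume.real 𝒴 ≤ 2 * M := by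
  have := measureReal_mono (μ := volume) (show 𝒴 ⊆ Icc (-M) M from fun y hy =>
    abs_le.1 (hM y hy)) (by simp)
  rw [Real.volume_real_Icc_of_le (by linarith)] at this
  linarith

lemma abs_setIntegral_le {g : ℝ → ℝ} {c : ℝ} (hM0 : 0 ≤ M) (hc : 0 ≤ c)
    (hM : ∀ y ∈ 𝒴, |y| ≤ M) (hg : ∀ y ∈ 𝒴, |g y| ≤ c) : |∫ y in 𝒴, g y| ≤ c * (2 * M) := by
  have := norm_setIntegral_le_of_norm_le_const (μ := volume) (f := g) (s := 𝒴) (C := c)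
    (lt_top_iff_ne_top.2 (volume_ne_top_of_abs_le hM)) hg
  exact this.trans (mul_le_mul_of_nonneg_left (volume_real_le hM0 hM) hc)

lemma integrableOn_tail_excess {f : ℝ → ℝ} (c : ℝ) (h𝒴 : MeasurableSet 𝒴)
    (hM : ∀ y ∈ 𝒴, |y| ≤ M) (hf : IntegrableOn f 𝒴) :
    IntegrableOn (fun y => max (y - c) 0 * f y) 𝒴 := by
  refine hf.bdd_mul (c := M + |c|)
    ((measurable_id.sub_const c).max measurable_const).aestronglyMeasurable ?_
  refine ae_restrict_of_forall_mem h𝒴 fun y hy => ?_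
  have := abs_le.1 (hM y hy)
  rw [Real.norm_eq_abs, abs_of_nonneg (le_max_right _ _)]
  refine max_le ?_ ?_ <;> linarith [neg_abs_le c, abs_nonneg c]

/-- The Rockafellar-Uryasev representation of a tail expectation as a minimum over `c`. -/
lemma tail_expectation_le {f : ℝ → ℝ} {q c υ : ℝ} (h𝒴 : MeasurableSet 𝒴)
    (hM : ∀ y ∈ 𝒴, |y| ≤ M) (hf : IntegrableOn f 𝒴) (hf0 : ∀ y ∈ 𝒴, 0 ≤ f y)
    (hq : ∫ y in 𝒴, (Ioi q).indicator f y = 1 - υ) :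
    ∫ y in 𝒴, (Ioi q).indicator (fun y => y * f y) y ≤
      c * (1 - υ) + ∫ y in 𝒴, max (y - c) 0 * f y := by
  have hyf : IntegrableOn (fun y => y * f y) 𝒴 := by
    refine hf.bdd_mul (c := M) measurable_id.aestronglyMeasurable ?_
    exact ae_restrict_of_forall_mem h𝒴 hM
  have hmax : IntegrableOn (fun y => max (y - c) 0 * f y) 𝒴 :=
    integrableOn_tail_excess _ h𝒴 hM hf
  have h1 : IntegrableOn ((Ioi q).indicator f) 𝒴 := hf.indicator measurableSet_Ioi
  rw [← hq, ← integral_const_mul, ← integral_add (h1.const_mul c) hmax]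
  refine setIntegral_mono_on (hyf.indicator measurableSet_Ioi) ((h1.const_mul c).add hmax) h𝒴
    fun y hy => ?_
  -- On the tail, `y ≤ c + (y - c)₊`; off the tail the left side is zero and the excess is
  -- nonnegative.
  have h0 := hf0 y hy
  by_cases h : y ∈ Ioi q
  · simp only [indicator_of_mem h]
    nlinarith [le_max_left (y - c) 0]
  · simp only [indicator_of_notMem h]
    have := mul_nonneg (le_max_right (y - c) 0) h0
    simpa using this

lemma tail_expectation_eq {f : ℝ → ℝ} {q υ : ℝ} (h𝒴 : MeasurableSet 𝒴)
    (hM : ∀ y ∈ 𝒴, |y| ≤ M) (hf : IntegrableOn f 𝒴)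
    (hq : ∫ y in 𝒴, (Ioi q).indicator f y = 1 - υ) :
    ∫ y in 𝒴, (Ioi q).indicator (fun y => y * f y) y =
      q * (1 - υ) + ∫ y in 𝒴, max (y - q) 0 * f y := by
  have hmax : IntegrableOn (fun y => max (y - q) 0 * f y) 𝒴 :=
    integrableOn_tail_excess _ h𝒴 hM hf
  have h1 : IntegrableOn ((Ioi q).indicator f) 𝒴 := hf.indicator measurableSet_Ioi
  rw [← hq, ← integral_const_mul, ← integral_add (h1.const_mul q) hmax]
  congr 1
  ext y
  by_cases h : y ∈ Ioi q
  · have : q < y := h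
    simp only [indicator_of_mem h]
    rw [max_eq_left (by linarith)]
    ring
  · have : y ≤ q := not_lt.1 h
    simp only [indicator_of_notMem h]
    rw [max_eq_right (by linarith)]
    ring

/-- Each tail expectation is a minimum over levels, attained at its own quantile, so testing other
levels gives inequalities. Only the distance between `q₁` and `q₂` enters, not a second difference
of quantiles: the error from moving the level is a product of two first differences. -/
lemma abs_second_difference_tail_le {f₀ f₁ f₂ : ℝ → ℝ} {q₀ q₁ q₂ υ s A L Q : ℝ}
    (h𝒴 : MeasurableSet 𝒴) (hM0 : 0 ≤ M) (hM : ∀ y ∈ 𝒴, |y| ≤ M)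
    (hi₀ : IntegrableOn f₀ 𝒴) (hi₁ : IntegrableOn f₁ 𝒴) (hi₂ : IntegrableOn f₂ 𝒴)
    (hf₀ : ∀ y ∈ 𝒴, 0 ≤ f₀ y) (hf₁ : ∀ y ∈ 𝒴, 0 ≤ f₁ y) (hf₂ : ∀ y ∈ 𝒴, 0 ≤ f₂ y)
    (hq₀ : ∫ y in 𝒴, (Ioi q₀).indicator f₀ y = 1 - υ)
    (hq₁ : ∫ y in 𝒴, (Ioi q₁).indicator f₁ y = 1 - υ)
    (hq₂ : ∫ y in 𝒴, (Ioi q₂).indicator f₂ y = 1 - υ)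
    (hm₀ : |q₀| ≤ M) (hm₂ : |q₂| ≤ M)
    (hA : ∀ y ∈ 𝒴, |f₁ y + f₂ y - 2 * f₀ y| ≤ A * s ^ 2)
    (hL : ∀ y ∈ 𝒴, |f₁ y - f₀ y| ≤ L * |s|) (hQ : |q₁ - q₂| ≤ Q * |s|)
    (hA0 : 0 ≤ A) (hL0 : 0 ≤ L) (hQ0 : 0 ≤ Q) :
    |(∫ y in 𝒴, (Ioi q₁).indicator (fun y => y * f₁ y) y) +
      (∫ y in 𝒴, (Ioi q₂).indicator (fun y => y * f₂ y) y) -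
      2 * ∫ y in 𝒴, (Ioi q₀).indicator (fun y => y * f₀ y) y| ≤
      (2 * M * A + Q * L) * (2 * M) * s ^ 2 := by
  have hmaxI : ∀ (c : ℝ) (f : ℝ → ℝ), IntegrableOn f 𝒴 →
      IntegrableOn (fun y => max (y - c) 0 * f y) 𝒴 :=
    fun c f hf => integrableOn_tail_excess c h𝒴 hM hf
  -- a tail excess over a level in `[-M, M]` has small second difference
  have hΔ : ∀ c, |c| ≤ M → |∫ y in 𝒴, max (y - c) 0 * (f₁ y + f₂ y - 2 * f₀ y)| ≤
      2 * M * (A * s ^ 2) * (2 * M) := by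
    intro c hc
    refine abs_setIntegral_le hM0 (by positivity) hM fun y hy => ?_
    rw [abs_mul, abs_of_nonneg (le_max_right _ _)]
    have := abs_le.1 (hM y hy)
    have := abs_le.1 hc
    exact mul_le_mul (max_le (by linarith) (by linarith)) (hA y hy) (abs_nonneg _) (by linarith)
  have hsplit : ∀ c, ∫ y in 𝒴, max (y - c) 0 * (f₁ y + f₂ y - 2 * f₀ y) =
      (∫ y in 𝒴, max (y - c) 0 * f₁ y) + (∫ y in 𝒴, max (y - c) 0 * f₂ y) -
        2 * ∫ y in 𝒴, max (y - c) 0 * f₀ y := by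
    intro c
    have hi : IntegrableOn (fun y => max (y - c) 0 * f₁ y + max (y - c) 0 * f₂ y) 𝒴 :=
      (hmaxI c _ hi₁).add (hmaxI c _ hi₂)
    rw [← integral_add (hmaxI c _ hi₁) (hmaxI c _ hi₂), ← integral_const_mul,
      ← integral_sub hi ((hmaxI c _ hi₀).const_mul 2)]
    congr 1
    ext y
    ring
  have hQL : 0 ≤ Q * L * (2 * M) * s ^ 2 := by positivity
  rw [abs_le]
  constructor
  -- Lower bound: the midpoint of `q₁` and `q₂` is tested in the minimum for `f₀`, and convexity of
  -- `c ↦ (y - c)₊` returns to the levels `q₁` and `q₂`. What remains is the second difference of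
  -- densities at level `q₂` plus the product of first differences in `hcross`.
  · have e₁ := tail_expectation_eq h𝒴 hM hi₁ hq₁
    have e₂ := tail_expectation_eq h𝒴 hM hi₂ hq₂
    have e₀ := tail_expectation_le (c := (q₁ + q₂) / 2) h𝒴 hM hi₀ hf₀ hq₀
    have hconv : 2 * ∫ y in 𝒴, max (y - (q₁ + q₂) / 2) 0 * f₀ y ≤
        (∫ y in 𝒴, max (y - q₁) 0 * f₀ y) + ∫ y in 𝒴, max (y - q₂) 0 * f₀ y := by
      rw [← integral_const_mul, ← integral_add (hmaxI _ _ hi₀) (hmaxI _ _ hi₀)]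
      refine setIntegral_mono_on ((hmaxI _ _ hi₀).const_mul 2)
        ((hmaxI _ _ hi₀).add (hmaxI _ _ hi₀)) h𝒴 fun y hy => ?_
      have : 2 * max (y - (q₁ + q₂) / 2) 0 ≤ max (y - q₁) 0 + max (y - q₂) 0 := by
        have a1 := le_max_left (y - q₁) 0
        have a2 := le_max_left (y - q₂) 0
        have a3 := le_max_right (y - q₁) 0
        have a4 := le_max_right (y - q₂) 0
        rcases max_choice (y - (q₁ + q₂) / 2) 0 with h | h <;> rw [h] <;> linarith
      nlinarith [hf₀ y hy]
    have hcross : |∫ y in 𝒴, (max (y - q₁) 0 - max (y - q₂) 0) * (f₁ y - f₀ y)| ≤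
        Q * |s| * (L * |s|) * (2 * M) := by
      refine abs_setIntegral_le hM0 (by positivity) hM fun y hy => ?_
      rw [abs_mul]
      refine mul_le_mul ?_ (hL y hy) (abs_nonneg _) (by positivity)
      refine le_trans ?_ hQ
      have := abs_max_sub_max_le_abs (y - q₁) (y - q₂) 0
      rw [show y - q₁ - (y - q₂) = -(q₁ - q₂) by ring, abs_neg] at this
      exact this
    have hcs : ∫ y in 𝒴, (max (y - q₁) 0 - max (y - q₂) 0) * (f₁ y - f₀ y) =
        ((∫ y in 𝒴, max (y - q₁) 0 * f₁ y) - ∫ y in 𝒴, max (y - q₁) 0 * f₀ y) -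
        ((∫ y in 𝒴, max (y - q₂) 0 * f₁ y) - ∫ y in 𝒴, max (y - q₂) 0 * f₀ y) := by
      have hi : ∀ c, IntegrableOn (fun y => max (y - c) 0 * f₁ y - max (y - c) 0 * f₀ y) 𝒴 :=
        fun c => (hmaxI _ _ hi₁).sub (hmaxI _ _ hi₀)
      rw [← integral_sub (hmaxI _ _ hi₁) (hmaxI _ _ hi₀),
        ← integral_sub (hmaxI _ _ hi₁) (hmaxI _ _ hi₀), ← integral_sub (hi _) (hi _)]
      congr 1
      ext y
      ring
    have hss : |s| * |s| = s ^ 2 := by rw [← sq, sq_abs]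
    have hb : Q * |s| * (L * |s|) * (2 * M) = Q * L * (2 * M) * s ^ 2 := by
      rw [← hss]; ring
    have h2 := abs_le.1 (hΔ q₂ hm₂)
    have h3 := abs_le.1 hcross
    rw [hsplit] at h2
    rw [hcs, hb] at h3
    linarith [h2.1, h3.1]
  -- Upper bound: the level `q₀` is tested in the minima for `f₁` and `f₂`, and the terms in `q₀ (1
  -- - υ)` cancel.
  · have e₁ := tail_expectation_le (c := q₀) h𝒴 hM hi₁ hf₁ hq₁
    have e₂ := tail_expectation_le (c := q₀) h𝒴 hM hi₂ hf₂ hq₂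
    have e₀ := tail_expectation_eq h𝒴 hM hi₀ hq₀
    have h2 := abs_le.1 (hΔ q₀ hm₀)
    rw [hsplit] at h2
    linarith [h2.2]

end TailExpectation

/-! ### Conditional laws and quantiles -/

section CondLaw

variable {𝒳 : Type*} [MeasurableSpace 𝒳] {𝒯 𝒴 : Set ℝ} {fT : 𝒳 → ℝ → ℝ} {fY : 𝒳 → ℝ → ℝ → ℝ}
  {mf M : ℝ}

lemma ArePositiveDensities.measurable_section (hf : ArePositiveDensities 𝒯 𝒴 fT fY mf) (x : 𝒳)
    (t : ℝ) : Measurable (fY x t) :=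
  hf.measurable_outcome.comp (measurable_const.prodMk (measurable_const.prodMk measurable_id))

lemma ArePositiveDensities.isProbabilityMeasure (hf : ArePositiveDensities 𝒯 𝒴 fT fY mf) (x : 𝒳)
    {t : ℝ} (ht : t ∈ 𝒯) : IsProbabilityMeasure (condLaw 𝒴 fY x t) := by
  constructor
  rw [condLaw, withDensity_apply _ MeasurableSet.univ, Measure.restrict_univ]
  exact hf.outcome_mass x t ht

omit [MeasurableSpace 𝒳] in
lemma condLaw_absolutelyContinuous (x : 𝒳) (t : ℝ) :
    condLaw 𝒴 fY x t ≪ volume.restrict 𝒴 :=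
  withDensity_absolutelyContinuous _ _

omit [MeasurableSpace 𝒳] in
instance nullSingletonClass_condLaw (x : 𝒳) (t : ℝ) : NullSingletonClass (condLaw 𝒴 fY x t) where
  measure_singleton y := condLaw_absolutelyContinuous x t (measure_singleton y)

lemma ArePositiveDensities.ae_mem (hf : ArePositiveDensities 𝒯 𝒴 fT fY mf) (x : 𝒳) (t : ℝ) :
    ∀ᵐ y ∂(condLaw 𝒴 fY x t), y ∈ 𝒴 :=
  (condLaw_absolutelyContinuous x t).ae_le (ae_restrict_mem hf.measurableSet_outcome)

lemma ArePositiveDensities.integral_condLaw (hf : ArePositiveDensities 𝒯 𝒴 fT fY mf) (x : 𝒳)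
    (t : ℝ) (g : ℝ → ℝ) :
    ∫ y, g y ∂(condLaw 𝒴 fY x t) = ∫ y in 𝒴, (ENNReal.ofReal (fY x t y)).toReal * g y := by
  rw [condLaw, integral_withDensity_eq_integral_toReal_smul
    (hf.measurable_section x t).ennreal_ofReal (Eventually.of_forall fun _ => ENNReal.ofReal_lt_top)]
  rfl

lemma ArePositiveDensities.integral_condLaw_of_mem (hf : ArePositiveDensities 𝒯 𝒴 fT fY mf)
    (x : 𝒳) {t : ℝ} (ht : t ∈ 𝒯) (g : ℝ → ℝ) :
    ∫ y, g y ∂(condLaw 𝒴 fY x t) = ∫ y in 𝒴, fY x t y * g y := by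
  rw [hf.integral_condLaw]
  refine setIntegral_congr_fun hf.measurableSet_outcome fun y hy => ?_
  simp only [ENNReal.toReal_ofReal (hf.outcome_pos x t ht y hy).le]

lemma ArePositiveDensities.integrableOn_section (hf : ArePositiveDensities 𝒯 𝒴 fT fY mf) (x : 𝒳)
    {t : ℝ} (ht : t ∈ 𝒯) : IntegrableOn (fY x t) 𝒴 := by
  refine (lintegral_ofReal_ne_top_iff_integrable (hf.measurable_section x t).aestronglyMeasurable
    (ae_restrict_of_forall_mem hf.measurableSet_outcome fun y hy =>
      (hf.outcome_pos x t ht y hy).le)).1 ?_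
  rw [hf.outcome_mass x t ht]
  simp

variable (hf : ArePositiveDensities 𝒯 𝒴 fT fY mf) (hM : ∀ y ∈ 𝒴, |y| ≤ M)
include hf hM

lemma ArePositiveDensities.ae_abs_le (x : 𝒳) (t : ℝ) :
    ∀ᵐ y ∂(condLaw 𝒴 fY x t), |y| ≤ M :=
  (hf.ae_mem x t).mono hM

lemma ArePositiveDensities.integrable_id (x : 𝒳) {t : ℝ} (ht : t ∈ 𝒯) :
    Integrable (fun y : ℝ => y) (condLaw 𝒴 fY x t) :=
  have := hf.isProbabilityMeasure x ht
  Integrable.of_bound measurable_id.aestronglyMeasurable M (hf.ae_abs_le hM x t)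

lemma ArePositiveDensities.bound_nonneg (x : 𝒳) {t : ℝ} (ht : t ∈ 𝒯) : 0 ≤ M := by
  have := hf.isProbabilityMeasure x ht
  obtain ⟨y, hy⟩ := (hf.ae_abs_le hM x t).exists
  exact (abs_nonneg y).trans hy

lemma ArePositiveDensities.abs_condMean_le (x : 𝒳) {t : ℝ} (ht : t ∈ 𝒯) :
    |condMean 𝒴 fY t x| ≤ M := by
  have := hf.isProbabilityMeasure x ht
  have h := norm_integral_le_of_norm_le_const (μ := condLaw 𝒴 fY x t) (f := fun y : ℝ => y)
    (C := M) (hf.ae_abs_le hM x t)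
  simpa [condMean] using h

lemma ArePositiveDensities.integral_sub_condMean (x : 𝒳) {t : ℝ} (ht : t ∈ 𝒯) :
    ∫ y, (y - condMean 𝒴 fY t x) ∂(condLaw 𝒴 fY x t) = 0 := by
  have := hf.isProbabilityMeasure x ht
  rw [integral_sub (hf.integrable_id hM x ht) (integrable_const _)]
  simp [condMean]

lemma ArePositiveDensities.ae_abs_sub_condMean_le (x : 𝒳) {t : ℝ} (ht : t ∈ 𝒯) :
    ∀ᵐ y ∂(condLaw 𝒴 fY x t), |y - condMean 𝒴 fY t x| ≤ 2 * M := by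
  filter_upwards [hf.ae_abs_le hM x t] with y hy
  have h1 := abs_le.1 (hf.abs_condMean_le hM x ht)
  have h2 := abs_le.1 hy
  exact abs_le.2 ⟨by linarith, by linarith⟩

omit hM in
-- Up to a constant the distribution function is a primitive of `1` for a law without atoms.
lemma ArePositiveDensities.continuous_real_Iic (x : 𝒳) {t : ℝ} (ht : t ∈ 𝒯) :
    Continuous fun q => (condLaw 𝒴 fY x t).real (Iic q) := by
  have := hf.isProbabilityMeasure x ht
  have h : ∀ b, (condLaw 𝒴 fY x t).real (Iic b) =
      (condLaw 𝒴 fY x t).real (Iic 0) + ∫ _ in (0 : ℝ)..b, (1 : ℝ) ∂(condLaw 𝒴 fY x t) := by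
    intro b
    rw [← intervalIntegral.integral_Iic_sub_Iic (integrable_const _).integrableOn
      (integrable_const _).integrableOn]
    simp
  rw [funext h]
  exact continuous_const.add
    (intervalIntegral.continuous_primitive (fun a b => intervalIntegrable_const) 0)

/-- Let `F` be the continuous distribution function. The set where `F` exceeds `υ` is open, so it
cannot contain its infimum; the set where `F` is at least `υ` is closed, so it does. The bound
reflects the support of the law. -/
lemma ArePositiveDensities.condQuantile_spec (x : 𝒳) {t : ℝ} (ht : t ∈ 𝒯) {υ : ℝ}
    (hυ : υ ∈ Ico (0 : ℝ) 1) :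
    (condLaw 𝒴 fY x t).real (Iic (condQuantile 𝒴 fY υ x t)) = υ ∧
      |condQuantile 𝒴 fY υ x t| ≤ M := by
  have := hf.isProbabilityMeasure x ht
  have hc := hf.continuous_real_Iic x ht
  set F := fun q => (condLaw 𝒴 fY x t).real (Iic q)
  set A := {q | υ < F q} with hA
  have hMA : M ∈ A := by
    have : F M = 1 := by
      have h : (condLaw 𝒴 fY x t) (Iic M) = 1 := by
        rw [prob_compl_eq_zero_iff measurableSet_Iic |>.symm]
        exact (hf.ae_abs_le hM x t).mono fun y hy => (abs_le.1 hy).2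
      simp [F, Measure.real, h]
    have h : υ < F M := by rw [this]; exact hυ.2
    exact h
  have hlow : ∀ q ∈ A, -M ≤ q := by
    intro q hq
    by_contra hlt
    push Not at hlt
    have h : (condLaw 𝒴 fY x t) (Iic q) = 0 := by
      refine measure_mono_null (t := {y | ¬ |y| ≤ M}) (fun y hy => ?_) (hf.ae_abs_le hM x t)
      have : y ≤ q := hy
      intro h
      linarith [(abs_le.1 h).1]
    have : F q = 0 := by simp [F, Measure.real, h]
    have hq' : υ < F q := hq
    rw [this] at hq'
    exact absurd hυ.1 (not_le.2 hq')
  have hbdd : BddBelow A := ⟨-M, hlow⟩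
  have hq : condQuantile 𝒴 fY υ x t = sInf A := rfl
  rw [hq]
  refine ⟨le_antisymm ?_ ?_, abs_le.2 ⟨le_csInf ⟨M, hMA⟩ hlow, csInf_le hbdd hMA⟩⟩
  · by_contra hlt
    push Not at hlt
    have hmem : sInf A ∈ A := hlt
    have hopen : IsOpen A := isOpen_lt continuous_const hc
    obtain ⟨a, ha, has⟩ := exists_Ioc_subset_of_mem_nhds (hopen.mem_nhds hmem)
      ⟨sInf A - 1, by linarith⟩
    obtain ⟨b, hb1, hb2⟩ := exists_between ha
    have : sInf A ≤ b := csInf_le hbdd (has ⟨hb1, hb2.le⟩)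
    linarith
  · have hcl : IsClosed {q | υ ≤ F q} := isClosed_le continuous_const hc
    have hsub : A ⊆ {q | υ ≤ F q} := fun q hq => le_of_lt (show υ < F q from hq)
    exact closure_minimal hsub hcl (csInf_mem_closure ⟨M, hMA⟩ hbdd)

end CondLaw

/-! ### Tails -/

/-- The order of the quantile used on each side. -/
noncomputable def level (s : Side) (Γ : ℝ) : ℝ :=
  match s with
  | .lower => 1 - gam Γ
  | .upper => gam Γ

/-- The outcomes in the tail, given `X = x` and `T = t`. -/
def tailSection {𝒳 : Type*} (s : Side) (Γ : ℝ) (𝒴 : Set ℝ) (fY : 𝒳 → ℝ → ℝ → ℝ) (x : 𝒳)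
    (t : ℝ) : Set ℝ :=
  {y | (x, t, y) ∈ tailSet s Γ 𝒴 fY}

/-- `E[(Y - η(t, x)) 1{Y in the tail} | X = x, T = t]`. -/
noncomputable def tailMean {𝒳 : Type*} (s : Side) (Γ : ℝ) (𝒴 : Set ℝ) (fY : 𝒳 → ℝ → ℝ → ℝ)
    (x : 𝒳) (t : ℝ) : ℝ :=
  ∫ y in tailSection s Γ 𝒴 fY x t, (y - condMean 𝒴 fY t x) ∂(condLaw 𝒴 fY x t)

lemma one_half_le_gam {Γ : ℝ} (hΓ : 1 ≤ Γ) : 1 / 2 ≤ gam Γ := by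
  unfold gam
  rw [div_le_div_iff₀ (by norm_num) (by linarith)]
  linarith

lemma gam_lt_one {Γ : ℝ} (hΓ : 1 ≤ Γ) : gam Γ < 1 := by
  unfold gam
  rw [div_lt_one (by linarith)]
  linarith

lemma level_mem {Γ : ℝ} (hΓ : 1 ≤ Γ) (s : Side) : level s Γ ∈ Ico (0 : ℝ) 1 := by
  have h1 := one_half_le_gam hΓ
  have h2 := gam_lt_one hΓ
  cases s
  · exact ⟨by simp only [level]; linarith, by simp only [level]; linarith⟩
  · exact ⟨by simp only [level]; linarith, by simp only [level]; linarith⟩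

/-- This is why the extremal weight, equal to `Γ` on a tail of probability `1 - γ` and to `Γ⁻¹`
elsewhere, has mean one. -/
lemma inv_add_mul_one_sub_gam {Γ : ℝ} (hΓ : 1 ≤ Γ) : Γ⁻¹ + (Γ - Γ⁻¹) * (1 - gam Γ) = 1 := by
  have h1 : Γ ≠ 0 := by linarith
  have h2 : 1 + Γ ≠ 0 := by linarith
  unfold gam
  field_simp
  ring

/-- The factor of the tail form, divided by the probability of the tail, is the coefficient in the
closed form of the bounds. -/
lemma gam_ratio {Γ : ℝ} (hΓ : 1 ≤ Γ) : (2 * gam Γ - 1) / gam Γ / (1 - gam Γ) = Γ - Γ⁻¹ := by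
  have h1 : Γ ≠ 0 := by linarith
  have h2 : 1 + Γ ≠ 0 := by linarith
  have h3 : 1 - Γ / (1 + Γ) = 1 / (1 + Γ) := by field_simp; ring
  unfold gam
  rw [h3]
  field_simp
  ring

lemma sideQuantile_eq {𝒳 : Type*} (s : Side) (Γ : ℝ) (𝒴 : Set ℝ) (fY : 𝒳 → ℝ → ℝ → ℝ) (x : 𝒳)
    (t : ℝ) : sideQuantile s Γ 𝒴 fY x t = condQuantile 𝒴 fY (level s Γ) x t := by
  cases s <;> rfl

lemma tailSection_upper {𝒳 : Type*} (Γ : ℝ) (𝒴 : Set ℝ) (fY : 𝒳 → ℝ → ℝ → ℝ) (x : 𝒳) (t : ℝ) :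
    tailSection .upper Γ 𝒴 fY x t = Ioi (sideQuantile .upper Γ 𝒴 fY x t) := rfl

lemma tailSection_lower {𝒳 : Type*} (Γ : ℝ) (𝒴 : Set ℝ) (fY : 𝒳 → ℝ → ℝ → ℝ) (x : 𝒳) (t : ℝ) :
    tailSection .lower Γ 𝒴 fY x t = Iic (sideQuantile .lower Γ 𝒴 fY x t) := rfl

lemma measurableSet_tailSection {𝒳 : Type*} (s : Side) (Γ : ℝ) (𝒴 : Set ℝ)
    (fY : 𝒳 → ℝ → ℝ → ℝ) (x : 𝒳) (t : ℝ) : MeasurableSet (tailSection s Γ 𝒴 fY x t) := by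
  cases s
  · rw [tailSection_lower]; exact measurableSet_Iic
  · rw [tailSection_upper]; exact measurableSet_Ioi

section Tails

variable {𝒳 : Type*} [MeasurableSpace 𝒳] {𝒯 𝒴 : Set ℝ} {fT : 𝒳 → ℝ → ℝ} {fY : 𝒳 → ℝ → ℝ → ℝ}
  {mf M Γ : ℝ} (hf : ArePositiveDensities 𝒯 𝒴 fT fY mf) (hM : ∀ y ∈ 𝒴, |y| ≤ M) (hΓ : 1 ≤ Γ)
include hf hM hΓ

lemma ArePositiveDensities.sideQuantile_spec (s : Side) (x : 𝒳) {t : ℝ} (ht : t ∈ 𝒯) :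
    (condLaw 𝒴 fY x t).real (Iic (sideQuantile s Γ 𝒴 fY x t)) = level s Γ := by
  rw [sideQuantile_eq]
  exact (hf.condQuantile_spec hM x ht (level_mem hΓ s)).1

lemma ArePositiveDensities.real_tailSection (s : Side) (x : 𝒳) {t : ℝ} (ht : t ∈ 𝒯) :
    (condLaw 𝒴 fY x t).real (tailSection s Γ 𝒴 fY x t) = 1 - gam Γ := by
  have := hf.isProbabilityMeasure x ht
  cases s
  · exact hf.sideQuantile_spec hM hΓ .lower x ht
  · rw [tailSection_upper, ← compl_Iic, probReal_compl_eq_one_sub measurableSet_Iic,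
      hf.sideQuantile_spec hM hΓ .upper x ht]
    rfl

omit hΓ in
lemma ArePositiveDensities.abs_tailMean_le (s : Side) (x : 𝒳) {t : ℝ} (ht : t ∈ 𝒯) :
    |tailMean s Γ 𝒴 fY x t| ≤ 2 * M := by
  have := hf.isProbabilityMeasure x ht
  have hM0 := hf.bound_nonneg hM x ht
  have h := norm_setIntegral_le_of_norm_le_const_ae (μ := condLaw 𝒴 fY x t)
    (s := tailSection s Γ 𝒴 fY x t) (f := fun y => y - condMean 𝒴 fY t x) (C := 2 * M)
    (measure_lt_top _ _) (ae_restrict_of_ae (hf.ae_abs_sub_condMean_le hM x ht))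
  refine h.trans (mul_le_of_le_one_right (by positivity) measureReal_le_one)

/-- The weight function which is extremal in the definition of the bounds. -/
lemma ArePositiveDensities.extremal_weight_mem (s : Side) :
    (fun y x t => Γ⁻¹ + (Γ - Γ⁻¹) * (tailSection s Γ 𝒴 fY x t).indicator 1 y) ∈
      weights Γ 𝒯 𝒴 fY := by
  have hinv : Γ⁻¹ ≤ 1 := inv_le_one_of_one_le₀ hΓ
  refine ⟨fun x t => ?_, fun y x t => ?_, fun x t ht => ?_⟩
  · exact ((measurable_one.indicator (measurableSet_tailSection s Γ 𝒴 fY x t)).const_mul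
      _).const_add _
  · by_cases h : y ∈ tailSection s Γ 𝒴 fY x t
    · simp only [indicator_of_mem h, Pi.one_apply]
      exact ⟨by linarith, by linarith⟩
    · simp only [indicator_of_notMem h]
      exact ⟨by linarith, by linarith⟩
  · have := hf.isProbabilityMeasure x ht
    have hms := measurableSet_tailSection s Γ 𝒴 fY x t
    have hI : Integrable ((tailSection s Γ 𝒴 fY x t).indicator (1 : ℝ → ℝ)) (condLaw 𝒴 fY x t) :=
      (integrable_const (1 : ℝ)).indicator hms
    rw [integral_add (integrable_const _) (hI.const_mul _), integral_const_mul,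
      integral_indicator_one hms, hf.real_tailSection hM hΓ s x ht]
    simp only [integral_const, probReal_univ, smul_eq_mul, one_mul]
    exact inv_add_mul_one_sub_gam hΓ

omit hΓ in
-- `Y - η` is conditionally centered, so the constant part `Γ⁻¹` of the weight contributes nothing.
lemma ArePositiveDensities.weightedMean_extremal (s : Side) (x : 𝒳) {τ : ℝ} (hτ : τ ∈ 𝒯) :
    weightedMean 𝒴 fY τ x
      (fun y x t => Γ⁻¹ + (Γ - Γ⁻¹) * (tailSection s Γ 𝒴 fY x t).indicator 1 y) =
      (Γ - Γ⁻¹) * tailMean s Γ 𝒴 fY x τ := by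
  have := hf.isProbabilityMeasure x hτ
  have hms := measurableSet_tailSection s Γ 𝒴 fY x τ
  have hI : Integrable (fun y => y - condMean 𝒴 fY τ x) (condLaw 𝒴 fY x τ) :=
    (hf.integrable_id hM x hτ).sub (integrable_const _)
  have hE : ∀ y, (y - condMean 𝒴 fY τ x) *
      (Γ⁻¹ + (Γ - Γ⁻¹) * (tailSection s Γ 𝒴 fY x τ).indicator 1 y) =
      Γ⁻¹ * (y - condMean 𝒴 fY τ x) + (Γ - Γ⁻¹) *
        (tailSection s Γ 𝒴 fY x τ).indicator (fun y => y - condMean 𝒴 fY τ x) y := by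
    intro y
    by_cases h : y ∈ tailSection s Γ 𝒴 fY x τ
    · simp only [indicator_of_mem h, Pi.one_apply]
      ring
    · simp only [indicator_of_notMem h]
      ring
  unfold weightedMean
  simp only [hE]
  rw [integral_add (hI.const_mul _) ((hI.indicator hms).const_mul _), integral_const_mul,
    integral_const_mul, hf.integral_sub_condMean hM x hτ, integral_indicator hms, mul_zero, zero_add]
  rfl

omit hΓ in
/-- Two weight functions are compared through `Y - q` for any constant `q`. -/
lemma ArePositiveDensities.weightedMean_sub (x : 𝒳) {τ : ℝ} (hτ : τ ∈ 𝒯) (q : ℝ)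
    {v w : ℝ → 𝒳 → ℝ → ℝ} (hv : v ∈ weights Γ 𝒯 𝒴 fY) (hw : w ∈ weights Γ 𝒯 𝒴 fY) :
    weightedMean 𝒴 fY τ x v - weightedMean 𝒴 fY τ x w =
      ∫ y, (y - q) * (v y x τ - w y x τ) ∂(condLaw 𝒴 fY x τ) := by
  have := hf.isProbabilityMeasure x hτ
  have hid := hf.integrable_id hM x hτ
  have hbd : ∀ {w : ℝ → 𝒳 → ℝ → ℝ}, w ∈ weights Γ 𝒯 𝒴 fY → ∀ y, ‖w y x τ‖ ≤ |Γ| + |Γ⁻¹| := by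
    intro w hw y
    have := hw.2.1 y x τ
    rw [Real.norm_eq_abs, abs_le]
    exact ⟨by linarith [this.1, neg_abs_le Γ⁻¹, abs_nonneg Γ],
      by linarith [this.2, le_abs_self Γ, abs_nonneg Γ⁻¹]⟩
  have hw1 : ∀ {w : ℝ → 𝒳 → ℝ → ℝ}, w ∈ weights Γ 𝒯 𝒴 fY →
      Integrable (fun y => w y x τ) (condLaw 𝒴 fY x τ) := fun {w} hw =>
    Integrable.of_bound (hw.1 x τ).aestronglyMeasurable _ (Eventually.of_forall (hbd hw))
  have hyw : ∀ (c : ℝ) {w : ℝ → 𝒳 → ℝ → ℝ}, w ∈ weights Γ 𝒯 𝒴 fY →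
      Integrable (fun y => (y - c) * w y x τ) (condLaw 𝒴 fY x τ) := fun c {w} hw =>
    (hid.sub (integrable_const c)).mul_bdd (hw.1 x τ).aestronglyMeasurable
      (Eventually.of_forall (hbd hw))
  -- Every weight has conditional mean one, so recentring at `q` shifts all weighted means by the
  -- same amount.
  have hshift : ∀ {w : ℝ → 𝒳 → ℝ → ℝ}, w ∈ weights Γ 𝒯 𝒴 fY →
      weightedMean 𝒴 fY τ x w =
        (∫ y, (y - q) * w y x τ ∂(condLaw 𝒴 fY x τ)) + (q - condMean 𝒴 fY τ x) := by
    intro w hw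
    have h1 : ∫ y, (q - condMean 𝒴 fY τ x) * w y x τ ∂(condLaw 𝒴 fY x τ) =
        q - condMean 𝒴 fY τ x := by
      rw [integral_const_mul, hw.2.2 x τ hτ, mul_one]
    rw [← h1, ← integral_add (hyw q hw) ((hw1 hw).const_mul _)]
    unfold weightedMean
    congr 1
    ext y
    ring
  rw [hshift hv, hshift hw, add_sub_add_right_eq_sub, ← integral_sub (hyw q hv) (hyw q hw)]
  congr 1
  ext y
  ring

/-- The bounds in closed form. -/
lemma ArePositiveDensities.capoBound_eq (s : Side) (x : 𝒳) {τ : ℝ} (hτ : τ ∈ 𝒯) :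
    capoBound s Γ 𝒯 𝒴 fY τ x =
      condMean 𝒴 fY τ x + (Γ - Γ⁻¹) * tailMean s Γ 𝒴 fY x τ := by
  have hmem := hf.extremal_weight_mem hM hΓ s
  have heq := hf.weightedMean_extremal (Γ := Γ) hM s x hτ
  cases s
  · have : IsLeast (weightedMean 𝒴 fY τ x '' weights Γ 𝒯 𝒴 fY)
        ((Γ - Γ⁻¹) * tailMean .lower Γ 𝒴 fY x τ) := by
      refine ⟨⟨_, hmem, heq⟩, ?_⟩
      rintro _ ⟨w, hw, rfl⟩
      rw [← heq, ← sub_nonneg, hf.weightedMean_sub hM x hτ (sideQuantile .lower Γ 𝒴 fY x τ) hw hmem]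
      -- As in the Neyman–Pearson lemma, the sign is checked pointwise: the extremal weight is the
      -- largest possible where `y ≤ q` and the smallest possible where `y > q`.
      refine integral_nonneg fun y => ?_
      have hwy := hw.2.1 y x τ
      by_cases h : y ∈ tailSection .lower Γ 𝒴 fY x τ
      · have h' : y ≤ sideQuantile .lower Γ 𝒴 fY x τ := h
        simp only [indicator_of_mem h, Pi.one_apply]
        exact mul_nonneg_of_nonpos_of_nonpos (by linarith) (by linarith [hwy.2])
      · have h' : sideQuantile .lower Γ 𝒴 fY x τ < y := not_le.1 h
        simp only [indicator_of_notMem h]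
        exact mul_nonneg (by linarith) (by linarith [hwy.1])
    simp only [capoBound]
    rw [this.csInf_eq, add_comm]
  · have : IsGreatest (weightedMean 𝒴 fY τ x '' weights Γ 𝒯 𝒴 fY)
        ((Γ - Γ⁻¹) * tailMean .upper Γ 𝒴 fY x τ) := by
      refine ⟨⟨_, hmem, heq⟩, ?_⟩
      rintro _ ⟨w, hw, rfl⟩
      rw [← heq, ← sub_nonneg, hf.weightedMean_sub hM x hτ (sideQuantile .upper Γ 𝒴 fY x τ) hmem hw]
      refine integral_nonneg fun y => ?_
      have hwy := hw.2.1 y x τ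
      by_cases h : y ∈ tailSection .upper Γ 𝒴 fY x τ
      · have h' : sideQuantile .upper Γ 𝒴 fY x τ < y := h
        simp only [indicator_of_mem h, Pi.one_apply]
        exact mul_nonneg (by linarith) (by linarith [hwy.2])
      · have h' : y ≤ sideQuantile .upper Γ 𝒴 fY x τ := not_lt.1 h
        simp only [indicator_of_notMem h]
        exact mul_nonneg_of_nonpos_of_nonpos (by linarith) (by linarith [hwy.1])
    simp only [capoBound]
    rw [this.csSup_eq, add_comm]

/-- The tail mean in terms of the upper tail expectation at the quantile, up to sign. -/
lemma ArePositiveDensities.tailMean_eq (s : Side) (x : 𝒳) {t : ℝ} (ht : t ∈ 𝒯) :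
    tailMean s Γ 𝒴 fY x t = (match s with | .lower => -1 | .upper => 1) *
      ((∫ y in 𝒴, (Ioi (sideQuantile s Γ 𝒴 fY x t)).indicator (fun y => y * fY x t y) y) -
        (1 - level s Γ) * condMean 𝒴 fY t x) := by
  have := hf.isProbabilityMeasure x ht
  have hid := hf.integrable_id hM x ht
  set q := sideQuantile s Γ 𝒴 fY x t with hq
  have hlev : (condLaw 𝒴 fY x t).real (Ioi q) = 1 - level s Γ := by
    rw [← compl_Iic, probReal_compl_eq_one_sub measurableSet_Iic, hf.sideQuantile_spec hM hΓ s x ht]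
  have hU : ∫ y in Ioi q, y ∂(condLaw 𝒴 fY x t) =
      ∫ y in 𝒴, (Ioi q).indicator (fun y => y * fY x t y) y := by
    rw [← integral_indicator measurableSet_Ioi, hf.integral_condLaw_of_mem x ht]
    congr 1
    ext y
    by_cases h : y ∈ Ioi q
    · simp only [indicator_of_mem h]; ring
    · simp only [indicator_of_notMem h]; ring
  have hup : ∫ y in Ioi q, (y - condMean 𝒴 fY t x) ∂(condLaw 𝒴 fY x t) =
      (∫ y in 𝒴, (Ioi q).indicator (fun y => y * fY x t y) y) -
        (1 - level s Γ) * condMean 𝒴 fY t x := by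
    rw [integral_sub hid.integrableOn (integrable_const _), hU]
    simp [hlev]
  have hI : Integrable (fun y => y - condMean 𝒴 fY t x) (condLaw 𝒴 fY x t) :=
    hid.sub (integrable_const _)
  rw [← hup]
  cases s
  -- Since `Y - η` has conditional mean zero, its integral over the lower tail is minus the one over
  -- the complement.
  · have h := integral_add_compl (μ := condLaw 𝒴 fY x t) (measurableSet_Iic (a := q)) hI
    rw [hf.integral_sub_condMean hM x ht, compl_Iic] at h
    simp only [tailMean, tailSection_lower, ← hq]
    linarith
  · simp only [tailMean, tailSection_upper, ← hq, one_mul]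

/-- The tail mean has a second-order expansion at `τ`, uniformly in `x`. -/
lemma ArePositiveDensities.abs_second_difference_tailMean_le {τ d Mf Mf2 MQ2 : ℝ} (hd : 0 < d)
    (h𝒯 : Ioo (τ - d) (τ + d) ⊆ 𝒯) (hrf : IsRegularDensity 𝒯 𝒴 fY τ Mf Mf2)
    (hrq : IsRegularQuantile 𝒯 𝒴 fY MQ2) (s : Side) (x : 𝒳) (r : ℝ) (hr : |r| < d) :
    |tailMean s Γ 𝒴 fY x (τ + r) + tailMean s Γ 𝒴 fY x (τ - r) - 2 * tailMean s Γ 𝒴 fY x τ| ≤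
      ((2 * M * (2 * Mf2) + 2 * (4 * M / d + 2 * MQ2 * d) * (4 * Mf / d + 2 * Mf2 * d)) * (2 * M) +
        M * (2 * Mf2) * (2 * M)) * r ^ 2 := by
  have hr' := abs_lt.1 hr
  have hτ : τ ∈ 𝒯 := h𝒯 ⟨by linarith, by linarith⟩
  have hτ₁ : τ + r ∈ 𝒯 := h𝒯 ⟨by linarith, by linarith⟩
  have hτ₂ : τ - r ∈ 𝒯 := h𝒯 ⟨by linarith, by linarith⟩
  have hM0 := hf.bound_nonneg hM x hτ
  have hlev := level_mem hΓ s
  -- A point of `𝒴` is what makes `Mf` and `Mf2` nonnegative.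
  obtain ⟨y₀, hy₀⟩ : ∃ y, y ∈ 𝒴 := by
    have := hf.isProbabilityMeasure x hτ
    exact (hf.ae_mem x τ).exists
  have hMf0 : 0 ≤ Mf := (abs_nonneg _).trans (hrf.abs_le x y₀ hy₀)
  have hMf20 : 0 ≤ Mf2 := (abs_nonneg _).trans (hrf.abs_deriv_le x y₀ hy₀ τ hτ)
  have hMQ0 : 0 ≤ MQ2 := (abs_nonneg _).trans (hrq.abs_deriv_le x _ hlev τ hτ)
  -- The density is bounded above only at `τ`; positivity provides the lower bound elsewhere.
  have hreg : ∀ y ∈ 𝒴, ∀ r, |r| < d → _ := fun y hy =>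
    second_difference_and_lipschitz (B := Mf) hd h𝒯 (hrf.contDiffOn x y hy)
      (hrf.abs_deriv_le x y hy) ((le_abs_self _).trans (hrf.abs_le x y hy))
      (fun t ht => by linarith [hf.outcome_pos x t ht y hy])
  have hqM : ∀ t ∈ 𝒯, |condQuantile 𝒴 fY (level s Γ) x t| ≤ M := fun t ht =>
    (hf.condQuantile_spec hM x ht hlev).2
  have hregq : ∀ r, |r| < d → _ :=
    second_difference_and_lipschitz (B := M) hd h𝒯 (hrq.contDiffOn x _ hlev)
      (hrq.abs_deriv_le x _ hlev) (abs_le.1 (hqM τ hτ)).2 (fun t ht => (abs_le.1 (hqM t ht)).1)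
  have hIoi : ∀ t ∈ 𝒯, ∫ y in 𝒴, (Ioi (condQuantile 𝒴 fY (level s Γ) x t)).indicator (fY x t) y =
      1 - level s Γ := by
    intro t ht
    have := hf.isProbabilityMeasure x ht
    rw [← sideQuantile_eq, ← hf.sideQuantile_spec hM hΓ s x ht,
      ← probReal_compl_eq_one_sub measurableSet_Iic, compl_Iic,
      ← integral_indicator_one measurableSet_Ioi, hf.integral_condLaw_of_mem x ht]
    congr 1
    ext y
    simp [indicator_apply]
  have hQ : |condQuantile 𝒴 fY (level s Γ) x (τ + r) - condQuantile 𝒴 fY (level s Γ) x (τ - r)| ≤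
      2 * (4 * M / d + 2 * MQ2 * d) * |r| := by
    have h1 := abs_le.1 (hregq r hr).2
    have h2 := abs_le.1 (hregq (-r) (by rwa [abs_neg])).2
    rw [abs_neg, ← sub_eq_add_neg] at h2
    exact abs_le.2 ⟨by linarith, by linarith⟩
  have hU := abs_second_difference_tail_le hf.measurableSet_outcome hM0 hM
    (hf.integrableOn_section x hτ) (hf.integrableOn_section x hτ₁) (hf.integrableOn_section x hτ₂)
    (fun y hy => (hf.outcome_pos x _ hτ y hy).le) (fun y hy => (hf.outcome_pos x _ hτ₁ y hy).le)
    (fun y hy => (hf.outcome_pos x _ hτ₂ y hy).le) (hIoi _ hτ) (hIoi _ hτ₁) (hIoi _ hτ₂)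
    (hqM _ hτ) (hqM _ hτ₂) (fun y hy => (hreg y hy r hr).1) (fun y hy => (hreg y hy r hr).2) hQ
    (by positivity) (by positivity) (by positivity)
  have hη : |condMean 𝒴 fY (τ + r) x + condMean 𝒴 fY (τ - r) x - 2 * condMean 𝒴 fY τ x| ≤
      M * (2 * Mf2) * (2 * M) * r ^ 2 := by
    have hyI : ∀ t ∈ 𝒯, IntegrableOn (fun y => fY x t y * y) 𝒴 := fun t ht =>
      (hf.integrableOn_section x ht).mul_bdd measurable_id.aestronglyMeasurable
        (ae_restrict_of_forall_mem hf.measurableSet_outcome hM)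
    have hi : IntegrableOn (fun y => fY x (τ + r) y * y + fY x (τ - r) y * y) 𝒴 :=
      (hyI _ hτ₁).add (hyI _ hτ₂)
    have he : condMean 𝒴 fY (τ + r) x + condMean 𝒴 fY (τ - r) x - 2 * condMean 𝒴 fY τ x =
        ∫ y in 𝒴, (fY x (τ + r) y + fY x (τ - r) y - 2 * fY x τ y) * y := by
      unfold condMean
      rw [hf.integral_condLaw_of_mem x hτ, hf.integral_condLaw_of_mem x hτ₁,
        hf.integral_condLaw_of_mem x hτ₂, ← integral_add (hyI _ hτ₁) (hyI _ hτ₂),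
        ← integral_const_mul, ← integral_sub hi ((hyI _ hτ).const_mul 2)]
      congr 1
      ext y
      ring
    rw [he]
    have := abs_setIntegral_le (c := M * (2 * Mf2 * r ^ 2)) hM0 (by positivity) hM
      (g := fun y => (fY x (τ + r) y + fY x (τ - r) y - 2 * fY x τ y) * y) fun y hy => by
        rw [abs_mul, mul_comm]
        exact mul_le_mul (hM y hy) (hreg y hy r hr).1 (abs_nonneg _) hM0
    linarith
  rw [hf.tailMean_eq hM hΓ s x hτ, hf.tailMean_eq hM hΓ s x hτ₁, hf.tailMean_eq hM hΓ s x hτ₂]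
  simp only [sideQuantile_eq]
  have h1 := abs_le.1 hU
  have hlη : |(1 - level s Γ) *
      (condMean 𝒴 fY (τ + r) x + condMean 𝒴 fY (τ - r) x - 2 * condMean 𝒴 fY τ x)| ≤
      M * (2 * Mf2) * (2 * M) * r ^ 2 := by
    rw [abs_mul]
    refine le_trans (mul_le_of_le_one_left (abs_nonneg _) ?_) hη
    rw [abs_le]
    exact ⟨by linarith [hlev.2], by linarith [hlev.1]⟩
  have h2 := abs_le.1 hlη
  cases s
  · simp only at h1 h2 ⊢
    exact abs_le.2 ⟨by linarith [h1.1, h1.2, h2.1, h2.2], by linarith [h1.1, h1.2, h2.1, h2.2]⟩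
  · simp only at h1 h2 ⊢
    exact abs_le.2 ⟨by linarith [h1.1, h1.2, h2.1, h2.2], by linarith [h1.1, h1.2, h2.1, h2.2]⟩

end Tails

/-! ### The joint law -/

section JointLaw

variable {𝒳 : Type*} [MeasurableSpace 𝒳] {𝒯 𝒴 : Set ℝ} {fT : 𝒳 → ℝ → ℝ} {fY : 𝒳 → ℝ → ℝ → ℝ}
  {mf M Γ : ℝ}

/-! ### Joint measurability of means, quantiles and tails. -/

section Measurability

variable (hf : ArePositiveDensities 𝒯 𝒴 fT fY mf)
include hf

lemma ArePositiveDensities.measurable_density :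
    Measurable fun p : 𝒳 × ℝ × ℝ => ENNReal.ofReal (fT p.1 p.2.1 * fY p.1 p.2.1 p.2.2) :=
  ((hf.measurable_treatment.comp (measurable_fst.prodMk measurable_snd.fst)).mul
    hf.measurable_outcome).ennreal_ofReal

lemma ArePositiveDensities.measurable_outcome_assoc :
    Measurable fun p : (𝒳 × ℝ) × ℝ => fY p.1.1 p.1.2 p.2 :=
  hf.measurable_outcome.comp
    (measurable_fst.fst.prodMk (measurable_fst.snd.prodMk measurable_snd))

lemma ArePositiveDensities.measurable_condMean :
    Measurable fun p : 𝒳 × ℝ => condMean 𝒴 fY p.2 p.1 := by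
  unfold condMean
  simp_rw [fun (x : 𝒳) (t : ℝ) => hf.integral_condLaw x t fun y => y]
  have h : Measurable fun p : (𝒳 × ℝ) × ℝ =>
      (ENNReal.ofReal (fY p.1.1 p.1.2 p.2)).toReal * p.2 :=
    hf.measurable_outcome_assoc.ennreal_ofReal.ennreal_toReal.mul measurable_snd
  exact (h.stronglyMeasurable.integral_prod_right' (ν := volume.restrict 𝒴)).measurable

lemma ArePositiveDensities.measurable_condLaw_apply {A : Set ℝ} (hA : MeasurableSet A) :
    Measurable fun p : 𝒳 × ℝ => condLaw 𝒴 fY p.1 p.2 A := by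
  simp_rw [condLaw, withDensity_apply _ hA]
  exact Measurable.lintegral_prod_right' (ν := (volume.restrict 𝒴).restrict A)
    hf.measurable_outcome_assoc.ennreal_ofReal

lemma ArePositiveDensities.measurable_kernelResidual {K : ℝ → ℝ} (hK : Measurable K) (τ h : ℝ) :
    Measurable (kernelResidual 𝒴 fT fY K τ h) := by
  unfold kernelResidual scaledKernel
  refine Measurable.mul (Measurable.div ?_ ?_) ?_
  · exact (hK.comp ((measurable_snd.fst.sub_const τ).div_const h)).div_const h
  · exact hf.measurable_treatment.comp (measurable_fst.prodMk measurable_snd.fst)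
  · have h1 : Measurable fun p : 𝒳 × ℝ × ℝ => (p.1, p.2.1) :=
      measurable_fst.prodMk measurable_snd.fst
    have h2 := hf.measurable_condMean.comp h1
    exact measurable_snd.snd.sub h2

/-- By monotonicity the quantile is below `c` exactly when the distribution function exceeds `υ` at
some rational below `c`, a countable union. Outside `𝒯` the conditional law need not be a
probability, hence the indicator. -/
lemma ArePositiveDensities.measurable_condQuantile (hM : ∀ y ∈ 𝒴, |y| ≤ M) {υ : ℝ}
    (hυ : υ ∈ Ico (0 : ℝ) 1) :
    Measurable fun p : 𝒳 × ℝ => 𝒯.indicator (condQuantile 𝒴 fY υ p.1) p.2 := by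
  have h𝒯 : MeasurableSet {p : 𝒳 × ℝ | p.2 ∈ 𝒯} := measurable_snd hf.measurableSet_treatment
  refine measurable_of_Iio fun c => ?_
  have hset : (fun p : 𝒳 × ℝ => 𝒯.indicator (condQuantile 𝒴 fY υ p.1) p.2) ⁻¹' Iio c =
      ({p : 𝒳 × ℝ | p.2 ∈ 𝒯} ∩
        ⋃ r : {r : ℚ // (r : ℝ) < c}, {p | υ < (condLaw 𝒴 fY p.1 p.2).real (Iic (r : ℝ))}) ∪
      ({p : 𝒳 × ℝ | p.2 ∈ 𝒯}ᶜ ∩ {_p | 0 < c}) := by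
    ext ⟨x, t⟩
    by_cases ht : t ∈ 𝒯
    · have := hf.isProbabilityMeasure x ht
      have hq : condQuantile 𝒴 fY υ x t < c ↔
          ∃ r : {r : ℚ // (r : ℝ) < c}, υ < (condLaw 𝒴 fY x t).real (Iic (r : ℝ)) := by
        have hbdd : BddBelow {q : ℝ | υ < (condLaw 𝒴 fY x t).real (Iic q)} := by
          refine ⟨condQuantile 𝒴 fY υ x t, fun q hq => ?_⟩
          by_contra hlt
          have h1 := measureReal_mono (μ := condLaw 𝒴 fY x t) (Iic_subset_Iic.2 (not_le.1 hlt).le)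
          rw [(hf.condQuantile_spec hM x ht hυ).1] at h1
          exact absurd (show υ < (condLaw 𝒴 fY x t).real (Iic q) from hq) (not_lt.2 h1)
        constructor
        · intro hc
          obtain ⟨r, hr1, hr2⟩ := exists_rat_btwn hc
          refine ⟨⟨r, hr2⟩, ?_⟩
          have hne : {q : ℝ | υ < (condLaw 𝒴 fY x t).real (Iic q)}.Nonempty := by
            refine ⟨M, ?_⟩
            have h : (condLaw 𝒴 fY x t) (Iic M) = 1 := by
              rw [prob_compl_eq_zero_iff measurableSet_Iic |>.symm]
              exact (hf.ae_abs_le hM x t).mono fun y hy => (abs_le.1 hy).2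
            have h1 : (condLaw 𝒴 fY x t).real (Iic M) = 1 := by simp [Measure.real, h]
            exact (show υ < (condLaw 𝒴 fY x t).real (Iic M) by rw [h1]; exact hυ.2)
          obtain ⟨q, hq, hqr⟩ := exists_lt_of_csInf_lt hne hr1
          have hq' : υ < (condLaw 𝒴 fY x t).real (Iic q) := hq
          exact hq'.trans_le (measureReal_mono (Iic_subset_Iic.2 hqr.le))
        · rintro ⟨⟨r, hr⟩, hυr⟩
          exact (csInf_le hbdd hυr).trans_lt hr
      simp [ht, hq]
    · simp [ht]
  rw [hset]
  refine (h𝒯.inter (MeasurableSet.iUnion fun r => ?_)).union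
    (h𝒯.compl.inter (MeasurableSet.const _))
  exact measurableSet_lt measurable_const
    (hf.measurable_condLaw_apply measurableSet_Iic).ennreal_toReal

variable (hM : ∀ y ∈ 𝒴, |y| ≤ M) (hΓ : 1 ≤ Γ)
include hM hΓ

lemma ArePositiveDensities.measurable_sideQuantile (s : Side) :
    Measurable fun p : 𝒳 × ℝ => 𝒯.indicator (sideQuantile s Γ 𝒴 fY p.1) p.2 := by
  have := hf.measurable_condQuantile hM (level_mem hΓ s)
  have he : ∀ x, sideQuantile s Γ 𝒴 fY x = condQuantile 𝒴 fY (level s Γ) x := fun x =>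
    funext fun t => sideQuantile_eq s Γ 𝒴 fY x t
  simpa only [he] using this

lemma ArePositiveDensities.measurableSet_tail (s : Side) :
    MeasurableSet ({p : 𝒳 × ℝ × ℝ | p.2.1 ∈ 𝒯} ∩ tailSet s Γ 𝒴 fY) := by
  have h𝒯 : MeasurableSet {p : 𝒳 × ℝ × ℝ | p.2.1 ∈ 𝒯} :=
    measurable_snd.fst hf.measurableSet_treatment
  have hq := (hf.measurable_sideQuantile hM hΓ s).comp
    (measurable_fst.prodMk measurable_snd.fst : Measurable fun p : 𝒳 × ℝ × ℝ => (p.1, p.2.1))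
  cases s
  · convert h𝒯.inter (measurableSet_le measurable_snd.snd hq) using 1
    ext p
    simp only [mem_inter_iff]
    refine and_congr_right fun hp => ?_
    have hp' : p.2.1 ∈ 𝒯 := hp
    change _ ↔ p.2.2 ≤ 𝒯.indicator _ p.2.1
    rw [indicator_of_mem hp']
    rfl
  · convert h𝒯.inter (measurableSet_lt hq measurable_snd.snd) using 1
    ext p
    simp only [mem_inter_iff]
    refine and_congr_right fun hp => ?_
    have hp' : p.2.1 ∈ 𝒯 := hp
    change _ ↔ 𝒯.indicator _ p.2.1 < p.2.2
    rw [indicator_of_mem hp']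
    rfl

/-- Once the moving tail is written as an indicator, this is a partial integral of a jointly
measurable function over the fixed set `𝒴`. -/
lemma ArePositiveDensities.measurable_tailMean (s : Side) :
    Measurable fun p : 𝒳 × ℝ => 𝒯.indicator (tailMean s Γ 𝒴 fY p.1) p.2 := by
  have hE := hf.measurableSet_tail hM hΓ s
  have hG : Measurable (({p : 𝒳 × ℝ × ℝ | p.2.1 ∈ 𝒯} ∩ tailSet s Γ 𝒴 fY).indicator
      fun p => p.2.2 - condMean 𝒴 fY p.2.1 p.1) :=
    (measurable_snd.snd.sub (hf.measurable_condMean.comp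
      (measurable_fst.prodMk measurable_snd.fst))).indicator hE
  have hF := hf.measurable_outcome_assoc.ennreal_ofReal.ennreal_toReal.mul
    (hG.comp (measurable_fst.fst.prodMk (measurable_fst.snd.prodMk measurable_snd)))
  have h := (hF.stronglyMeasurable.integral_prod_right' (ν := volume.restrict 𝒴)).measurable
  convert h using 1
  ext ⟨x, t⟩
  simp only [Pi.mul_apply, Function.comp_apply]
  rw [← hf.integral_condLaw x t fun y => ({p : 𝒳 × ℝ × ℝ | p.2.1 ∈ 𝒯} ∩
    tailSet s Γ 𝒴 fY).indicator (fun p => p.2.2 - condMean 𝒴 fY p.2.1 p.1) (x, t, y)]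
  by_cases ht : t ∈ 𝒯
  · rw [indicator_of_mem ht, tailMean,
      ← integral_indicator (measurableSet_tailSection s Γ 𝒴 fY x t)]
    congr 1
    ext y
    by_cases hy : y ∈ tailSection s Γ 𝒴 fY x t
    · have hmem : (x, t, y) ∈ {p : 𝒳 × ℝ × ℝ | p.2.1 ∈ 𝒯} ∩ tailSet s Γ 𝒴 fY := ⟨ht, hy⟩
      rw [indicator_of_mem hy, indicator_of_mem hmem]
    · have hmem : (x, t, y) ∉ {p : 𝒳 × ℝ × ℝ | p.2.1 ∈ 𝒯} ∩ tailSet s Γ 𝒴 fY := fun h => hy h.2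
      rw [indicator_of_notMem hy, indicator_of_notMem hmem]
  · have hmem : ∀ y, (x, t, y) ∉ {p : 𝒳 × ℝ × ℝ | p.2.1 ∈ 𝒯} ∩ tailSet s Γ 𝒴 fY :=
      fun y h => ht h.1
    simp only [indicator_of_notMem ht, indicator_of_notMem (hmem _), integral_zero]

end Measurability

/-! ### Disintegration of the joint law. -/

section Fubini

variable (hf : ArePositiveDensities 𝒯 𝒴 fT fY mf) (hmf : 0 < mf) (PX : Measure 𝒳)

lemma jointLaw_absolutelyContinuous :
    jointLaw PX 𝒯 𝒴 fT fY ≪ PX.prod ((volume.restrict 𝒯).prod (volume.restrict 𝒴)) :=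
  withDensity_absolutelyContinuous _ _

include hf in
lemma ArePositiveDensities.ae_jointLaw_mem [SFinite PX] :
    ∀ᵐ p ∂(jointLaw PX 𝒯 𝒴 fT fY), p.2.1 ∈ 𝒯 ∧ p.2.2 ∈ 𝒴 := by
  refine (jointLaw_absolutelyContinuous PX).ae_le ?_
  have h2 : Measure.QuasiMeasurePreserving (Prod.snd : 𝒳 × ℝ × ℝ → ℝ × ℝ)
      (PX.prod ((volume.restrict 𝒯).prod (volume.restrict 𝒴)))
      ((volume.restrict 𝒯).prod (volume.restrict 𝒴)) := Measure.quasiMeasurePreserving_snd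
  have h𝒯 := h2.ae (Measure.quasiMeasurePreserving_fst.ae
    (ae_restrict_mem hf.measurableSet_treatment))
  have h𝒴 := h2.ae (Measure.quasiMeasurePreserving_snd.ae
    (ae_restrict_mem hf.measurableSet_outcome))
  filter_upwards [h𝒯, h𝒴] with p h1 h2 using ⟨h1, h2⟩

lemma quasiMeasurePreserving_sub_div (τ : ℝ) {h : ℝ} (hh : 0 < h) :
    Measure.QuasiMeasurePreserving (fun t : ℝ => (t - τ) / h) volume volume := by
  have h1 : Measure.QuasiMeasurePreserving (fun t : ℝ => h⁻¹ * t) volume volume := by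
    refine ⟨measurable_const_mul _, ?_⟩
    rw [Real.map_volume_mul_left (inv_ne_zero hh.ne')]
    exact Measure.smul_absolutelyContinuous
  have h2 := h1.comp (measurePreserving_sub_right volume τ).quasiMeasurePreserving
  have he : (fun t : ℝ => (t - τ) / h) = (fun t => h⁻¹ * t) ∘ fun t => t - τ :=
    funext fun t => div_eq_inv_mul _ _
  rwa [he]

/-- Modifying the kernel on a null set does not change the residuals. -/
lemma kernelResidual_ae_eq [SFinite PX] {K K' : ℝ → ℝ} (hK : K =ᵐ[volume] K') {τ h : ℝ}
    (hh : 0 < h) :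
    kernelResidual 𝒴 fT fY K τ h =ᵐ[jointLaw PX 𝒯 𝒴 fT fY] kernelResidual 𝒴 fT fY K' τ h := by
  refine (jointLaw_absolutelyContinuous PX).ae_le ?_
  have h2 : Measure.QuasiMeasurePreserving (Prod.snd : 𝒳 × ℝ × ℝ → ℝ × ℝ)
      (PX.prod ((volume.restrict 𝒯).prod (volume.restrict 𝒴)))
      ((volume.restrict 𝒯).prod (volume.restrict 𝒴)) := Measure.quasiMeasurePreserving_snd
  have h4 := ae_restrict_of_ae (s := 𝒯) ((quasiMeasurePreserving_sub_div τ hh).ae hK)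
  have h5 := h2.ae (Measure.quasiMeasurePreserving_fst.ae h4)
  filter_upwards [h5] with p hp
  simp only [kernelResidual, scaledKernel]
  rw [hp]

include hf hmf in
-- Tonelli's theorem; `ENNReal.ofReal` splits over the product of densities because `fT` is
-- nonnegative on `𝒯`.
lemma ArePositiveDensities.lintegral_jointLaw [SFinite PX] {F : 𝒳 × ℝ × ℝ → ENNReal} (hF : Measurable F) :
    ∫⁻ p, F p ∂(jointLaw PX 𝒯 𝒴 fT fY) =
      ∫⁻ x, (∫⁻ t in 𝒯, ENNReal.ofReal (fT x t) * ∫⁻ y, F (x, t, y) ∂(condLaw 𝒴 fY x t)) ∂PX := by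
  have hG := hf.measurable_density.mul hF
  rw [jointLaw, lintegral_withDensity_eq_lintegral_mul _ hf.measurable_density hF,
    lintegral_prod _ hG.aemeasurable]
  refine lintegral_congr fun x => ?_
  have hGx : Measurable fun z : ℝ × ℝ => ((fun p : 𝒳 × ℝ × ℝ =>
      ENNReal.ofReal (fT p.1 p.2.1 * fY p.1 p.2.1 p.2.2)) * F) (x, z) :=
    hG.comp measurable_prodMk_left
  rw [lintegral_prod _ hGx.aemeasurable]
  refine setLIntegral_congr_fun hf.measurableSet_treatment fun t ht => ?_
  have hfT : 0 ≤ fT x t := hmf.le.trans (hf.le_treatment x t ht)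
  have hFy : Measurable fun y => F (x, t, y) :=
    hF.comp (measurable_const.prodMk (measurable_const.prodMk measurable_id))
  have hfy := (hf.measurable_section x t).ennreal_ofReal
  simp only [condLaw]
  rw [lintegral_withDensity_eq_lintegral_mul _ hfy hFy, ← lintegral_const_mul _ (hfy.mul hFy)]
  refine lintegral_congr fun y => ?_
  simp only [Pi.mul_apply, ENNReal.ofReal_mul hfT, mul_assoc]

variable [IsProbabilityMeasure PX]

include hf hmf in
/-- A set whose conditional probability given `(X, T)` is constant. -/
lemma ArePositiveDensities.jointLaw_apply_eq {E : Set (𝒳 × ℝ × ℝ)} (hE : MeasurableSet E)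
    {c : ENNReal} (hc : ∀ x, ∀ t ∈ 𝒯, condLaw 𝒴 fY x t {y | (x, t, y) ∈ E} = c) :
    jointLaw PX 𝒯 𝒴 fT fY E = c := by
  rw [← lintegral_indicator_one hE,
    hf.lintegral_jointLaw hmf PX (measurable_one.indicator hE)]
  have hx : ∀ x, ∫⁻ t in 𝒯, ENNReal.ofReal (fT x t) *
      ∫⁻ y, E.indicator 1 (x, t, y) ∂(condLaw 𝒴 fY x t) = c := by
    intro x
    have hmeas : Measurable fun t => ENNReal.ofReal (fT x t) :=
      (hf.measurable_treatment.comp (measurable_const.prodMk measurable_id)).ennreal_ofReal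
    rw [setLIntegral_congr_fun (g := fun t => ENNReal.ofReal (fT x t) * c)
      hf.measurableSet_treatment fun t ht => ?_]
    · rw [lintegral_mul_const _ hmeas, hf.treatment_mass, one_mul]
    · have hsec : MeasurableSet {y | (x, t, y) ∈ E} :=
        (measurable_const.prodMk (measurable_const.prodMk measurable_id) :
          Measurable fun y : ℝ => (x, t, y)) hE
      simp only
      rw [← hc x t ht, ← lintegral_indicator_one hsec]
      rfl
  simp [hx]

include hf hmf in
lemma ArePositiveDensities.isProbabilityMeasure_jointLaw :
    IsProbabilityMeasure (jointLaw PX 𝒯 𝒴 fT fY) := by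
  refine ⟨hf.jointLaw_apply_eq hmf PX MeasurableSet.univ fun x t ht => ?_⟩
  have := hf.isProbabilityMeasure x ht
  simp

include hf hmf in
lemma ArePositiveDensities.map_fst_jointLaw : (jointLaw PX 𝒯 𝒴 fT fY).map Prod.fst = PX := by
  ext A hA
  rw [Measure.map_apply measurable_fst hA, ← lintegral_indicator_one (measurable_fst hA),
    hf.lintegral_jointLaw hmf PX (measurable_one.indicator (measurable_fst hA)),
    ← lintegral_indicator_one hA]
  refine lintegral_congr fun x => ?_
  by_cases hx : x ∈ A
  · rw [indicator_of_mem hx, Pi.one_apply, ← hf.treatment_mass x]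
    refine setLIntegral_congr_fun hf.measurableSet_treatment fun t ht => ?_
    have := hf.isProbabilityMeasure x ht
    have h : ∀ y : ℝ, ((Prod.fst ⁻¹' A : Set (𝒳 × ℝ × ℝ)).indicator 1 (x, t, y) : ENNReal) = 1 :=
      fun y => indicator_of_mem (show (x, t, y) ∈ Prod.fst ⁻¹' A from hx) _
    simp [h]
  · simp [hx]

include hf hmf in
lemma ArePositiveDensities.integral_jointLaw {G : 𝒳 × ℝ × ℝ → ℝ}
    (hG : Integrable G (jointLaw PX 𝒯 𝒴 fT fY)) :
    Integrable (fun x => ∫ t in 𝒯, fT x t * ∫ y, G (x, t, y) ∂(condLaw 𝒴 fY x t)) PX ∧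
    ∫ p, G p ∂(jointLaw PX 𝒯 𝒴 fT fY) =
      ∫ x, (∫ t in 𝒯, fT x t * ∫ y, G (x, t, y) ∂(condLaw 𝒴 fY x t)) ∂PX := by
  have hlt : ∀ᵐ p ∂(PX.prod ((volume.restrict 𝒯).prod (volume.restrict 𝒴))),
      ENNReal.ofReal (fT p.1 p.2.1 * fY p.1 p.2.1 p.2.2) < ⊤ :=
    Eventually.of_forall fun _ => ENNReal.ofReal_lt_top
  have hI := (integrable_withDensity_iff_integrable_smul' hf.measurable_density hlt).1 hG
  have hae : (fun x => ∫ z, (ENNReal.ofReal (fT x z.1 * fY x z.1 z.2)).toReal • G (x, z)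
      ∂((volume.restrict 𝒯).prod (volume.restrict 𝒴))) =ᵐ[PX]
      fun x => ∫ t in 𝒯, fT x t * ∫ y, G (x, t, y) ∂(condLaw 𝒴 fY x t) := by
    filter_upwards [hI.prod_right_ae] with x hx
    rw [integral_prod _ hx]
    refine setIntegral_congr_fun hf.measurableSet_treatment fun t ht => ?_
    have hfT : 0 ≤ fT x t := hmf.le.trans (hf.le_treatment x t ht)
    simp only
    rw [hf.integral_condLaw_of_mem x ht, ← integral_const_mul]
    refine setIntegral_congr_fun hf.measurableSet_outcome fun y hy => ?_
    have hfY := (hf.outcome_pos x t ht y hy).le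
    simp only [smul_eq_mul]
    rw [ENNReal.toReal_ofReal (mul_nonneg hfT hfY), mul_assoc]
  refine ⟨(hI.integral_prod_left).congr hae, ?_⟩
  rw [jointLaw, integral_withDensity_eq_integral_toReal_smul hf.measurable_density hlt,
    integral_prod _ hI]
  exact integral_congr_ae hae

end Fubini

end JointLaw

/-! ### Moments of the kernel residuals -/

/-- The constant in the bias of the average residual over the tail. -/
noncomputable def biasConst (M Mf Mf2 MQ2 Mu2K d : ℝ) : ℝ :=
  (((2 * M * (2 * Mf2) + 2 * (4 * M / d + 2 * MQ2 * d) * (4 * Mf / d + 2 * Mf2 * d)) * (2 * M) +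
    M * (2 * Mf2) * (2 * M)) + 4 * (2 * M) / d ^ 2) * Mu2K

section Residuals

variable {𝒳 : Type*} [MeasurableSpace 𝒳] {𝒯 𝒴 : Set ℝ} {fT : 𝒳 → ℝ → ℝ} {fY : 𝒳 → ℝ → ℝ → ℝ}
  {mf M Γ : ℝ} (hf : ArePositiveDensities 𝒯 𝒴 fT fY mf) (hmf : 0 < mf)
  (hM : ∀ y ∈ 𝒴, |y| ≤ M) (hΓ : 1 ≤ Γ) (PX : Measure 𝒳) [IsProbabilityMeasure PX]
include hf

lemma ArePositiveDensities.tailSet_ae_eq (s : Side) :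
    tailSet s Γ 𝒴 fY =ᵐ[jointLaw PX 𝒯 𝒴 fT fY]
      ({p : 𝒳 × ℝ × ℝ | p.2.1 ∈ 𝒯} ∩ tailSet s Γ 𝒴 fY : Set (𝒳 × ℝ × ℝ)) := by
  filter_upwards [hf.ae_jointLaw_mem PX] with p hp
  exact propext ⟨fun h => ⟨hp.1, h⟩, fun h => h.2⟩

include hM hΓ in
lemma ArePositiveDensities.nullMeasurableSet_tailSet (s : Side) :
    NullMeasurableSet (tailSet s Γ 𝒴 fY) (jointLaw PX 𝒯 𝒴 fT fY) :=
  (hf.measurableSet_tail hM hΓ s).nullMeasurableSet.congr (hf.tailSet_ae_eq PX s).symm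

include hmf hM hΓ in
lemma ArePositiveDensities.real_tailSet (s : Side) :
    (jointLaw PX 𝒯 𝒴 fT fY).real (tailSet s Γ 𝒴 fY) = 1 - gam Γ := by
  have h := hf.jointLaw_apply_eq hmf PX (hf.measurableSet_tail hM hΓ s)
    (c := ENNReal.ofReal (1 - gam Γ)) fun x t ht => by
      have := hf.isProbabilityMeasure x ht
      have hset : {y | (x, t, y) ∈ {p : 𝒳 × ℝ × ℝ | p.2.1 ∈ 𝒯} ∩ tailSet s Γ 𝒴 fY} =
          tailSection s Γ 𝒴 fY x t := by
        ext y
        exact ⟨fun h => h.2, fun h => ⟨ht, h⟩⟩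
      rw [hset, ← hf.real_tailSection hM hΓ s x ht, ofReal_measureReal]
  rw [measureReal_congr (hf.tailSet_ae_eq PX s), Measure.real, h,
    ENNReal.toReal_ofReal (by linarith [gam_lt_one hΓ])]

include hmf hM hΓ in
-- Off ties the sign weight is the extremal weight. At a tie `y = q` it equals `1`, but ties are
-- null because the conditional laws have no atoms.
lemma ArePositiveDensities.signWeight_ae_eq (s : Side) :
    ∀ᵐ p ∂(jointLaw PX 𝒯 𝒴 fT fY),
      signWeight s Γ 𝒴 fY p = Γ⁻¹ + (Γ - Γ⁻¹) * (tailSet s Γ 𝒴 fY).indicator 1 p := by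
  have hE : MeasurableSet ({p : 𝒳 × ℝ × ℝ | p.2.1 ∈ 𝒯} ∩
      {p | p.2.2 = 𝒯.indicator (sideQuantile s Γ 𝒴 fY p.1) p.2.1}) :=
    (measurable_snd.fst hf.measurableSet_treatment).inter
      (measurableSet_eq_fun measurable_snd.snd ((hf.measurable_sideQuantile hM hΓ s).comp
        (measurable_fst.prodMk measurable_snd.fst)))
  have h0 := hf.jointLaw_apply_eq hmf PX hE (c := 0) fun x t ht => by
    refine measure_mono_null (t := {sideQuantile s Γ 𝒴 fY x t}) (fun y hy => ?_)
      (measure_singleton _)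
    have h1 : y = 𝒯.indicator (sideQuantile s Γ 𝒴 fY x) t := hy.2
    rw [indicator_of_mem ht] at h1
    exact h1
  have hne : ∀ᵐ p ∂(jointLaw PX 𝒯 𝒴 fT fY), p ∉ ({p : 𝒳 × ℝ × ℝ | p.2.1 ∈ 𝒯} ∩
      {p | p.2.2 = 𝒯.indicator (sideQuantile s Γ 𝒴 fY p.1) p.2.1} : Set (𝒳 × ℝ × ℝ)) :=
    measure_eq_zero_iff_ae_notMem.1 h0
  filter_upwards [hne, hf.ae_jointLaw_mem PX] with p hp hp𝒯
  have hpne : p.2.2 ≠ sideQuantile s Γ 𝒴 fY p.1 p.2.1 := by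
    intro h
    refine hp ⟨hp𝒯.1, ?_⟩
    change p.2.2 = 𝒯.indicator (sideQuantile s Γ 𝒴 fY p.1) p.2.1
    rw [indicator_of_mem hp𝒯.1]
    exact h
  cases s
  · simp only [signWeight]
    rcases lt_or_gt_of_ne hpne with h | h
    · have hmem : p ∈ tailSet .lower Γ 𝒴 fY := h.le
      rw [indicator_of_mem hmem, Real.sign_of_neg (by linarith)]
      simp
    · have hmem : p ∉ tailSet .lower Γ 𝒴 fY := not_le.2 h
      rw [indicator_of_notMem hmem, Real.sign_of_pos (by linarith)]
      simp [Real.rpow_neg_one]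
  · simp only [signWeight]
    rcases lt_or_gt_of_ne hpne with h | h
    · have hmem : p ∉ tailSet .upper Γ 𝒴 fY := not_lt.2 h.le
      rw [indicator_of_notMem hmem, Real.sign_of_neg (by linarith)]
      simp [Real.rpow_neg_one]
    · have hmem : p ∈ tailSet .upper Γ 𝒴 fY := h
      rw [indicator_of_mem hmem, Real.sign_of_pos (by linarith)]
      simp

include hmf hM in
-- One of the two factors `1 / fT` in the square is absorbed by the density of `T`, the other is at
-- most `1 / mf`; the centered outcome is at most `2 M`, and `∫ K_h² ≤ MK2 / h`. The kernel is first
-- replaced by a measurable version.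
lemma ArePositiveDensities.memLp_kernelResidual {K : ℝ → ℝ} {MK2 Mu2K τ h : ℝ}
    (hK : IsKernel K MK2 Mu2K) (hh : 0 < h) :
    MemLp (kernelResidual 𝒴 fT fY K τ h) 2 (jointLaw PX 𝒯 𝒴 fT fY) ∧
      ∫ p, kernelResidual 𝒴 fT fY K τ h p ^ 2 ∂(jointLaw PX 𝒯 𝒴 fT fY) ≤
        4 * M ^ 2 * MK2 / (mf * h) := by
  have hKm := hK.integrable.aestronglyMeasurable
  set K' := hKm.mk K
  have hKK : K =ᵐ[volume] K' := hKm.ae_eq_mk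
  have hK'm : Measurable K' := hKm.stronglyMeasurable_mk.measurable
  have hae := kernelResidual_ae_eq (𝒯 := 𝒯) (𝒴 := 𝒴) (fT := fT) (fY := fY) PX (τ := τ) hKK hh
  have hRm : Measurable (kernelResidual 𝒴 fT fY K' τ h) :=
    hf.measurable_kernelResidual hK'm τ h
  have hMK0 : 0 ≤ MK2 := le_trans (integral_nonneg fun u => sq_nonneg _) hK.integral_sq_le
  have hsK : ∀ᵐ t, scaledKernel K' h (t - τ) = scaledKernel K h (t - τ) := by
    filter_upwards [(quasiMeasurePreserving_sub_div τ hh).ae hKK] with t ht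
    simp only [scaledKernel, ht]
  have hlin : ∫⁻ p, ENNReal.ofReal (kernelResidual 𝒴 fT fY K' τ h p ^ 2)
      ∂(jointLaw PX 𝒯 𝒴 fT fY) ≤ ENNReal.ofReal (4 * M ^ 2 * MK2 / (mf * h)) := by
    rw [hf.lintegral_jointLaw hmf PX (hRm.pow_const 2).ennreal_ofReal]
    have hx : ∀ x, ∫⁻ t in 𝒯, ENNReal.ofReal (fT x t) * ∫⁻ y,
        ENNReal.ofReal (kernelResidual 𝒴 fT fY K' τ h (x, t, y) ^ 2) ∂(condLaw 𝒴 fY x t) ≤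
        ENNReal.ofReal (4 * M ^ 2 * MK2 / (mf * h)) := by
      intro x
      calc ∫⁻ t in 𝒯, ENNReal.ofReal (fT x t) * ∫⁻ y,
            ENNReal.ofReal (kernelResidual 𝒴 fT fY K' τ h (x, t, y) ^ 2) ∂(condLaw 𝒴 fY x t)
          ≤ ∫⁻ t in 𝒯, ENNReal.ofReal (4 * M ^ 2 / mf) *
              ENNReal.ofReal (scaledKernel K' h (t - τ) ^ 2) := by
            refine setLIntegral_mono' hf.measurableSet_treatment fun t ht => ?_
            have := hf.isProbabilityMeasure x ht
            have hfT : 0 < fT x t := hmf.trans_le (hf.le_treatment x t ht)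
            have h1 : ∫⁻ y, ENNReal.ofReal (kernelResidual 𝒴 fT fY K' τ h (x, t, y) ^ 2)
                ∂(condLaw 𝒴 fY x t) ≤
                ENNReal.ofReal ((scaledKernel K' h (t - τ) / fT x t) ^ 2 * (2 * M) ^ 2) := by
              calc _ ≤ ∫⁻ _, ENNReal.ofReal ((scaledKernel K' h (t - τ) / fT x t) ^ 2 *
                    (2 * M) ^ 2) ∂(condLaw 𝒴 fY x t) := by
                    refine lintegral_mono_ae ?_
                    filter_upwards [hf.ae_abs_sub_condMean_le hM x ht] with y hy
                    refine ENNReal.ofReal_le_ofReal ?_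
                    simp only [kernelResidual]
                    rw [mul_pow, ← sq_abs (y - _)]
                    gcongr
                _ = _ := by simp
            calc _ ≤ ENNReal.ofReal (fT x t) * ENNReal.ofReal
                  ((scaledKernel K' h (t - τ) / fT x t) ^ 2 * (2 * M) ^ 2) := by gcongr
              _ = ENNReal.ofReal (4 * M ^ 2 / fT x t * scaledKernel K' h (t - τ) ^ 2) := by
                  rw [← ENNReal.ofReal_mul hfT.le]
                  congr 1
                  field_simp
                  ring
              _ ≤ ENNReal.ofReal (4 * M ^ 2 / mf * scaledKernel K' h (t - τ) ^ 2) := by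
                  refine ENNReal.ofReal_le_ofReal ?_
                  gcongr
                  exact hf.le_treatment x t ht
              _ = _ := ENNReal.ofReal_mul (by positivity)
        _ ≤ ∫⁻ t, ENNReal.ofReal (4 * M ^ 2 / mf) *
              ENNReal.ofReal (scaledKernel K' h (t - τ) ^ 2) := setLIntegral_le_lintegral _ _
        _ = ENNReal.ofReal (4 * M ^ 2 / mf) *
              ∫⁻ t, ENNReal.ofReal (scaledKernel K h (t - τ) ^ 2) := by
            rw [lintegral_const_mul' _ _ ENNReal.ofReal_ne_top]
            congr 1
            refine lintegral_congr_ae ?_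
            filter_upwards [hsK] with t ht
            rw [ht]
        _ ≤ ENNReal.ofReal (4 * M ^ 2 / mf) * ENNReal.ofReal (MK2 / h) := by
            gcongr
            exact hK.lintegral_scaledKernel_sq_le hh
        _ = _ := by
            rw [← ENNReal.ofReal_mul (by positivity)]
            congr 1
            field_simp
    calc _ ≤ ∫⁻ _, ENNReal.ofReal (4 * M ^ 2 * MK2 / (mf * h)) ∂PX := lintegral_mono hx
      _ = _ := by simp
  have hsq : Integrable (fun p => kernelResidual 𝒴 fT fY K' τ h p ^ 2)
      (jointLaw PX 𝒯 𝒴 fT fY) :=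
    (lintegral_ofReal_ne_top_iff_integrable (hRm.pow_const 2).aestronglyMeasurable
      (Eventually.of_forall fun p => sq_nonneg _)).1 (ne_top_of_le_ne_top ENNReal.ofReal_ne_top hlin)
  have hL : MemLp (kernelResidual 𝒴 fT fY K' τ h) 2 (jointLaw PX 𝒯 𝒴 fT fY) :=
    (memLp_two_iff_integrable_sq hRm.aestronglyMeasurable).2 hsq
  refine ⟨hL.ae_eq hae.symm, ?_⟩
  have he : ∫ p, kernelResidual 𝒴 fT fY K τ h p ^ 2 ∂(jointLaw PX 𝒯 𝒴 fT fY) =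
      ∫ p, kernelResidual 𝒴 fT fY K' τ h p ^ 2 ∂(jointLaw PX 𝒯 𝒴 fT fY) := by
    refine integral_congr_ae ?_
    filter_upwards [hae] with p hp
    rw [hp]
  rw [he, integral_eq_lintegral_of_nonneg_ae (Eventually.of_forall fun p => sq_nonneg _)
    (hRm.pow_const 2).aestronglyMeasurable]
  exact ENNReal.toReal_le_of_le_ofReal (by positivity) hlin

include hmf hM in
/-- The mean of the residuals over a measurable set of observations. -/
lemma ArePositiveDensities.setIntegral_kernelResidual {K : ℝ → ℝ} {MK2 Mu2K τ h : ℝ}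
    (hK : IsKernel K MK2 Mu2K) (hh : 0 < h) {E : Set (𝒳 × ℝ × ℝ)} (hE : MeasurableSet E)
    {g : 𝒳 → ℝ → ℝ} (hg : ∀ x, ∀ t ∈ 𝒯,
      ∫ y in {y | (x, t, y) ∈ E}, (y - condMean 𝒴 fY t x) ∂(condLaw 𝒴 fY x t) = g x t) :
    Integrable (fun x => ∫ t, scaledKernel K h (t - τ) * 𝒯.indicator (g x) t) PX ∧
    ∫ p in E, kernelResidual 𝒴 fT fY K τ h p ∂(jointLaw PX 𝒯 𝒴 fT fY) =
      ∫ x, (∫ t, scaledKernel K h (t - τ) * 𝒯.indicator (g x) t) ∂PX := by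
  have := hf.isProbabilityMeasure_jointLaw hmf PX
  have hR := ((hf.memLp_kernelResidual hmf hM PX (τ := τ) hK hh).1.integrable
    (by norm_num)).indicator hE
  have hFub := hf.integral_jointLaw hmf PX hR
  have hx : ∀ x, ∫ t in 𝒯, fT x t * ∫ y, E.indicator (kernelResidual 𝒴 fT fY K τ h) (x, t, y)
      ∂(condLaw 𝒴 fY x t) = ∫ t, scaledKernel K h (t - τ) * 𝒯.indicator (g x) t := by
    intro x
    rw [← integral_indicator hf.measurableSet_treatment]
    congr 1
    ext t
    by_cases ht : t ∈ 𝒯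
    · have hfT : fT x t ≠ 0 := (hmf.trans_le (hf.le_treatment x t ht)).ne'
      have hsec : MeasurableSet {y | (x, t, y) ∈ E} :=
        (measurable_const.prodMk (measurable_const.prodMk measurable_id) :
          Measurable fun y : ℝ => (x, t, y)) hE
      have hy : ∀ y, E.indicator (kernelResidual 𝒴 fT fY K τ h) (x, t, y) =
          scaledKernel K h (t - τ) / fT x t *
            {y | (x, t, y) ∈ E}.indicator (fun y => y - condMean 𝒴 fY t x) y := by
        intro y
        by_cases hmem : (x, t, y) ∈ E
        · have hmem' : y ∈ {y | (x, t, y) ∈ E} := hmem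
          rw [indicator_of_mem hmem, indicator_of_mem hmem']
          rfl
        · have hmem' : y ∉ {y | (x, t, y) ∈ E} := hmem
          rw [indicator_of_notMem hmem, indicator_of_notMem hmem', mul_zero]
      rw [indicator_of_mem ht, indicator_of_mem ht]
      simp_rw [hy]
      rw [integral_const_mul, integral_indicator hsec, hg x t ht]
      -- The inverse weight `1 / fT` cancels the density of `T`.
      field_simp
    · rw [indicator_of_notMem ht, indicator_of_notMem ht, mul_zero]
  simp_rw [hx] at hFub
  rw [integral_indicator hE] at hFub
  exact hFub

include hmf hM in
-- Residuals are centered given `X` and `T`, so the constant part of the sign weight does not affect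
-- the mean.
lemma ArePositiveDensities.integral_kernelResidual {K : ℝ → ℝ} {MK2 Mu2K τ h : ℝ}
    (hK : IsKernel K MK2 Mu2K) (hh : 0 < h) :
    ∫ p, kernelResidual 𝒴 fT fY K τ h p ∂(jointLaw PX 𝒯 𝒴 fT fY) = 0 := by
  have h := (hf.setIntegral_kernelResidual hmf hM PX (τ := τ) hK hh MeasurableSet.univ
    (g := fun _ _ => 0) fun x t ht => by
      have := hf.integral_sub_condMean hM x ht
      simpa using this).2
  rw [setIntegral_univ] at h
  rw [h]
  simp

include hM hΓ in
lemma ArePositiveDensities.integrable_tailMean (s : Side) {τ : ℝ} (hτ : τ ∈ 𝒯) :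
    Integrable (fun x => tailMean s Γ 𝒴 fY x τ) PX := by
  have he : (fun x => tailMean s Γ 𝒴 fY x τ) =
      fun x => 𝒯.indicator (tailMean s Γ 𝒴 fY x) τ :=
    funext fun x => (indicator_of_mem hτ _).symm
  have hAτ : Measurable fun x => tailMean s Γ 𝒴 fY x τ := by
    rw [he]
    exact (hf.measurable_tailMean hM hΓ s).comp
      (measurable_id.prodMk measurable_const : Measurable fun x : 𝒳 => (x, τ))
  exact Integrable.of_bound hAτ.aestronglyMeasurable (2 * M)
    (Eventually.of_forall fun x => hf.abs_tailMean_le hM s x hτ)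

include hmf hM hΓ in
/-- The bias of the average residual over the tail. -/
lemma ArePositiveDensities.abs_bias_le {K : ℝ → ℝ} {MK2 Mu2K Mf Mf2 MQ2 τ d h : ℝ}
    (hd : 0 < d) (h𝒯 : Ioo (τ - d) (τ + d) ⊆ 𝒯) (hK : IsKernel K MK2 Mu2K) (hh : 0 < h)
    (hrf : IsRegularDensity 𝒯 𝒴 fY τ Mf Mf2) (hrq : IsRegularQuantile 𝒯 𝒴 fY MQ2) (s : Side) :
    |(∫ p in tailSet s Γ 𝒴 fY, kernelResidual 𝒴 fT fY K τ h p ∂(jointLaw PX 𝒯 𝒴 fT fY)) -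
        ∫ x, tailMean s Γ 𝒴 fY x τ ∂PX| ≤
      biasConst M Mf Mf2 MQ2 Mu2K d * h ^ 2 := by
  have hτ : τ ∈ 𝒯 := h𝒯 ⟨by linarith, by linarith⟩
  have hA := hf.measurable_tailMean hM hΓ s
  have hmean := hf.setIntegral_kernelResidual hmf hM PX (τ := τ) hK hh
    (hf.measurableSet_tail hM hΓ s) (g := tailMean s Γ 𝒴 fY) fun x t ht => by
      have hset : {y | (x, t, y) ∈ {p : 𝒳 × ℝ × ℝ | p.2.1 ∈ 𝒯} ∩ tailSet s Γ 𝒴 fY} =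
          tailSection s Γ 𝒴 fY x t := by
        ext y
        exact ⟨fun h => h.2, fun h => ⟨ht, h⟩⟩
      rw [hset]
      rfl
  have hAI := hf.integrable_tailMean hM hΓ PX s hτ
  rw [setIntegral_congr_set (hf.tailSet_ae_eq PX s), hmean.2, ← integral_sub hmean.1 hAI]
  have hbound := norm_integral_le_of_norm_le_const (μ := PX)
    (f := fun x => (∫ t, scaledKernel K h (t - τ) * 𝒯.indicator (tailMean s Γ 𝒴 fY x) t) -
      tailMean s Γ 𝒴 fY x τ)
    (C := biasConst M Mf Mf2 MQ2 Mu2K d * h ^ 2)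
    (Eventually.of_forall fun x => by
      have hM0 := hf.bound_nonneg hM x hτ
      -- The extension of the tail mean by zero outside `𝒯` is harmless: smoothness is used only
      -- within distance `d` of `τ`, and boundedness elsewhere. The estimate is uniform in `x`.
      have hb := hK.abs_integral_sub_le (τ := τ) (B := 2 * M) hh hd
        (g := 𝒯.indicator (tailMean s Γ 𝒴 fY x))
        (hA.comp (measurable_const.prodMk measurable_id : Measurable fun t : ℝ =>
          (x, t))).aestronglyMeasurable
        (fun t => by
          by_cases ht : t ∈ 𝒯
          · rw [indicator_of_mem ht]
            exact hf.abs_tailMean_le hM s x ht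
          · rw [indicator_of_notMem ht, abs_zero]
            positivity)
        (fun r hr => by
          have hr' := abs_lt.1 hr
          rw [indicator_of_mem hτ, indicator_of_mem (h𝒯 ⟨by linarith, by linarith⟩),
            indicator_of_mem (h𝒯 ⟨by linarith, by linarith⟩)]
          exact hf.abs_second_difference_tailMean_le hM hΓ hd h𝒯 hrf hrq s x r hr)
      rw [indicator_of_mem hτ] at hb
      exact hb)
  simpa using hbound

end Residuals

/-! ### The mean squared error of the estimators -/

lemma add_sq_le_two (a b : ℝ) : (a + b) ^ 2 ≤ 2 * a ^ 2 + 2 * b ^ 2 := by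
  nlinarith [sq_nonneg (a - b)]

lemma add_add_sq_le_three (a b c : ℝ) : (a + b + c) ^ 2 ≤ 3 * a ^ 2 + 3 * b ^ 2 + 3 * c ^ 2 := by
  nlinarith [sq_nonneg (a - b), sq_nonneg (a - c), sq_nonneg (b - c)]

/-- Moments of `η + R W` for a weight `W` equal to `Γ` on `E` and to `Γ⁻¹` outside. -/
lemma two_valued_weight_moments {S : Type*} [MeasurableSpace S] {P : Measure S}
    [IsProbabilityMeasure P] {Γ : ℝ} (hΓ : 1 ≤ Γ) {E : Set S} (hE : MeasurableSet E) {η R : S → ℝ}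
    (hη : MemLp η 2 P) (hR : MemLp R 2 P) :
    MemLp (fun p => η p + (Γ⁻¹ * R p + (Γ - Γ⁻¹) * E.indicator R p)) 2 P ∧
    ∫ p, (η p + (Γ⁻¹ * R p + (Γ - Γ⁻¹) * E.indicator R p)) ∂P =
      (∫ p, η p ∂P) + Γ⁻¹ * (∫ p, R p ∂P) + (Γ - Γ⁻¹) * ∫ p in E, R p ∂P ∧
    ∫ p, (η p + (Γ⁻¹ * R p + (Γ - Γ⁻¹) * E.indicator R p)) ^ 2 ∂P ≤
      2 * (∫ p, η p ^ 2 ∂P) + 2 * Γ ^ 2 * ∫ p, R p ^ 2 ∂P := by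
  have hRI := hR.integrable (by norm_num : (1 : ENNReal) ≤ 2)
  have hRE : MemLp (fun p => Γ⁻¹ * R p + (Γ - Γ⁻¹) * E.indicator R p) 2 P :=
    (hR.const_mul _).add ((hR.indicator hE).const_mul _)
  have hZ : MemLp (fun p => η p + (Γ⁻¹ * R p + (Γ - Γ⁻¹) * E.indicator R p)) 2 P := hη.add hRE
  refine ⟨hZ, ?_, ?_⟩
  · rw [integral_add (hη.integrable (by norm_num)) (hRE.integrable (by norm_num)),
      integral_add (hRI.const_mul _) ((hRI.indicator hE).const_mul _), integral_const_mul,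
      integral_const_mul, integral_indicator hE, add_assoc]
  · have hinv0 : 0 < Γ⁻¹ := inv_pos.2 (by linarith)
    have hinv1 : Γ⁻¹ ≤ 1 := inv_le_one_of_one_le₀ hΓ
    have hpt : ∀ p, (η p + (Γ⁻¹ * R p + (Γ - Γ⁻¹) * E.indicator R p)) ^ 2 ≤
        2 * η p ^ 2 + 2 * Γ ^ 2 * R p ^ 2 := by
      intro p
      refine (add_sq_le_two _ _).trans ?_
      have : (Γ⁻¹ * R p + (Γ - Γ⁻¹) * E.indicator R p) ^ 2 ≤ Γ ^ 2 * R p ^ 2 := by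
        by_cases hp : p ∈ E
        · rw [indicator_of_mem hp]
          apply le_of_eq
          ring
        · rw [indicator_of_notMem hp, mul_zero, add_zero, mul_pow]
          gcongr
          linarith
      linarith
    have h1 := hη.integrable_sq.const_mul 2
    have h2 := hR.integrable_sq.const_mul (2 * Γ ^ 2)
    calc _ ≤ ∫ p, (2 * η p ^ 2 + 2 * Γ ^ 2 * R p ^ 2) ∂P :=
          integral_mono hZ.integrable_sq (h1.add h2) hpt
      _ = _ := by rw [integral_add h1 h2, integral_const_mul, integral_const_mul]

section Estimators

variable {Ω 𝒳 : Type*} [MeasurableSpace Ω] [MeasurableSpace 𝒳] {μ : Measure Ω}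
  [IsProbabilityMeasure μ] {PX : Measure 𝒳} [IsProbabilityMeasure PX] {𝒯 𝒴 : Set ℝ}
  {fT : 𝒳 → ℝ → ℝ} {fY : 𝒳 → ℝ → ℝ → ℝ} {K : ℝ → ℝ} {τ Γ mf M MK2 Mu2K Mf Mf2 MQ2 d : ℝ}
  {D : ℕ → Ω → 𝒳 × ℝ × ℝ}

omit [MeasurableSpace 𝒳] in
/-- The tail form as a ratio of sums over all observations. -/
lemma estimator_tail_eq (s : Side) (n : ℕ) (h : ℝ) (z : ℕ → 𝒳 × ℝ × ℝ) :
    estimator .tail s Γ 𝒴 fT fY K τ n h z = (2 * gam Γ - 1) / gam Γ *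
      ((∑ i ∈ Finset.range n,
        (tailSet s Γ 𝒴 fY).indicator (kernelResidual 𝒴 fT fY K τ h) (z i)) /
        ∑ i ∈ Finset.range n, (tailSet s Γ 𝒴 fY).indicator 1 (z i)) +
      etaTilde 𝒴 fY τ n z := by
  classical
  have h1 : (∑ i ∈ Finset.range n, (tailSet s Γ 𝒴 fY).indicator 1 (z i) : ℝ) =
      ((Finset.range n).filter fun i => z i ∈ tailSet s Γ 𝒴 fY).card := by
    simp [indicator_apply, Finset.sum_boole]
  have h2 : ∑ i ∈ Finset.range n,
      (tailSet s Γ 𝒴 fY).indicator (kernelResidual 𝒴 fT fY K τ h) (z i) =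
      ∑ i ∈ (Finset.range n).filter fun i => z i ∈ tailSet s Γ 𝒴 fY,
        kernelResidual 𝒴 fT fY K τ h (z i) := by
    simp only [indicator_apply, Finset.sum_filter]
  rw [h1, h2]
  simp only [estimator]
  congr 1
  rw [← div_div, mul_div_assoc', div_mul_eq_mul_div]

variable (hf : ArePositiveDensities 𝒯 𝒴 fT fY mf) (hM : ∀ y ∈ 𝒴, |y| ≤ M) (hΓ : 1 ≤ Γ)
  (hmf : 0 < mf)
include hf hM

omit hM in
lemma ArePositiveDensities.measurable_condMean_section (τ : ℝ) :
    Measurable fun x => condMean 𝒴 fY τ x := by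
  have h : Measurable fun x : 𝒳 => (x, τ) := measurable_id.prodMk measurable_const
  have h2 := hf.measurable_condMean.comp h
  exact h2

include hΓ in
lemma ArePositiveDensities.apoBound_eq (s : Side) (hτ : τ ∈ 𝒯) :
    apoBound s Γ PX 𝒯 𝒴 fY τ =
      (∫ x, condMean 𝒴 fY τ x ∂PX) + (Γ - Γ⁻¹) * ∫ x, tailMean s Γ 𝒴 fY x τ ∂PX := by
  have h1 : Integrable (fun x => condMean 𝒴 fY τ x) PX :=
    Integrable.of_bound (hf.measurable_condMean_section τ).aestronglyMeasurable M
      (Eventually.of_forall fun x => hf.abs_condMean_le hM x hτ)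
  unfold apoBound
  simp_rw [fun x => hf.capoBound_eq hM hΓ s x hτ]
  rw [integral_add h1 ((hf.integrable_tailMean hM hΓ PX s hτ).const_mul _), integral_const_mul]

include hmf in
/-- Conditional means at `τ`, as functions of an observation. -/
lemma ArePositiveDensities.condMean_fst (hτ : τ ∈ 𝒯) :
    MemLp (fun p : 𝒳 × ℝ × ℝ => condMean 𝒴 fY τ p.1) 2 (jointLaw PX 𝒯 𝒴 fT fY) ∧
      ∫ p, condMean 𝒴 fY τ p.1 ∂(jointLaw PX 𝒯 𝒴 fT fY) = ∫ x, condMean 𝒴 fY τ x ∂PX ∧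
      ∫ p, condMean 𝒴 fY τ p.1 ^ 2 ∂(jointLaw PX 𝒯 𝒴 fT fY) ≤ M ^ 2 := by
  have := hf.isProbabilityMeasure_jointLaw hmf PX
  have hm := hf.measurable_condMean_section τ
  have hm' : Measurable fun p : 𝒳 × ℝ × ℝ => condMean 𝒴 fY τ p.1 := hm.comp measurable_fst
  have hL : MemLp (fun p : 𝒳 × ℝ × ℝ => condMean 𝒴 fY τ p.1) 2 (jointLaw PX 𝒯 𝒴 fT fY) :=
    MemLp.of_bound hm'.aestronglyMeasurable M
      (Eventually.of_forall fun p => hf.abs_condMean_le hM p.1 hτ)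
  refine ⟨hL, ?_, ?_⟩
  · have h := integral_map (μ := jointLaw PX 𝒯 𝒴 fT fY) (φ := Prod.fst)
      measurable_fst.aemeasurable (f := fun x => condMean 𝒴 fY τ x) hm.aestronglyMeasurable
    rw [hf.map_fst_jointLaw hmf PX] at h
    exact h.symm
  · calc _ ≤ ∫ _, M ^ 2 ∂(jointLaw PX 𝒯 𝒴 fT fY) := by
          refine integral_mono hL.integrable_sq (integrable_const _) fun p => ?_
          simp only
          rw [← sq_abs]
          gcongr
          exact hf.abs_condMean_le hM p.1 hτ
      _ = M ^ 2 := by simp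

include hΓ hmf in
lemma ArePositiveDensities.mse_tail_le (hd : 0 < d) (h𝒯 : Ioo (τ - d) (τ + d) ⊆ 𝒯)
    (hK : IsKernel K MK2 Mu2K) (hrf : IsRegularDensity 𝒯 𝒴 fY τ Mf Mf2)
    (hrq : IsRegularQuantile 𝒯 𝒴 fY MQ2) (hD : IsIIDSample μ D (jointLaw PX 𝒯 𝒴 fT fY))
    (s : Side) {n : ℕ} (hn : 1 ≤ n) {h : ℝ} (hh : 0 < h) :
    MemLp (fun ω => estimator .tail s Γ 𝒴 fT fY K τ n h fun i => D i ω) 2 μ ∧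
    mse μ (fun ω => estimator .tail s Γ 𝒴 fT fY K τ n h fun i => D i ω)
      (apoBound s Γ PX 𝒯 𝒴 fY τ) ≤
      mseBound (21 * (Γ - Γ⁻¹) ^ 2 * (4 * M ^ 2 * MK2 / mf)) (3 * M ^ 2)
        (3 * (Γ - Γ⁻¹) ^ 2 * biasConst M Mf Mf2 MQ2 Mu2K d ^ 2) n h := by
  have hτ : τ ∈ 𝒯 := h𝒯 ⟨by linarith, by linarith⟩
  have hn' : (0 : ℝ) < n := by exact_mod_cast hn
  have hg : 0 < 1 - gam Γ := by linarith [gam_lt_one hΓ]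
  have hP := hf.isProbabilityMeasure_jointLaw hmf PX
  have hR := hf.memLp_kernelResidual hmf hM PX (τ := τ) hK hh
  have hpB := hf.real_tailSet hmf hM hΓ PX s
  obtain ⟨hAL, hA⟩ := integral_ratio_sub_sq_le hD.measurable hD.indep hD.law
    (hf.nullMeasurableSet_tailSet hM hΓ PX s) (by rw [hpB]; exact hg) hR.1 hn
  rw [hpB] at hA
  obtain ⟨heL, he1, he2⟩ := hf.condMean_fst (PX := PX) hM hmf hτ
  have hB := integral_mean_sub_sq_le hD.measurable hD.indep hD.law heL hn
  have hBL : MemLp (fun ω => (∑ i ∈ Finset.range n, condMean 𝒴 fY τ (D i ω).1) / n) 2 μ := by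
    have h1 : MemLp (fun ω => ∑ i ∈ Finset.range n, condMean 𝒴 fY τ (D i ω).1) 2 μ :=
      memLp_finsetSum _ fun i _ => memLp_comp_sample hD.measurable hD.law heL i
    simpa only [div_eq_mul_inv] using h1.mul_const (n : ℝ)⁻¹
  rw [he1] at hB
  have hbias := hf.abs_bias_le hmf hM hΓ PX hd h𝒯 hK hh hrf hrq s
  set m := ∫ p in tailSet s Γ 𝒴 fY, kernelResidual 𝒴 fT fY K τ h p ∂(jointLaw PX 𝒯 𝒴 fT fY)
  set a := ∫ x, tailMean s Γ 𝒴 fY x τ ∂PX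
  set e := ∫ x, condMean 𝒴 fY τ x ∂PX
  set κ := (2 * gam Γ - 1) / gam Γ with hκ
  have hκp : κ / (1 - gam Γ) = Γ - Γ⁻¹ := gam_ratio hΓ
  simp_rw [estimator_tail_eq]
  rw [← hκ]
  set A := fun ω => (∑ i ∈ Finset.range n,
        (tailSet s Γ 𝒴 fY).indicator (kernelResidual 𝒴 fT fY K τ h) (D i ω)) /
        ∑ i ∈ Finset.range n, (tailSet s Γ 𝒴 fY).indicator (1 : 𝒳 × ℝ × ℝ → ℝ) (D i ω) with hAdef
  set B := fun ω => (∑ i ∈ Finset.range n, condMean 𝒴 fY τ (D i ω).1) / (n : ℝ) with hBdef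
  refine ⟨(hAL.const_mul κ).add hBL, ?_⟩
  rw [hf.apoBound_eq hM hΓ s hτ]
  have hA2 := (hAL.sub (memLp_const (m / (1 - gam Γ)))).integrable_sq
  have hB2 := (hBL.sub (memLp_const e)).integrable_sq
  -- Three errors: the tail average around `m / (1 - γ)`, the mean of `η` around `e`, and the bias
  -- `m - a`. The constants of the bound come from the factor `3` of this split, with `21 = 3 * 7`
  -- for the ratio.
  have hpt : ∀ ω, (κ * A ω + etaTilde 𝒴 fY τ n (fun i => D i ω) - (e + (Γ - Γ⁻¹) * a)) ^ 2 ≤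
      3 * κ ^ 2 * (A ω - m / (1 - gam Γ)) ^ 2 + 3 * (B ω - e) ^ 2 +
        3 * ((Γ - Γ⁻¹) * (m - a)) ^ 2 := by
    intro ω
    have h1 : κ * A ω + etaTilde 𝒴 fY τ n (fun i => D i ω) - (e + (Γ - Γ⁻¹) * a) =
        κ * (A ω - m / (1 - gam Γ)) + (B ω - e) + (Γ - Γ⁻¹) * (m - a) := by
      rw [← hκp]
      simp only [hBdef, etaTilde]
      ring
    rw [h1, mul_assoc 3, ← mul_pow κ]
    exact add_add_sq_le_three _ _ _
  have hI1 : Integrable (fun ω => 3 * κ ^ 2 * (A ω - m / (1 - gam Γ)) ^ 2) μ := hA2.const_mul _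
  have hI2 : Integrable (fun ω => 3 * (B ω - e) ^ 2) μ := hB2.const_mul _
  have hI12 : Integrable (fun ω => 3 * κ ^ 2 * (A ω - m / (1 - gam Γ)) ^ 2 +
      3 * (B ω - e) ^ 2) μ := hI1.add hI2
  have hbias2 : (m - a) ^ 2 ≤ (biasConst M Mf Mf2 MQ2 Mu2K d * h ^ 2) ^ 2 := by
    rw [← sq_abs (m - a)]
    gcongr
  calc _ ≤ ∫ ω, (3 * κ ^ 2 * (A ω - m / (1 - gam Γ)) ^ 2 + 3 * (B ω - e) ^ 2 +
        3 * ((Γ - Γ⁻¹) * (m - a)) ^ 2) ∂μ :=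
        integral_mono_of_nonneg (Eventually.of_forall fun ω => sq_nonneg _)
          (hI12.add (integrable_const _)) (Eventually.of_forall hpt)
    _ = 3 * κ ^ 2 * (∫ ω, (A ω - m / (1 - gam Γ)) ^ 2 ∂μ) + 3 * (∫ ω, (B ω - e) ^ 2 ∂μ) +
        3 * ((Γ - Γ⁻¹) * (m - a)) ^ 2 := by
        rw [integral_add hI12 (integrable_const _), integral_add hI1 hI2, integral_const_mul,
          integral_const_mul]
        simp
    _ ≤ 3 * κ ^ 2 * (7 * (4 * M ^ 2 * MK2 / (mf * h)) / ((1 - gam Γ) ^ 2 * n)) +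
        3 * (M ^ 2 / n) +
        3 * ((Γ - Γ⁻¹) ^ 2 * (biasConst M Mf Mf2 MQ2 Mu2K d * h ^ 2) ^ 2) := by
        rw [mul_pow]
        gcongr
        · refine hA.trans ?_
          gcongr
          exact hR.2
        · refine hB.trans ?_
          gcongr
    _ = _ := by
        rw [← hκp]
        unfold mseBound
        field_simp
        ring

include hΓ hmf in
/-- The mean and the second moment of the summands of the sign form. -/
lemma ArePositiveDensities.exists_sign_summand (hτ : τ ∈ 𝒯) (hK : IsKernel K MK2 Mu2K) (s : Side)
    {h : ℝ} (hh : 0 < h) :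
    ∃ Z : 𝒳 × ℝ × ℝ → ℝ, MemLp Z 2 (jointLaw PX 𝒯 𝒴 fT fY) ∧
      (∀ᵐ p ∂(jointLaw PX 𝒯 𝒴 fT fY), condMean 𝒴 fY τ p.1 +
        kernelResidual 𝒴 fT fY K τ h p * signWeight s Γ 𝒴 fY p = Z p) ∧
      ∫ p, Z p ∂(jointLaw PX 𝒯 𝒴 fT fY) = (∫ x, condMean 𝒴 fY τ x ∂PX) + (Γ - Γ⁻¹) *
        ∫ p in tailSet s Γ 𝒴 fY, kernelResidual 𝒴 fT fY K τ h p ∂(jointLaw PX 𝒯 𝒴 fT fY) ∧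
      ∫ p, Z p ^ 2 ∂(jointLaw PX 𝒯 𝒴 fT fY) ≤
        2 * M ^ 2 + 2 * Γ ^ 2 * (4 * M ^ 2 * MK2 / (mf * h)) := by
  have hP := hf.isProbabilityMeasure_jointLaw hmf PX
  obtain ⟨hR, hR2⟩ := hf.memLp_kernelResidual hmf hM PX (τ := τ) hK hh
  have hR0 := hf.integral_kernelResidual hmf hM PX (τ := τ) hK hh
  have hW := hf.signWeight_ae_eq hmf hM hΓ PX s
  have hE := hf.measurableSet_tail hM hΓ s
  have hEae := hf.tailSet_ae_eq (Γ := Γ) PX s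
  obtain ⟨heL, he1, he2⟩ := hf.condMean_fst (PX := PX) hM hmf hτ
  rw [setIntegral_congr_set hEae]
  obtain ⟨h1, h2, h3⟩ := two_valued_weight_moments hΓ hE heL hR
  refine ⟨_, h1, ?_, ?_, ?_⟩
  · filter_upwards [hW, hEae.mem_iff] with p hp hmem
    rw [hp]
    by_cases h : p ∈ tailSet s Γ 𝒴 fY
    · rw [indicator_of_mem h, indicator_of_mem (hmem.1 h), Pi.one_apply]
      ring
    · rw [indicator_of_notMem h, indicator_of_notMem (mt hmem.2 h)]
      ring
  · rw [h2, he1, hR0, mul_zero, add_zero]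
  · refine h3.trans ?_
    gcongr

include hΓ hmf in
lemma ArePositiveDensities.mse_sign_le (hd : 0 < d) (h𝒯 : Ioo (τ - d) (τ + d) ⊆ 𝒯)
    (hK : IsKernel K MK2 Mu2K) (hrf : IsRegularDensity 𝒯 𝒴 fY τ Mf Mf2)
    (hrq : IsRegularQuantile 𝒯 𝒴 fY MQ2) (hD : IsIIDSample μ D (jointLaw PX 𝒯 𝒴 fT fY))
    (s : Side) {n : ℕ} (hn : 1 ≤ n) {h : ℝ} (hh : 0 < h) :
    MemLp (fun ω => estimator .sign s Γ 𝒴 fT fY K τ n h fun i => D i ω) 2 μ ∧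
    mse μ (fun ω => estimator .sign s Γ 𝒴 fT fY K τ n h fun i => D i ω)
      (apoBound s Γ PX 𝒯 𝒴 fY τ) ≤
      mseBound (4 * Γ ^ 2 * (4 * M ^ 2 * MK2 / mf)) (4 * M ^ 2)
        (2 * (Γ - Γ⁻¹) ^ 2 * biasConst M Mf Mf2 MQ2 Mu2K d ^ 2) n h := by
  have hτ : τ ∈ 𝒯 := h𝒯 ⟨by linarith, by linarith⟩
  have hn' : (0 : ℝ) < n := by exact_mod_cast hn
  have hP := hf.isProbabilityMeasure_jointLaw hmf PX
  have hbias := hf.abs_bias_le hmf hM hΓ PX hd h𝒯 hK hh hrf hrq s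
  obtain ⟨Z, hZ, hW, hZmean, hZsq⟩ :=
    hf.exists_sign_summand (PX := PX) hM hΓ hmf hτ hK s hh
  set m := ∫ p in tailSet s Γ 𝒴 fY, kernelResidual 𝒴 fT fY K τ h p ∂(jointLaw PX 𝒯 𝒴 fT fY)
  have hae : (fun ω => estimator .sign s Γ 𝒴 fT fY K τ n h fun i => D i ω) =ᵐ[μ]
      fun ω => (∑ i ∈ Finset.range n, Z (D i ω)) / n := by
    filter_upwards [ae_sample hD.measurable hD.law hW] with ω hω
    simp only [estimator, etaTilde]
    rw [← add_div, ← Finset.sum_add_distrib]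
    congr 1
    exact Finset.sum_congr rfl fun i _ => hω i
  have hmean := integral_mean_sub_sq_le hD.measurable hD.indep hD.law hZ hn
  have hL : MemLp (fun ω => (∑ i ∈ Finset.range n, Z (D i ω)) / n) 2 μ := by
    have h1 : MemLp (fun ω => ∑ i ∈ Finset.range n, Z (D i ω)) 2 μ :=
      memLp_finsetSum _ fun i _ => memLp_comp_sample hD.measurable hD.law hZ i
    simpa only [div_eq_mul_inv] using h1.mul_const (n : ℝ)⁻¹
  refine ⟨hL.ae_eq hae.symm, ?_⟩
  rw [hf.apoBound_eq hM hΓ s hτ]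
  rw [hZmean] at hmean
  set a := ∫ x, tailMean s Γ 𝒴 fY x τ ∂PX
  set e := ∫ x, condMean 𝒴 fY τ x ∂PX
  have hmse : mse μ (fun ω => estimator .sign s Γ 𝒴 fT fY K τ n h fun i => D i ω)
      (e + (Γ - Γ⁻¹) * a) =
      ∫ ω, ((∑ i ∈ Finset.range n, Z (D i ω)) / n - (e + (Γ - Γ⁻¹) * a)) ^ 2 ∂μ := by
    refine integral_congr_ae ?_
    filter_upwards [hae] with ω hω
    rw [hω]
  have hI := (hL.sub (memLp_const (e + (Γ - Γ⁻¹) * m))).integrable_sq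
  have hI2 : Integrable (fun ω => 2 * ((∑ i ∈ Finset.range n, Z (D i ω)) / n -
      (e + (Γ - Γ⁻¹) * m)) ^ 2) μ := hI.const_mul _
  have hbias2 : (m - a) ^ 2 ≤ (biasConst M Mf Mf2 MQ2 Mu2K d * h ^ 2) ^ 2 := by
    rw [← sq_abs (m - a)]
    gcongr
  rw [hmse]
  -- Split into the fluctuation around the exact mean and the bias; the factor `2` here and the one
  -- in the second moment of `Z` produce the constants `4`.
  calc _ ≤ ∫ ω, (2 * ((∑ i ∈ Finset.range n, Z (D i ω)) / n - (e + (Γ - Γ⁻¹) * m)) ^ 2 +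
        2 * ((Γ - Γ⁻¹) * (m - a)) ^ 2) ∂μ := by
        refine integral_mono_of_nonneg (Eventually.of_forall fun ω => sq_nonneg _)
          (hI2.add (integrable_const _)) (Eventually.of_forall fun ω => ?_)
        refine le_trans (le_of_eq ?_) (add_sq_le_two _ _)
        ring
    _ = 2 * (∫ ω, ((∑ i ∈ Finset.range n, Z (D i ω)) / n - (e + (Γ - Γ⁻¹) * m)) ^ 2 ∂μ) +
        2 * ((Γ - Γ⁻¹) * (m - a)) ^ 2 := by
        rw [integral_add hI2 (integrable_const _), integral_const_mul]
        simp
    _ ≤ 2 * ((2 * M ^ 2 + 2 * Γ ^ 2 * (4 * M ^ 2 * MK2 / (mf * h))) / n) +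
        2 * ((Γ - Γ⁻¹) ^ 2 * (biasConst M Mf Mf2 MQ2 Mu2K d * h ^ 2) ^ 2) := by
        rw [mul_pow]
        gcongr
        refine hmean.trans ?_
        gcongr
    _ = _ := by
        unfold mseBound
        field_simp
        ring

end Estimators

lemma mseBound_mono {A₁ A₂ A C₁ C₂ C h : ℝ} {n : ℕ} (hh : 0 < h) (h₁ : A₁ ≤ C₁) (h₂ : A₂ ≤ C₂)
    (h₃ : A ≤ C) : mseBound A₁ A₂ A n h ≤ mseBound C₁ C₂ C n h := by
  unfold mseBound
  gcongr

end APOBounds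

/-! ### Choice of the constants and conclusion. -/

theorem theorem2 (Γ mf MY MK2 Mu2K Mf Mf2 MQ2 d : ℝ) (hΓ : 1 ≤ Γ) (hmf : 0 < mf) (hd : 0 < d) :
    ∃ C₁ C₂ C : ℝ, 0 < C₁ ∧ 0 < C₂ ∧ 0 < C ∧
      -- the optimal bandwidth exists, is unique, and is of order `n ^ (-1/5)`
      (∀ n : ℕ, 1 ≤ n → ∃! h : ℝ, APOBounds.IsOptimalBandwidth C₁ C₂ C n h) ∧
      (∀ hstar : ℕ → ℝ,
        (∀ n : ℕ, 1 ≤ n → APOBounds.IsOptimalBandwidth C₁ C₂ C n (hstar n)) →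
        hstar =O[atTop] fun n : ℕ => (n : ℝ) ^ (-(1 / 5) : ℝ)) ∧
      ∀ {Ω 𝒳 : Type*} [MeasurableSpace Ω] [MeasurableSpace 𝒳]
        (μ : Measure Ω) [IsProbabilityMeasure μ] (PX : Measure 𝒳) [IsProbabilityMeasure PX]
        (𝒯 𝒴 : Set ℝ) (fT : 𝒳 → ℝ → ℝ) (fY : 𝒳 → ℝ → ℝ → ℝ) (K : ℝ → ℝ) (τ : ℝ)
        (D : ℕ → Ω → 𝒳 × ℝ × ℝ),
        Ioo (τ - d) (τ + d) ⊆ 𝒯 →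
        APOBounds.ArePositiveDensities 𝒯 𝒴 fT fY mf →
        APOBounds.IsKernel K MK2 Mu2K →
        (∀ y ∈ 𝒴, |y| ≤ MY) →
        APOBounds.IsRegularDensity 𝒯 𝒴 fY τ Mf Mf2 →
        APOBounds.IsRegularQuantile 𝒯 𝒴 fY MQ2 →
        APOBounds.IsIIDSample μ D (APOBounds.jointLaw PX 𝒯 𝒴 fT fY) →
        ∀ (form : APOBounds.Form) (s : APOBounds.Side),
          -- the bound on the mean squared error
          (∀ n : ℕ, 1 ≤ n → ∀ h : ℝ, 0 < h →
            MemLp (fun ω => APOBounds.estimator form s Γ 𝒴 fT fY K τ n h fun i => D i ω) 2 μ ∧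
            APOBounds.mse μ
                (fun ω => APOBounds.estimator form s Γ 𝒴 fT fY K τ n h fun i => D i ω)
                (APOBounds.apoBound s Γ PX 𝒯 𝒴 fY τ) ≤
              APOBounds.mseBound C₁ C₂ C n h) ∧
          -- the rate at the optimal bandwidth
          (∀ hstar : ℕ → ℝ,
            (∀ n : ℕ, 1 ≤ n → APOBounds.IsOptimalBandwidth C₁ C₂ C n (hstar n)) →
            (fun n : ℕ => APOBounds.mse μ
                (fun ω => APOBounds.estimator form s Γ 𝒴 fT fY K τ n (hstar n) fun i => D i ω)
                (APOBounds.apoBound s Γ PX 𝒯 𝒴 fY τ))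
              =O[atTop] fun n : ℕ => (n : ℝ) ^ (-(4 / 5) : ℝ)) ∧
          -- convergence in `L²`
          (∀ h : ℕ → ℝ, (∀ n : ℕ, 1 ≤ n → 0 < h n) → Tendsto h atTop (𝓝 0) →
            Tendsto (fun n : ℕ => (n : ℝ) * h n) atTop atTop →
            Tendsto (fun n : ℕ => eLpNorm
                (fun ω => APOBounds.estimator form s Γ 𝒴 fT fY K τ n (h n) (fun i => D i ω) -
                  APOBounds.apoBound s Γ PX 𝒯 𝒴 fY τ) 2 μ) atTop (𝓝 0)) := by
  have hV := le_abs_self (4 * MY ^ 2 * MK2 / mf)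
  have hV0 := abs_nonneg (4 * MY ^ 2 * MK2 / mf)
  -- The constants are fixed before any model, so the sign of `MK2` is not yet known: hence the
  -- absolute value. Adding `1` keeps them positive in degenerate cases such as `Γ = 1`, as
  -- uniqueness of the optimal bandwidth requires. Sums in `C₁` and the larger coefficients in `C₂`
  -- and `C` cover both forms.
  set V := |4 * MY ^ 2 * MK2 / mf|
  set b := APOBounds.biasConst MY Mf Mf2 MQ2 Mu2K d
  have hC₁ : 0 < (21 * (Γ - Γ⁻¹) ^ 2 + 4 * Γ ^ 2) * V + 1 := by positivity
  have hC₂ : 0 < 4 * MY ^ 2 + 1 := by positivity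
  have hC : 0 < 3 * (Γ - Γ⁻¹) ^ 2 * b ^ 2 + 1 := by positivity
  refine ⟨(21 * (Γ - Γ⁻¹) ^ 2 + 4 * Γ ^ 2) * V + 1, 4 * MY ^ 2 + 1,
    3 * (Γ - Γ⁻¹) ^ 2 * b ^ 2 + 1, hC₁, hC₂, hC,
    fun n hn => APOBounds.existsUnique_isOptimalBandwidth hC₁ hC hn,
    fun hstar hopt => APOBounds.isBigO_optimalBandwidth hC₁ hC hopt, ?_⟩
  intro Ω 𝒳 _ _ μ _ PX _ 𝒯 𝒴 fT fY K τ D h𝒯 hf hK hM hrf hrq hD form s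
  have main : ∀ n : ℕ, 1 ≤ n → ∀ h : ℝ, 0 < h →
      MemLp (fun ω => APOBounds.estimator form s Γ 𝒴 fT fY K τ n h fun i => D i ω) 2 μ ∧
      APOBounds.mse μ
        (fun ω => APOBounds.estimator form s Γ 𝒴 fT fY K τ n h fun i => D i ω)
        (APOBounds.apoBound s Γ PX 𝒯 𝒴 fY τ) ≤
      APOBounds.mseBound ((21 * (Γ - Γ⁻¹) ^ 2 + 4 * Γ ^ 2) * V + 1) (4 * MY ^ 2 + 1)
        (3 * (Γ - Γ⁻¹) ^ 2 * b ^ 2 + 1) n h := by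
    intro n hn h hh
    have hsq : 0 ≤ (Γ - Γ⁻¹) ^ 2 * b ^ 2 := by positivity
    have hsV : 0 ≤ (Γ - Γ⁻¹) ^ 2 * V := by positivity
    have hΓV : 0 ≤ Γ ^ 2 * V := by positivity
    cases form
    · obtain ⟨h1, h2⟩ := hf.mse_tail_le hM hΓ hmf hd h𝒯 hK hrf hrq hD s hn hh
      refine ⟨h1, h2.trans (APOBounds.mseBound_mono hh ?_ ?_ ?_)⟩
      · have := mul_le_mul_of_nonneg_left hV (show 0 ≤ 21 * (Γ - Γ⁻¹) ^ 2 by positivity)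
        linarith
      · linarith [sq_nonneg MY]
      · linarith
    · obtain ⟨h1, h2⟩ := hf.mse_sign_le hM hΓ hmf hd h𝒯 hK hrf hrq hD s hn hh
      refine ⟨h1, h2.trans (APOBounds.mseBound_mono hh ?_ ?_ ?_)⟩
      · have := mul_le_mul_of_nonneg_left hV (show 0 ≤ 4 * Γ ^ 2 by positivity)
        linarith
      · linarith
      · linarith
  refine ⟨main, fun hstar hopt => ?_, fun h hpos h0 hn => ?_⟩
  · exact APOBounds.isBigO_of_le_mseBound hC₁ hC₂ hC hopt
      (fun n => APOBounds.mse_nonneg _ _ _) fun n hn => (main n hn _ (hopt n hn).1).2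
  · exact APOBounds.tendsto_eLpNorm_of_le_mseBound (fun n hn => (main n hn _ (hpos n hn)).1)
      (fun n hn => (main n hn _ (hpos n hn)).2) h0 hn
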